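/- **Setting.** Let $M$ be a smooth 5-manifold. A *Monge–Ampère system* on $M$ consists of smooth forms $\theta\in\Omega^1(M)$, $\Psi\in\Omega^2(M)$ with $\theta\wedge d\theta\wedge d\theta\neq0$ everywhere and $\Psi\wedge d\theta\equiv0 \pmod\theta$; $\varepsilon=\{\theta,d\theta,\Psi\}$ denotes the ideal of differential forms generated by $\theta,d\theta,\Psi$. It is *elliptic* if at each point $\Psi\wedge\Psi$ is, modulo $\theta$, a positive multiple of $d\theta\wedge d\theta$. **The matrix $S_2$.** A *reduced coframing* on an open set $U\subset M$ consists of a smooth real 1-form $\pi^0$ and smooth complex 1-forms $\pi^1,\pi^2$ such that $(\pi^0,\pi^1,\pi^2,\bar\pi^1,\bar\pi^2)$ is a coframing, $\pi^0=a\theta$ with $a$ nowhere zero, $\Psi\equiv\mu\,\mathrm{Re}(\pi^1\wedge\pi^2)\pmod{\pi^0}$ with $\mu$ nowhere zero, and there exist a smooth real 1-form $\psi^0_0$, smooth complex 1-forms $\psi^i_j$ with $\psi^1_1+\psi^2_2=\psi^0_0$, and smooth complex functions $P^i_j$ ($i,j=1,2$) satisfying $$d\pi^0=-\psi^0_0\wedge\pi^0+\tfrac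 i2(\bar\pi^1\wedge\bar\pi^2-\pi^1\wedge\pi^2),$$ $$d\pi^i=-\psi^i_1\wedge\pi^1-\psi^i_2\wedge\pi^2-P^i_1\,\bar\pi^1\wedge\pi^0-P^i_2\,\bar\pi^2\wedge\pi^0\qquad(i=1,2).$$ Put $$S_2=\begin{pmatrix}P^1_1-\overline{P^2_2}&\overline{P^1_2}+P^1_2\\ P^2_1+\overline{P^2_1}&\overline{P^1_1}-P^2_2\end{pmatrix}.$$ The system *satisfies $S_2=0$* if $S_2$ vanishes identically for every reduced coframing on every open set $U\subset M$ and all such $\psi, P$. **Euler–Lagrange systems.** An *Euler–Lagrange system* on an open set $V\subset\mathbb R^5$ is an ideal $\{\theta',d\theta',\Psi'\}$, with $\theta'$ a smooth 1-form on $V$ satisfying $\theta'\wedge d\theta'\wedge d\theta'\ne0$ and $\Psi'$ a smooth 2-form on $V$ such that $\theta'\wedge\Psi'$ is the Poincaré–Cartan form of some Lagrangian $\Lambda\in\Omega^2(V)$, i.e. $\theta'\wedge\Psi'=d(\Lambda-\theta'\wedge\beta)$ for some $\beta\in\Omega^1(V)$. The Monge–Ampère system is *locally equivalent to an Euler–Lagrange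 system* if every point of $M$ has an open neighbourhood with a diffeomorphism onto an open set $V\subset\mathbb R^5$ which pulls back some Euler–Lagrange system on $V$ to $\varepsilon$. **Theorem 3.3.** For an elliptic Monge–Ampère system $(M,\varepsilon)$ the following are equivalent: 1. $S_2=0$; 2. $(M,\varepsilon)$ is locally equivalent to an Euler–Lagrange system; 3. every point of $M$ has an open neighbourhood $U$ with a reduced coframing and a smooth function $\lambda>0$ on $U$ such that $\lambda\,\pi^0\wedge\mathrm{Re}(\pi^1\wedge\pi^2)$ belongs to $\varepsilon$ on $U$ and is closed. -/

import Mathlib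

open scoped Manifold ContDiff ComplexConjugate

noncomputable section

namespace MongeAmpere

/-! ### Exterior algebra -/

section Wedge

variable {E : Type*} [AddCommGroup E] [Module ℝ E] [TopologicalSpace E]
variable {A : Type*} [NormedCommRing A] [NormedAlgebra ℝ A]

/-- The tensor product `(α ⊗ β)(v₁, …, v_{p+q}) = α(v₁, …, v_p) β(v_{p+1}, …, v_{p+q})`. -/
def tensor {p q : ℕ} (α : E [⋀^Fin p]→L[ℝ] A) (β : E [⋀^Fin q]→L[ℝ] A) :
    ContinuousMultilinearMap ℝ (fun _ : Fin (p + q) => E) A where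
  toFun v := α (fun i => v (Fin.castAdd q i)) * β (fun j => v (Fin.natAdd p j))
  map_update_add' {inst} v i x y := by
    rw [Subsingleton.elim inst (inferInstance : DecidableEq (Fin (p + q)))]
    have hL : ∀ (k : Fin p) (z : E), (fun j => Function.update v (Fin.castAdd q k) z
        (Fin.castAdd q j)) = Function.update (fun j => v (Fin.castAdd q j)) k z := fun k z =>
      Function.update_comp_eq_of_injective v (Fin.castAdd_injective p q) k z
    have hR : ∀ (k : Fin q) (z : E), (fun j => Function.update v (Fin.natAdd p k) z
        (Fin.natAdd p j)) = Function.update (fun j => v (Fin.natAdd p j)) k z := fun k z =>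
      Function.update_comp_eq_of_injective v (Fin.natAdd_injective q p) k z
    have hLR : ∀ (k : Fin p) (z : E), (fun j => Function.update v (Fin.castAdd q k) z
        (Fin.natAdd p j)) = fun j => v (Fin.natAdd p j) := fun k z => by
      funext j
      exact Function.update_of_ne (by simp [Fin.ext_iff]; omega) _ _
    have hRL : ∀ (k : Fin q) (z : E), (fun j => Function.update v (Fin.natAdd p k) z
        (Fin.castAdd q j)) = fun j => v (Fin.castAdd q j) := fun k z => by
      funext j
      exact Function.update_of_ne (by simp [Fin.ext_iff]; omega) _ _
    refine Fin.addCases (fun k => ?_) (fun k => ?_) i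
    · simp only [hL, hLR, ContinuousAlternatingMap.map_update_add, add_mul]
    · simp only [hR, hRL, ContinuousAlternatingMap.map_update_add, mul_add]
  map_update_smul' {inst} v i c x := by
    rw [Subsingleton.elim inst (inferInstance : DecidableEq (Fin (p + q)))]
    have hL : ∀ (k : Fin p) (z : E), (fun j => Function.update v (Fin.castAdd q k) z
        (Fin.castAdd q j)) = Function.update (fun j => v (Fin.castAdd q j)) k z := fun k z =>
      Function.update_comp_eq_of_injective v (Fin.castAdd_injective p q) k z
    have hR : ∀ (k : Fin q) (z : E), (fun j => Function.update v (Fin.natAdd p k) z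
        (Fin.natAdd p j)) = Function.update (fun j => v (Fin.natAdd p j)) k z := fun k z =>
      Function.update_comp_eq_of_injective v (Fin.natAdd_injective q p) k z
    have hLR : ∀ (k : Fin p) (z : E), (fun j => Function.update v (Fin.castAdd q k) z
        (Fin.natAdd p j)) = fun j => v (Fin.natAdd p j) := fun k z => by
      funext j
      exact Function.update_of_ne (by simp [Fin.ext_iff]; omega) _ _
    have hRL : ∀ (k : Fin q) (z : E), (fun j => Function.update v (Fin.natAdd p k) z
        (Fin.castAdd q j)) = fun j => v (Fin.castAdd q j) := fun k z => by
      funext j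
      exact Function.update_of_ne (by simp [Fin.ext_iff]; omega) _ _
    refine Fin.addCases (fun k => ?_) (fun k => ?_) i
    · simp only [hL, hLR, ContinuousAlternatingMap.map_update_smul, smul_mul_assoc]
    · simp only [hR, hRL, ContinuousAlternatingMap.map_update_smul, mul_smul_comm]
  cont := by
    refine Continuous.mul ?_ ?_
    · exact α.cont.comp (continuous_pi fun i => continuous_apply _)
    · exact β.cont.comp (continuous_pi fun i => continuous_apply _)

/-- The wedge product, in the determinant normalization:
`(α ∧ β)(v) = (1 / (p! q!)) ∑_σ sign(σ) α(v_{σ 1}, …, v_{σ p}) β(v_{σ (p+1)}, …, v_{σ (p+q)})`.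
It matches the normalization of `extDeriv`. -/
def wedge {p q : ℕ} (α : E [⋀^Fin p]→L[ℝ] A) (β : E [⋀^Fin q]→L[ℝ] A) :
    E [⋀^Fin (p + q)]→L[ℝ] A :=
  ((p.factorial * q.factorial : ℝ)⁻¹) •
    ContinuousMultilinearMap.alternatization (tensor α β)

/-- Real part of a complex-valued alternating form. -/
def reForm {k : ℕ} (α : E [⋀^Fin k]→L[ℝ] ℂ) : E [⋀^Fin k]→L[ℝ] ℝ :=
  Complex.reCLM.compContinuousAlternatingMap α

/-- Imaginary part of a complex-valued alternating form. -/
def imForm {k : ℕ} (α : E [⋀^Fin k]→L[ℝ] ℂ) : E [⋀^Fin k]→L[ℝ] ℝ :=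
  Complex.imCLM.compContinuousAlternatingMap α

/-- Complex conjugate of a complex-valued alternating form. -/
def conjForm {k : ℕ} (α : E [⋀^Fin k]→L[ℝ] ℂ) : E [⋀^Fin k]→L[ℝ] ℂ :=
  (Complex.conjCLE : ℂ →L[ℝ] ℂ).compContinuousAlternatingMap α

/-- A real alternating form, regarded as a complex-valued one. -/
def ofRealForm {k : ℕ} (α : E [⋀^Fin k]→L[ℝ] ℝ) : E [⋀^Fin k]→L[ℝ] ℂ :=
  Complex.ofRealCLM.compContinuousAlternatingMap α

/-- `η ≡ η' mod θ` for `(k+1)`-covectors and a 1-covector `θ`. -/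
def ModEq {k : ℕ} (θ : E [⋀^Fin 1]→L[ℝ] A) (η η' : E [⋀^Fin (k + 1)]→L[ℝ] A) : Prop :=
  ∃ γ : E [⋀^Fin k]→L[ℝ] A, η - η' = wedge γ θ

end Wedge

/-! ### Differential forms on a 5-dimensional manifold -/

/-- The model space of the 5-dimensional manifolds considered here. -/
abbrev R5 : Type := EuclideanSpace ℝ (Fin 5)

section Forms

variable {M : Type*} [TopologicalSpace M] [ChartedSpace R5 M]
variable {F : Type*} [NormedAddCommGroup F] [NormedSpace ℝ F]

/-- (Not necessarily smooth) differential `k`-forms on `M` with values in `F`. -/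
abbrev Form (M : Type*) [TopologicalSpace M] [ChartedSpace R5 M]
    (F : Type*) [NormedAddCommGroup F] [NormedSpace ℝ F] (k : ℕ) : Type _ :=
  (x : M) → (TangentSpace 𝓘(ℝ, R5) x) [⋀^Fin k]→L[ℝ] F

/-- Pullback of a form along a map between 5-manifolds. -/
def pullback {N : Type*} [TopologicalSpace N] [ChartedSpace R5 N] {k : ℕ}
    (f : M → N) (η : Form N F k) : Form M F k :=
  fun x => (η (f x)).compContinuousLinearMap (mfderiv 𝓘(ℝ, R5) 𝓘(ℝ, R5) f x)

/-- The expression of a form in the chart `e`, i.e. its pullback under `e.symm`, as a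
form on the vector space `ℝ⁵` (meaningful on `e.target`). -/
def inChart {k : ℕ} (e : OpenPartialHomeomorph M R5) (η : Form M F k) :
    R5 → R5 [⋀^Fin k]→L[ℝ] F :=
  pullback (M := R5) (N := M) e.symm η

/-- `η` is smooth on the open set `U`: its expression in every chart of the smooth structure is. -/
def SmoothFormOn {k : ℕ} (η : Form M F k) (U : Set M) : Prop :=
  ∀ e ∈ IsManifold.maximalAtlas 𝓘(ℝ, R5) ∞ M,
    ContDiffOn ℝ ∞ (inChart e η) (e.target ∩ e.symm ⁻¹' U)

/-- Exterior derivative of a form on `M`, computed in the preferred chart at each point. -/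
def extD {k : ℕ} (η : Form M F k) : Form M F (k + 1) := fun x =>
  (extDeriv (inChart (chartAt R5 x) η) (chartAt R5 x x)).compContinuousLinearMap
    (mfderiv 𝓘(ℝ, R5) 𝓘(ℝ, R5) (chartAt R5 x) x)

/-- `θ` is a contact form on `U`: it is smooth and `θ ∧ dθ ∧ dθ ≠ 0` everywhere on `U`. -/
structure IsContactFormOn (θ : Form M ℝ 1) (U : Set M) : Prop where
  smooth : SmoothFormOn θ U
  nondegenerate : ∀ x ∈ U, wedge (θ x) (wedge (extD θ x) (extD θ x)) ≠ 0

/-- Membership of a `k`-form, over the open set `U`, in the ideal `{θ, dθ, Ψ}` of `Ω*(U)`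
generated algebraically by `θ`, `dθ` and `Ψ`. -/
def MemIdeal (U : Set M) (θ : Form M ℝ 1) (Ψ : Form M ℝ 2) : (k : ℕ) → Form M ℝ k → Prop
  | 0, η => ∀ x ∈ U, η x = 0
  | 1, η => ∃ a : Form M ℝ 0, SmoothFormOn a U ∧ ∀ x ∈ U, η x = wedge (a x) (θ x)
  | k + 2, η => ∃ (a : Form M ℝ (k + 1)) (b c : Form M ℝ k),
      SmoothFormOn a U ∧ SmoothFormOn b U ∧ SmoothFormOn c U ∧
      ∀ x ∈ U, η x = wedge (a x) (θ x) + wedge (b x) (extD θ x) + wedge (c x) (Ψ x)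

/-- The ideals `{θ, dθ, Ψ}` and `{θ', dθ', Ψ'}` of `Ω*(U)` coincide. -/
def SameIdeal (U : Set M) (θ : Form M ℝ 1) (Ψ : Form M ℝ 2)
    (θ' : Form M ℝ 1) (Ψ' : Form M ℝ 2) : Prop :=
  ∀ (k : ℕ) (η : Form M ℝ k), MemIdeal U θ Ψ k η ↔ MemIdeal U θ' Ψ' k η

/-- `{θ, dθ, Ψ}` is an Euler–Lagrange system on `U`: for some Lagrangian 2-form `Λ`, the form
`θ ∧ Ψ` is the Poincaré–Cartan form of `Λ`, i.e. `θ ∧ Ψ = d(Λ - θ ∧ β)` for a 1-form `β`. -/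
def IsEulerLagrangeOn (U : Set M) (θ : Form M ℝ 1) (Ψ : Form M ℝ 2) : Prop :=
  IsContactFormOn θ U ∧ SmoothFormOn Ψ U ∧
  ∃ (Λ : Form M ℝ 2) (β : Form M ℝ 1), SmoothFormOn Λ U ∧ SmoothFormOn β U ∧
    ∀ x ∈ U, wedge (θ x) (Ψ x) = extD (fun y => Λ y - wedge (θ y) (β y)) x

end Forms

/-! ### Monge–Ampère systems -/

/-- A Monge–Ampère system `(M, {θ, dθ, Ψ})`: a contact form `θ` and a 2-form `Ψ` with
`Ψ ∧ dθ ≡ 0 mod θ`. -/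
structure MongeAmpereSystem (M : Type*) [TopologicalSpace M] [ChartedSpace R5 M] where
  θ : Form M ℝ 1
  Ψ : Form M ℝ 2
  contact : IsContactFormOn θ Set.univ
  smooth : SmoothFormOn Ψ Set.univ
  primitive : ∀ x, ModEq (k := 3) (θ x) (wedge (p := 2) (q := 2) (Ψ x) (extD θ x)) 0

section Systems

variable {M : Type*} [TopologicalSpace M] [ChartedSpace R5 M]

/-- Ellipticity: `Ψ ∧ Ψ` is a positive multiple of `dθ ∧ dθ` modulo `θ`. -/
def MongeAmpereSystem.IsElliptic (S : MongeAmpereSystem M) : Prop :=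
  ∀ x, ∃ c : ℝ, 0 < c ∧ ModEq (k := 3) (S.θ x) (wedge (p := 2) (q := 2) (S.Ψ x) (S.Ψ x))
    (c • wedge (extD S.θ x) (extD S.θ x))

/-- A local coframing `(π⁰, π¹, π², π̄¹, π̄²)` over `U` adapted to the system: `π⁰` is a section of
the contact line bundle, `dπ⁰ ≡ Im(π¹ ∧ π²) = (i/2)(π̄¹ ∧ π̄² - π¹ ∧ π²)` modulo `π⁰`, and modulo
`π⁰` the form `Ψ` is a multiple of `Re(π¹ ∧ π²)`, so that the ideal of the system is
`{π⁰, dπ⁰, Re(π¹ ∧ π²)}`. The entries `π¹`, `π²` are `π 0`, `π 1`. -/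
structure AdaptedCoframing (S : MongeAmpereSystem M) (U : Set M) where
  π₀ : Form M ℝ 1
  π : Fin 2 → Form M ℂ 1
  smooth₀ : SmoothFormOn π₀ U
  smooth : ∀ i, SmoothFormOn (π i) U
  coframe : ∀ x ∈ U, ∀ v : TangentSpace 𝓘(ℝ, R5) x,
    π₀ x (fun _ => v) = 0 → (∀ i, π i x (fun _ => v) = 0) → v = 0
  contact : ∀ x ∈ U, ∃ a : ℝ, a ≠ 0 ∧ π₀ x = a • S.θ x
  dcontact : ∀ x ∈ U,
    ModEq (k := 1) (π₀ x) (extD π₀ x) (imForm (wedge (π 0 x) (π 1 x)))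
  psi : ∀ x ∈ U, ∃ μ : ℝ, μ ≠ 0 ∧
    ModEq (k := 1) (π₀ x) (S.Ψ x) (μ • reForm (wedge (π 0 x) (π 1 x)))

/-- Pseudo-connection forms and torsion coefficients for which an adapted coframing satisfies
the reduced structure equations (fully absorbed, with the torsion `U¹, U²` normalized to zero):

`dπ⁰ = -ψ⁰₀ ∧ π⁰ + Im(π¹ ∧ π²)`,

`dπⁱ = -ψⁱ₁ ∧ π¹ - ψⁱ₂ ∧ π² - Pⁱ₁ π̄¹ ∧ π⁰ - Pⁱ₂ π̄² ∧ π⁰`, `i = 1, 2`,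

with `ψ⁰₀` real and `ψ¹₁ + ψ²₂ = ψ⁰₀`. A coframing admitting such data is a section of the
reduced structure bundle. -/
structure ReducedStructure {S : MongeAmpereSystem M} {U : Set M}
    (c : AdaptedCoframing S U) where
  ψ₀ : Form M ℝ 1
  ψ : Fin 2 → Fin 2 → Form M ℂ 1
  P : M → Matrix (Fin 2) (Fin 2) ℂ
  smooth₀ : SmoothFormOn ψ₀ U
  smooth : ∀ i j, SmoothFormOn (ψ i j) U
  smoothP : ∀ i j, ContMDiffOn 𝓘(ℝ, R5) 𝓘(ℝ, ℂ) ∞ (fun x => P x i j) U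
  trace : ∀ x ∈ U, ψ 0 0 x + ψ 1 1 x = ofRealForm (ψ₀ x)
  eq₀ : ∀ x ∈ U, extD c.π₀ x =
    -wedge (ψ₀ x) (c.π₀ x) + imForm (wedge (c.π 0 x) (c.π 1 x))
  eq : ∀ x ∈ U, ∀ i, extD (c.π i) x =
    -(∑ j, wedge (ψ i j x) (c.π j x))
      - ∑ j, P x i j • wedge (conjForm (c.π j x)) (ofRealForm (c.π₀ x))

/-- The matrix `S₂` built from the torsion coefficients `P = (Pⁱⱼ)`. -/
def S₂ (P : Matrix (Fin 2) (Fin 2) ℂ) : Matrix (Fin 2) (Fin 2) ℂ :=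
  !![P 0 0 - conj (P 1 1), conj (P 0 1) + P 0 1;
     P 1 0 + conj (P 1 0), conj (P 0 0) - P 1 1]

/-- `S₂ = 0`: the matrix function `S₂` vanishes at every point of the reduced structure bundle,
i.e. along all its local sections. -/
def S₂Vanishes (S : MongeAmpereSystem M) : Prop :=
  ∀ (U : Set M), IsOpen U → ∀ (c : AdaptedCoframing S U) (r : ReducedStructure c),
    ∀ x ∈ U, S₂ (r.P x) = 0

/-- The system is locally equivalent to an Euler–Lagrange system: every point has an open
neighbourhood with a diffeomorphism `φ` onto an open subset of `ℝ⁵` that carries an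
Euler–Lagrange system `{θ', dθ', Ψ'}` whose pullback is the given system. -/
def IsLocallyEulerLagrange (S : MongeAmpereSystem M) : Prop :=
  ∀ x : M, ∃ φ : OpenPartialHomeomorph M R5, x ∈ φ.source ∧
    ContMDiffOn 𝓘(ℝ, R5) 𝓘(ℝ, R5) ∞ φ φ.source ∧
    ContMDiffOn 𝓘(ℝ, R5) 𝓘(ℝ, R5) ∞ φ.symm φ.target ∧
    ∃ (θ' : Form R5 ℝ 1) (Ψ' : Form R5 ℝ 2), IsEulerLagrangeOn φ.target θ' Ψ' ∧
      SameIdeal φ.source S.θ S.Ψ (pullback φ θ') (pullback φ Ψ')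

/-- The form `λ π⁰ ∧ Re(π¹ ∧ π²)`. -/
def pcForm {S : MongeAmpereSystem M} {U : Set M} (c : AdaptedCoframing S U) (l : M → ℝ) :
    Form M ℝ 3 :=
  fun x => l x • wedge (c.π₀ x) (reForm (wedge (c.π 0 x) (c.π 1 x)))

/-- `λ π⁰ ∧ Re(π¹ ∧ π²)` is, on `V`, a closed form in the ideal of the system, for the smooth
positive function `λ`. -/
structure IsClosedPCForm {S : MongeAmpereSystem M} {U : Set M} (c : AdaptedCoframing S U)
    (l : M → ℝ) (V : Set M) : Prop where
  smooth : ContMDiffOn 𝓘(ℝ, R5) 𝓘(ℝ, ℝ) ∞ l V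
  pos : ∀ x ∈ V, 0 < l x
  mem : MemIdeal V S.θ S.Ψ 3 (pcForm c l)
  closed : ∀ x ∈ V, extD (pcForm c l) x = 0

/-- Near every point, the ideal of the system contains a closed Poincaré–Cartan form
`λ π⁰ ∧ Re(π¹ ∧ π²)`, `λ > 0`, for some section of the reduced structure bundle. -/
def HasClosedPCForm (S : MongeAmpereSystem M) : Prop :=
  ∀ x : M, ∃ (U : Set M), IsOpen U ∧ x ∈ U ∧
    ∃ (c : AdaptedCoframing S U) (l : M → ℝ), Nonempty (ReducedStructure c) ∧
      IsClosedPCForm c l U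

end Systems

end MongeAmpere

end

/-! Write Ω = π¹ ∧ π² and ρ = π⁰ ∧ Re Ω. The trace condition ψ¹₁ + ψ²₂ = ψ⁰₀ collapses the structure
equations to dΩ = -ψ⁰₀ ∧ Ω + π⁰ ∧ Q, where Q combines the forms π̄ʲ ∧ πᵏ with coefficients ±P. Since
Ω ∧ Ω = 0, this gives dρ = -2ψ⁰₀ ∧ ρ (`extDeriv_pcLocal_reduced`), so λρ is closed exactly when d
log λ ≡ 2ψ⁰₀ mod π⁰. The identity d(dπ⁰) = 0 gives dψ⁰₀ ∧ π⁰ = π⁰ ∧ Im Q (`extDeriv_psi_reduced`),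
and the entries of S₂ are, up to sign and a common factor, the coefficients of Im Q.

If S₂ = 0, then dψ⁰₀ is a multiple of π⁰. Differentiating once more and using that Im Ω is
nondegenerate on the contact planes forces dψ⁰₀ = 0. On a ball ψ⁰₀ = dg, and exp(2g) ρ is closed
(`exists_closed_pcLocal`).

Conversely, let λρ be closed with λ nowhere zero. Then ψ⁰₀ = ½ d log|λ| + f π⁰, so Im Q ≡ dψ⁰₀ ≡ f
Im Ω mod π⁰. But Im Q has type (1,1) and Im Ω type (2,0) + (0,2), so both sides vanish and S₂ = 0
(`S₂_eq_zero_of_closed`). Up to a nonvanishing factor ρ is θ ∧ Ψ, so one closed form tests every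
reduced coframing at once.

For Euler–Lagrange systems: a closed λρ equals θ ∧ HΨ, and a primitive of it on a ball is a
Lagrangian. In the other direction θ' ∧ Ψ' is exact, and comparing ideals shows that it is a
nonvanishing multiple of ρ (`wedge_eq_smul_pcLocal_of_closed`).

A universal statement about reduced coframings says something only once one exists, and ellipticity
provides it: after scaling, the square of mΨ + i dθ vanishes mod θ, so this form is decomposable
there (`exists_isCoframing`). Adding multiples of θ to the factors removes the π̄¹ ∧ π̄² torsion,
and the rest is absorbed in `exists_reduced`. All computations are made in charts. -/

noncomputable section

namespace MongeAmpere

/-! ### Explicit values of wedge products -/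

section WedgeEval

variable {E : Type*} [AddCommGroup E] [Module ℝ E] [TopologicalSpace E]
variable {A : Type*} [NormedCommRing A] [NormedAlgebra ℝ A]

theorem wedge_apply {p q : ℕ} (α : E [⋀^Fin p]→L[ℝ] A) (β : E [⋀^Fin q]→L[ℝ] A)
    (v : Fin (p + q) → E) :
    wedge α β v = ((p.factorial * q.factorial : ℝ)⁻¹) • ∑ σ : Equiv.Perm (Fin (p + q)),
      Equiv.Perm.sign σ • (α (fun i => v (σ (Fin.castAdd q i))) * β (fun j => v (σ (Fin.natAdd p j)))) := by
  rw [wedge, ContinuousAlternatingMap.smul_apply, ContinuousMultilinearMap.alternatization_apply_apply]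
  rfl

/-- A permutation is split into the image p of 0 and a permutation of the remaining entries; since β
is alternating, the latter contributes k! equal terms. The entry p is brought to the front by a
transposition, not a cycle, so the sign is -1 for every p ≠ 0 instead of (-1)^p. -/
theorem sum_perm_sign_smul {k : ℕ} (a : E → A) (β : E [⋀^Fin k]→L[ℝ] A) (v : Fin (k + 1) → E) :
    ∑ σ : Equiv.Perm (Fin (k + 1)), Equiv.Perm.sign σ • (a (v (σ 0)) * β (fun j => v (σ j.succ)))
      = (k.factorial : ℝ) • ∑ p : Fin (k + 1), (if p = 0 then (1 : ℤˣ) else -1) •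
        (a (v p) * β (fun j => v (Equiv.swap 0 p j.succ))) := by
  rw [← Equiv.Perm.decomposeFin.symm.sum_comp, Fintype.sum_prod_type, Finset.smul_sum]
  refine Finset.sum_congr rfl fun p _ => ?_
  have h : ∀ e : Equiv.Perm (Fin k), Equiv.Perm.sign (Equiv.Perm.decomposeFin.symm (p, e)) •
      (a (v (Equiv.Perm.decomposeFin.symm (p, e) 0)) *
        β (fun j => v (Equiv.Perm.decomposeFin.symm (p, e) j.succ))) =
      (if p = 0 then (1 : ℤˣ) else -1) • (a (v p) * β (fun j => v (Equiv.swap 0 p j.succ))) := by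
    intro e
    have h1 := β.toAlternatingMap.map_perm (fun j => v (Equiv.swap 0 p j.succ)) e
    simp only [Function.comp_def, ContinuousAlternatingMap.coe_toAlternatingMap] at h1
    simp only [Equiv.Perm.decomposeFin_symm_apply_zero, Equiv.Perm.decomposeFin_symm_apply_succ,
      Equiv.Perm.decomposeFin.symm_sign, h1]
    rw [mul_smul, mul_smul_comm, ← mul_smul (Equiv.Perm.sign e), Int.units_mul_self, one_smul]
  simp only [h, Finset.sum_const, Finset.card_univ, Fintype.card_perm, Fintype.card_fin]
  rw [Nat.cast_smul_eq_nsmul]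


theorem apply_swap (β : E [⋀^Fin 2]→L[ℝ] A) (u v : E) : β ![u, v] = - β ![v, u] := by
  have h := β.toAlternatingMap.map_swap ![v, u]  (i := 0) (j := 1) (by decide)
  have h2 : (![v, u] ∘ Equiv.swap (0 : Fin 2) 1) = ![u, v] := by ext i; fin_cases i <;> simp
  rw [h2] at h
  exact h

theorem apply_self (β : E [⋀^Fin 2]→L[ℝ] A) (u : E) : β ![u, u] = 0 :=
  β.map_eq_zero_of_eq ![u, u] (i := 0) (j := 1) rfl (by decide)

/-- Expansion along the 1-form, from which the low-degree formulas are read off. The tuple `w` is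
`v` reindexed, because `1 + k` and `k + 1` are not definitionally equal for a variable `k`. -/
theorem wedge_one_left {k : ℕ} (α : E [⋀^Fin 1]→L[ℝ] A) (β : E [⋀^Fin k]→L[ℝ] A)
    (v : Fin (1 + k) → E) (w : Fin (k + 1) → E) (h : ∀ i, w i = v (Fin.cast (add_comm k 1) i)) :
    wedge α β v = ∑ p : Fin (k + 1), (if p = 0 then (1 : ℤˣ) else -1) •
        (α ![w p] * β (fun j => w (Equiv.swap 0 p j.succ))) := by
  rw [wedge_apply]
  have key := sum_perm_sign_smul (fun x => α ![x]) β w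
  have e : ∑ σ : Equiv.Perm (Fin (1 + k)),
      Equiv.Perm.sign σ • (α (fun i => v (σ (Fin.castAdd k i))) * β (fun j => v (σ (Fin.natAdd 1 j))))
      = ∑ σ : Equiv.Perm (Fin (k + 1)), Equiv.Perm.sign σ • (α ![w (σ 0)] * β (fun j => w (σ j.succ))) := by
    rw [← (Equiv.permCongr (finCongr (add_comm k 1))).sum_comp]
    refine Finset.sum_congr rfl fun σ _ => ?_
    rw [Equiv.Perm.sign_permCongr]
    congr 3
    · ext i
      fin_cases i
      simp [h, Equiv.permCongr_apply]
      congr 3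
    · ext i
      simp [h, Equiv.permCongr_apply]
  rw [e, key, smul_smul]
  simp [Nat.factorial_ne_zero]

theorem wedge_one_one (α β : E [⋀^Fin 1]→L[ℝ] A) (v : Fin (1 + 1) → E) :
    wedge α β v = α ![v 0] * β ![v 1] - α ![v 1] * β ![v 0] := by
  rw [wedge_one_left α β v v (fun _ => rfl)]
  have e0 : (fun j : Fin 1 => v j.succ) = ![v 1] := by ext i; fin_cases i; rfl
  have e1 : (fun j : Fin 1 => v (Equiv.swap 0 1 j.succ)) = ![v 0] := by
    ext i; fin_cases i; rfl
  simp [Fin.sum_univ_succ, e0, e1]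
  ring

theorem wedge_one_two (α : E [⋀^Fin 1]→L[ℝ] A) (β : E [⋀^Fin 2]→L[ℝ] A) (v : Fin (1 + 2) → E) :
    wedge α β v = α ![v 0] * β ![v 1, v 2] - α ![v 1] * β ![v 0, v 2] + α ![v 2] * β ![v 0, v 1] := by
  rw [wedge_one_left α β v v (fun _ => rfl)]
  have e0 : (fun j : Fin 2 => v j.succ) = ![v 1, v 2] := by ext i; fin_cases i <;> rfl
  have e1 : (fun j : Fin 2 => v (Equiv.swap 0 1 j.succ)) = ![v 0, v 2] := by
    ext i; fin_cases i <;> rfl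
  have e2 : (fun j : Fin 2 => v (Equiv.swap 0 2 j.succ)) = ![v 1, v 0] := by
    ext i; fin_cases i <;> rfl
  simp [Fin.sum_univ_succ, e0, e1, e2, apply_swap β (v 1) (v 0)]
  ring


theorem sum_perm_fin_four {A : Type*} [AddCommGroup A] (f : Fin 4 → Fin 4 → Fin 4 → Fin 4 → A) :
    ∑ σ : Equiv.Perm (Fin 4), Equiv.Perm.sign σ • f (σ 0) (σ 1) (σ 2) (σ 3) =
      f 0 1 2 3 - f 0 1 3 2 - f 0 2 1 3 + f 0 2 3 1 + f 0 3 1 2 - f 0 3 2 1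
      - f 1 0 2 3 + f 1 0 3 2 + f 1 2 0 3 - f 1 2 3 0 - f 1 3 0 2 + f 1 3 2 0
      + f 2 0 1 3 - f 2 0 3 1 - f 2 1 0 3 + f 2 1 3 0 + f 2 3 0 1 - f 2 3 1 0
      - f 3 0 1 2 + f 3 0 2 1 + f 3 1 0 2 - f 3 1 2 0 - f 3 2 0 1 + f 3 2 1 0 := by
  -- Numerals are spelled as iterated successors so that the recursive description of permutations
  -- by `decomposeFin` can evaluate each σ i.
  have h2 : (2 : Fin 4) = Fin.succ (Fin.succ 0) := rfl
  have h3 : (3 : Fin 4) = Fin.succ (Fin.succ (Fin.succ 0)) := rfl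
  have h1 : (1 : Fin 4) = Fin.succ 0 := rfl
  have e : ∀ σ : Equiv.Perm (Fin 4), f (σ 0) (σ 1) (σ 2) (σ 3) = 
     f (σ 0) (σ (Fin.succ 0)) (σ (Fin.succ (Fin.succ 0))) (σ (Fin.succ (Fin.succ (Fin.succ 0)))) := fun _ => rfl
  simp only [e]
  rw [← (Equiv.Perm.decomposeFin (n := 3)).symm.sum_comp, Fintype.sum_prod_type]
  simp only [← (Equiv.Perm.decomposeFin (n := 2)).symm.sum_comp,
    ← (Equiv.Perm.decomposeFin (n := 1)).symm.sum_comp,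
    ← (Equiv.Perm.decomposeFin (n := 0)).symm.sum_comp, Fintype.sum_prod_type]
  simp only [Equiv.Perm.decomposeFin_symm_apply_zero, Equiv.Perm.decomposeFin_symm_apply_succ,
      Equiv.Perm.decomposeFin.symm_sign]
  simp only [Fin.sum_univ_succ, Finset.univ_unique, Finset.sum_singleton]
  have s1 : ∀ a b c : Fin 4, Equiv.swap a b c = if c = a then b else if c = b then a else c := fun _ _ _ => Equiv.swap_apply_def _ _ _
  have s2 : ∀ a b c : Fin 3, Equiv.swap a b c = if c = a then b else if c = b then a else c := fun _ _ _ => Equiv.swap_apply_def _ _ _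
  have s3 : ∀ a b c : Fin 2, Equiv.swap a b c = if c = a then b else if c = b then a else c := fun _ _ _ => Equiv.swap_apply_def _ _ _
  simp [s1, s2, s3]
  abel

theorem wedge_two_two (α β : E [⋀^Fin 2]→L[ℝ] A) (v : Fin (2 + 2) → E) :
    wedge α β v = α ![v 0, v 1] * β ![v 2, v 3] - α ![v 0, v 2] * β ![v 1, v 3]
      + α ![v 0, v 3] * β ![v 1, v 2] + α ![v 1, v 2] * β ![v 0, v 3]
      - α ![v 1, v 3] * β ![v 0, v 2] + α ![v 2, v 3] * β ![v 0, v 1] := by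
  rw [wedge_apply]
  have e : ∀ σ : Equiv.Perm (Fin (2 + 2)),
      α (fun i => v (σ (Fin.castAdd 2 i))) * β (fun j => v (σ (Fin.natAdd 2 j))) =
      α ![v (σ 0), v (σ 1)] * β ![v (σ 2), v (σ 3)] := by
    intro σ
    congr 2 <;> · ext i; fin_cases i <;> rfl
  simp only [e]
  rw [sum_perm_fin_four (fun a b c d => α ![v a, v b] * β ![v c, v d])]
  -- Once all arguments are put in increasing order the 24 terms coincide in groups of four, and 4 =
  -- 2! · 2! cancels the normalization.
  rw [apply_swap α (v 1) (v 0), apply_swap α (v 2) (v 0), apply_swap α (v 3) (v 0),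
    apply_swap α (v 2) (v 1), apply_swap α (v 3) (v 1), apply_swap α (v 3) (v 2),
    apply_swap β (v 1) (v 0), apply_swap β (v 2) (v 0), apply_swap β (v 3) (v 0),
    apply_swap β (v 2) (v 1), apply_swap β (v 3) (v 1), apply_swap β (v 3) (v 2)]
  have h4 : ((Nat.factorial 2 * Nat.factorial 2 : ℕ) : ℝ) = 4 := by norm_num [Nat.factorial]
  rw [← Nat.cast_mul, h4, inv_smul_eq_iff₀ (by norm_num), Algebra.smul_def, map_ofNat]
  ring

theorem wedge_one_three (α : E [⋀^Fin 1]→L[ℝ] A) (β : E [⋀^Fin 3]→L[ℝ] A)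
    (v : Fin (1 + 3) → E) :
    wedge α β v = α ![v 0] * β ![v 1, v 2, v 3] - α ![v 1] * β ![v 0, v 2, v 3]
      + α ![v 2] * β ![v 0, v 1, v 3] - α ![v 3] * β ![v 0, v 1, v 2] := by
  rw [wedge_one_left α β v v (fun _ => rfl)]
  have e0 : (fun j : Fin 3 => v j.succ) = ![v 1, v 2, v 3] := by ext i; fin_cases i <;> rfl
  have e1 : (fun j : Fin 3 => v (Equiv.swap 0 1 j.succ)) = ![v 0, v 2, v 3] := by
    ext i; fin_cases i <;> rfl
  have e2 : (fun j : Fin 3 => v (Equiv.swap 0 2 j.succ)) = ![v 1, v 0, v 3] := by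
    ext i; fin_cases i <;> rfl
  have e3 : (fun j : Fin 3 => v (Equiv.swap 0 3 j.succ)) = ![v 1, v 2, v 0] := by
    ext i; fin_cases i <;> rfl
  have h2 : β ![v 1, v 0, v 3] = - β ![v 0, v 1, v 3] := by
    have h := β.toAlternatingMap.map_swap ![v 0, v 1, v 3]  (i := 0) (j := 1) (by decide)
    have h' : (![v 0, v 1, v 3] ∘ Equiv.swap (0 : Fin 3) 1) = ![v 1, v 0, v 3] := by
      ext i; fin_cases i <;> rfl
    rwa [h'] at h
  have h3 : β ![v 1, v 2, v 0] = β ![v 0, v 1, v 2] := by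
    have h := β.toAlternatingMap.map_perm ![v 0, v 1, v 2] (Equiv.swap 0 2 * Equiv.swap 0 1)
    have h' : (![v 0, v 1, v 2] ∘ (Equiv.swap 0 2 * Equiv.swap 0 1 : Equiv.Perm (Fin 3)))
        = ![v 1, v 2, v 0] := by
      ext i; fin_cases i <;> rfl
    have hs : Equiv.Perm.sign (Equiv.swap 0 2 * Equiv.swap 0 1 : Equiv.Perm (Fin 3)) = 1 := by
      decide
    rw [h', hs, one_smul] at h
    exact h
  simp [Fin.sum_univ_succ, e0, e1, e2, e3, h2, h3]
  ring

theorem wedge_zero_left {q : ℕ} (a : E [⋀^Fin 0]→L[ℝ] A) (β : E [⋀^Fin q]→L[ℝ] A)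
    (v : Fin (0 + q) → E) :
    wedge a β v = a ![] * β (fun j => v (Fin.natAdd 0 j)) := by
  rw [wedge_apply]
  have e : ∀ σ : Equiv.Perm (Fin (0 + q)), Equiv.Perm.sign σ •
      (a (fun i => v (σ (Fin.castAdd q i))) * β (fun j => v (σ (Fin.natAdd 0 j)))) =
      a ![] * β (fun j => v (Fin.natAdd 0 j)) := by
    intro σ
    let c : Fin q ≃ Fin (0 + q) := finCongr (zero_add q).symm
    have hc : ∀ j : Fin q, Fin.natAdd 0 j = c j := fun j => by ext; simp [c]
    have h1 := β.toAlternatingMap.map_perm (fun j => v (c j)) (c.symm.permCongr σ)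
    rw [Equiv.Perm.sign_permCongr] at h1
    have h2 : ((fun j => v (c j)) ∘ (c.symm.permCongr σ)) = fun j => v (σ (Fin.natAdd 0 j)) := by
      ext j; simp [Equiv.permCongr_apply, hc]
    rw [h2] at h1
    change β _ = _ • β _ at h1
    rw [h1, mul_smul_comm, ← mul_smul, Int.units_mul_self, one_smul]
    simp only [hc]
    congr 2
    exact Subsingleton.elim _ _
  simp only [e, Finset.sum_const, Finset.card_univ, Fintype.card_perm, Fintype.card_fin]
  rw [← Nat.cast_smul_eq_nsmul ℝ, smul_smul]
  simp [Nat.factorial_ne_zero]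

/-- A wedge product vanishes on tuples from a set on which its left factor vanishes. -/
theorem wedge_apply_eq_zero_of_left {p q : ℕ} (α : E [⋀^Fin p]→L[ℝ] A) (β : E [⋀^Fin q]→L[ℝ] A)
    {D : Set E} (h : ∀ w : Fin p → E, (∀ i, w i ∈ D) → α w = 0) {v : Fin (p + q) → E}
    (hv : ∀ i, v i ∈ D) : wedge α β v = 0 := by
  rw [wedge_apply, Finset.sum_eq_zero, smul_zero]
  intro σ _
  rw [h _ (fun i => hv _), zero_mul, smul_zero]

/-- A wedge product vanishes on tuples from a set on which its right factor vanishes. -/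
theorem wedge_apply_eq_zero_of_right {p q : ℕ} (α : E [⋀^Fin p]→L[ℝ] A) (β : E [⋀^Fin q]→L[ℝ] A)
    {D : Set E} (h : ∀ w : Fin q → E, (∀ i, w i ∈ D) → β w = 0) {v : Fin (p + q) → E}
    (hv : ∀ i, v i ∈ D) : wedge α β v = 0 := by
  rw [wedge_apply, Finset.sum_eq_zero, smul_zero]
  intro σ _
  rw [h _ (fun i => hv _), mul_zero, smul_zero]

theorem wedge_compContinuousLinearMap {E' : Type*} [AddCommGroup E'] [Module ℝ E']
    [TopologicalSpace E'] {p q : ℕ} (α : E [⋀^Fin p]→L[ℝ] A) (β : E [⋀^Fin q]→L[ℝ] A)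
    (L : E' →L[ℝ] E) : (wedge α β).compContinuousLinearMap L =
      wedge (α.compContinuousLinearMap L) (β.compContinuousLinearMap L) := by
  ext v
  simp only [wedge_apply, ContinuousAlternatingMap.compContinuousLinearMap_apply, Function.comp_def]

theorem wedge_add_left {p q : ℕ} (α α' : E [⋀^Fin p]→L[ℝ] A) (β : E [⋀^Fin q]→L[ℝ] A) :
    wedge (α + α') β = wedge α β + wedge α' β := by
  ext v
  simp [wedge_apply, add_mul, Finset.sum_add_distrib]

theorem wedge_add_right {p q : ℕ} (α : E [⋀^Fin p]→L[ℝ] A) (β β' : E [⋀^Fin q]→L[ℝ] A) :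
    wedge α (β + β') = wedge α β + wedge α β' := by
  ext v
  simp [wedge_apply, mul_add, Finset.sum_add_distrib]

theorem wedge_smul_left {p q : ℕ} (c : ℝ) (α : E [⋀^Fin p]→L[ℝ] A) (β : E [⋀^Fin q]→L[ℝ] A) :
    wedge (c • α) β = c • wedge α β := by
  ext v
  simp only [wedge_apply, ContinuousAlternatingMap.smul_apply, smul_mul_assoc]
  rw [smul_comm c, Finset.smul_sum (r := c)]
  simp only [smul_comm c]

theorem wedge_smul_right {p q : ℕ} (c : ℝ) (α : E [⋀^Fin p]→L[ℝ] A) (β : E [⋀^Fin q]→L[ℝ] A) :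
    wedge α (c • β) = c • wedge α β := by
  ext v
  simp only [wedge_apply, ContinuousAlternatingMap.smul_apply, mul_smul_comm]
  rw [smul_comm c, Finset.smul_sum (r := c)]
  simp only [smul_comm c]

theorem wedge_zero_right {p q : ℕ} (α : E [⋀^Fin p]→L[ℝ] A) :
    wedge α (0 : E [⋀^Fin q]→L[ℝ] A) = 0 := by
  ext v
  simp [wedge_apply]

@[simp] theorem reForm_apply {k : ℕ} (α : E [⋀^Fin k]→L[ℝ] ℂ) (v : Fin k → E) :
    reForm α v = (α v).re := rfl

@[simp] theorem imForm_apply {k : ℕ} (α : E [⋀^Fin k]→L[ℝ] ℂ) (v : Fin k → E) :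
    imForm α v = (α v).im := rfl

@[simp] theorem conjForm_apply {k : ℕ} (α : E [⋀^Fin k]→L[ℝ] ℂ) (v : Fin k → E) :
    conjForm α v = conj (α v) := rfl

@[simp] theorem ofRealForm_apply {k : ℕ} (α : E [⋀^Fin k]→L[ℝ] ℝ) (v : Fin k → E) :
    ofRealForm α v = (α v : ℂ) := rfl

end WedgeEval

/-! ### Smoothness and exterior derivatives of forms on a vector space -/

section Calculus

variable {E : Type*} [NormedAddCommGroup E] [NormedSpace ℝ E] [FiniteDimensional ℝ E]
variable {F : Type*} [NormedAddCommGroup F] [NormedSpace ℝ F] [FiniteDimensional ℝ F]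
variable {H : Type*} [NormedAddCommGroup H] [NormedSpace ℝ H]

/-- Evaluation of an alternating map on the tuples of basis vectors. -/
def evalBasis {n : ℕ} (k : ℕ) (b : Module.Basis (Fin n) ℝ E) :
    (E [⋀^Fin k]→L[ℝ] F) →ₗ[ℝ] ((Fin k → Fin n) → F) where
  toFun η r := η (fun i => b (r i))
  map_add' _ _ := rfl
  map_smul' _ _ := rfl

omit [FiniteDimensional ℝ E] [FiniteDimensional ℝ F] in
theorem evalBasis_injective {n : ℕ} (k : ℕ) (b : Module.Basis (Fin n) ℝ E) :
    Function.Injective (evalBasis (F := F) k b) := by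
  intro η η' h
  refine ContinuousAlternatingMap.toAlternatingMap_injective
    (Module.Basis.ext_alternating b fun r _ => ?_)
  exact congrFun h r

instance {k : ℕ} : FiniteDimensional ℝ (E [⋀^Fin k]→L[ℝ] F) :=
  FiniteDimensional.of_injective _ (evalBasis_injective k (Module.finBasis ℝ E))

/-- A form is smooth as soon as its values on constant vectors are. -/
theorem contDiffOn_form {k : ℕ} {m : WithTop ℕ∞} {η : H → E [⋀^Fin k]→L[ℝ] F} {s : Set H}
    (h : ∀ v : Fin k → E, ContDiffOn ℝ m (fun y => η y v) s) : ContDiffOn ℝ m η s := by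
  let b := Module.finBasis ℝ E
  obtain ⟨g, hg⟩ := (evalBasis (F := F) k b).exists_leftInverse_of_injective
    (LinearMap.ker_eq_bot.2 (evalBasis_injective k b))
  have e : η = fun y => g.toContinuousLinearMap (fun r => η y (fun i => b (r i))) := by
    funext y
    exact (LinearMap.congr_fun hg (η y)).symm
  rw [e]
  exact g.toContinuousLinearMap.contDiff.comp_contDiffOn (contDiffOn_pi.2 fun r => h _)

omit [FiniteDimensional ℝ F] in
/-- The value of a smooth form on smooth vector fields is smooth. -/
theorem contDiffOn_form_apply {k : ℕ} {m : WithTop ℕ∞} {η : H → E [⋀^Fin k]→L[ℝ] F} {s : Set H}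
    {X : Fin k → H → E} (hη : ContDiffOn ℝ m η s) (hX : ∀ i, ContDiffOn ℝ m (X i) s) :
    ContDiffOn ℝ m (fun y => η y (fun i => X i y)) s := by
  let b := Module.finBasis ℝ E
  -- Multilinear expansion in a fixed basis: only coordinates of the fields and values of η on
  -- constant vectors remain.
  have e : (fun y => η y (fun i => X i y)) = fun y => ∑ r : Fin k → Fin (Module.finrank ℝ E),
      (∏ i, b.coord (r i) (X i y)) • η y (fun i => b (r i)) := by
    funext y
    have h1 : (fun i => X i y) = fun i => ∑ j, b.coord j (X i y) • b j := by
      funext i; exact (b.sum_repr (X i y)).symm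
    conv_lhs => rw [h1]
    refine ((η y).toMultilinearMap.map_sum _).trans ?_
    exact Finset.sum_congr rfl fun r _ => MultilinearMap.map_smul_univ _ _ _
  rw [e]
  refine ContDiffOn.sum fun r _ => ContDiffOn.smul (contDiffOn_prod fun i _ => ?_) ?_
  · exact (b.coord (r i)).toContinuousLinearMap.contDiff.comp_contDiffOn (hX i)
  · let ev : (E [⋀^Fin k]→L[ℝ] F) →L[ℝ] F :=
      ContinuousAlternatingMap.apply ℝ E F (fun i => b (r i))
    exact ev.contDiff.comp_contDiffOn hη

omit [FiniteDimensional ℝ E] [FiniteDimensional ℝ F] in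
theorem contDiffOn_extDeriv {k : ℕ} {η : E → E [⋀^Fin k]→L[ℝ] F} {s : Set E} (hs : IsOpen s)
    (h : ContDiffOn ℝ ∞ η s) : ContDiffOn ℝ ∞ (extDeriv η) s :=
  (ContinuousAlternatingMap.alternatizeUncurryFinCLM ℝ E F).contDiff.comp_contDiffOn
    (h.fderiv_of_isOpen hs (by simp))

variable {A : Type*} [NormedCommRing A] [NormedAlgebra ℝ A] [FiniteDimensional ℝ A]

/-- The wedge product as a bilinear map. -/
def wedgeLM (E A : Type*) [NormedAddCommGroup E] [NormedSpace ℝ E]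
    [NormedCommRing A] [NormedAlgebra ℝ A] (p q : ℕ) :
    (E [⋀^Fin p]→L[ℝ] A) →ₗ[ℝ] (E [⋀^Fin q]→L[ℝ] A) →ₗ[ℝ] (E [⋀^Fin (p + q)]→L[ℝ] A) :=
  LinearMap.mk₂ ℝ (fun α β => wedge α β) wedge_add_left wedge_smul_left wedge_add_right
    wedge_smul_right

/-- The wedge product as a continuous bilinear map. -/
def wedgeCLM (E A : Type*) [NormedAddCommGroup E] [NormedSpace ℝ E] [FiniteDimensional ℝ E]
    [NormedCommRing A] [NormedAlgebra ℝ A] [FiniteDimensional ℝ A] (p q : ℕ) :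
    (E [⋀^Fin p]→L[ℝ] A) →L[ℝ] (E [⋀^Fin q]→L[ℝ] A) →L[ℝ] (E [⋀^Fin (p + q)]→L[ℝ] A) :=
  (wedgeLM E A p q).toContinuousBilinearMap

omit [FiniteDimensional ℝ A] in
theorem contDiffOn_form_apply_const {k : ℕ} {m : WithTop ℕ∞} {η : H → E [⋀^Fin k]→L[ℝ] A}
    {s : Set H} (hη : ContDiffOn ℝ m η s) (v : Fin k → E) : ContDiffOn ℝ m (fun y => η y v) s :=
  contDiffOn_form_apply (X := fun i _ => v i) hη fun _ => contDiffOn_const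

theorem contDiffOn_wedge {p q : ℕ} {m : WithTop ℕ∞} {α : H → E [⋀^Fin p]→L[ℝ] A}
    {β : H → E [⋀^Fin q]→L[ℝ] A} {s : Set H} (hα : ContDiffOn ℝ m α s) (hβ : ContDiffOn ℝ m β s) :
    ContDiffOn ℝ m (fun y => wedge (α y) (β y)) s := by
  refine contDiffOn_form fun v => ?_
  simp only [wedge_apply]
  refine ContDiffOn.smul (f := fun _ => ((p.factorial * q.factorial : ℝ)⁻¹)) contDiffOn_const
    (ContDiffOn.sum fun σ _ => ?_)
  have h := (contDiffOn_form_apply_const hα (fun i => v (σ (Fin.castAdd q i)))).mul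
    (contDiffOn_form_apply_const hβ (fun j => v (σ (Fin.natAdd p j))))
  rcases Int.units_eq_one_or (Equiv.Perm.sign σ) with hs | hs
  · simpa only [hs, one_smul] using h
  · simpa only [hs, Units.neg_smul, one_smul] using h.neg

theorem fderiv_wedge {p q : ℕ} {α : E → E [⋀^Fin p]→L[ℝ] A} {β : E → E [⋀^Fin q]→L[ℝ] A} {y : E}
    (hα : DifferentiableAt ℝ α y) (hβ : DifferentiableAt ℝ β y) (u : E) :
    fderiv ℝ (fun y => wedge (α y) (β y)) y u =
      wedge (α y) (fderiv ℝ β y u) + wedge (fderiv ℝ α y u) (β y) := by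
  have h := (wedgeCLM E A p q).fderiv_of_bilinear hα hβ
  exact congrArg (fun L => L u) h

omit [FiniteDimensional ℝ E] [FiniteDimensional ℝ F] in
theorem extDeriv_zero_apply (η : E → E [⋀^Fin 0]→L[ℝ] F) (y u : E) :
    extDeriv η y ![u] = fderiv ℝ η y u ![] := by
  rw [extDeriv, ContinuousAlternatingMap.alternatizeUncurryFin_apply]
  simp only [Fin.sum_univ_succ, Fin.val_zero, pow_zero, one_smul, Finset.univ_eq_empty,
    Finset.sum_empty, add_zero]
  congr 1

omit [FiniteDimensional ℝ E] [FiniteDimensional ℝ F] in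
theorem extDeriv_one_apply (η : E → E [⋀^Fin 1]→L[ℝ] F) (y u v : E) :
    extDeriv η y ![u, v] = fderiv ℝ η y u ![v] - fderiv ℝ η y v ![u] := by
  rw [extDeriv, ContinuousAlternatingMap.alternatizeUncurryFin_apply]
  have e0 : (Fin.removeNth 0 ![u, v] : Fin 1 → E) = ![v] := by ext i; fin_cases i; rfl
  have e1 : (Fin.removeNth 1 ![u, v] : Fin 1 → E) = ![u] := by ext i; fin_cases i; rfl
  simp [Fin.sum_univ_two, e0, e1, sub_eq_add_neg]

omit [FiniteDimensional ℝ E] [FiniteDimensional ℝ F] in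
theorem extDeriv_two_apply (η : E → E [⋀^Fin 2]→L[ℝ] F) (y u v w : E) :
    extDeriv η y ![u, v, w] =
      fderiv ℝ η y u ![v, w] - fderiv ℝ η y v ![u, w] + fderiv ℝ η y w ![u, v] := by
  rw [extDeriv, ContinuousAlternatingMap.alternatizeUncurryFin_apply]
  have e0 : (Fin.removeNth 0 ![u, v, w] : Fin 2 → E) = ![v, w] := by ext i; fin_cases i <;> rfl
  have e1 : (Fin.removeNth 1 ![u, v, w] : Fin 2 → E) = ![u, w] := by ext i; fin_cases i <;> rfl
  have e2 : (Fin.removeNth 2 ![u, v, w] : Fin 2 → E) = ![u, v] := by ext i; fin_cases i <;> rfl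
  simp [Fin.sum_univ_three, e0, e1, e2, sub_eq_add_neg]

omit [FiniteDimensional ℝ E] [FiniteDimensional ℝ F] in
theorem extDeriv_three_apply (η : E → E [⋀^Fin 3]→L[ℝ] F) (y u v w x : E) :
    extDeriv η y ![u, v, w, x] =
      fderiv ℝ η y u ![v, w, x] - fderiv ℝ η y v ![u, w, x] + fderiv ℝ η y w ![u, v, x]
        - fderiv ℝ η y x ![u, v, w] := by
  rw [extDeriv, ContinuousAlternatingMap.alternatizeUncurryFin_apply]
  have e0 : (Fin.removeNth 0 ![u, v, w, x] : Fin 3 → E) = ![v, w, x] := by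
    ext i; fin_cases i <;> rfl
  have e1 : (Fin.removeNth 1 ![u, v, w, x] : Fin 3 → E) = ![u, w, x] := by
    ext i; fin_cases i <;> rfl
  have e2 : (Fin.removeNth 2 ![u, v, w, x] : Fin 3 → E) = ![u, v, x] := by
    ext i; fin_cases i <;> rfl
  have e3 : (Fin.removeNth 3 ![u, v, w, x] : Fin 3 → E) = ![u, v, w] := by
    ext i; fin_cases i <;> rfl
  simp [Fin.sum_univ_four, e0, e1, e2, e3, sub_eq_add_neg, pow_succ]

omit [FiniteDimensional ℝ E] [FiniteDimensional ℝ F] in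
theorem extDeriv_four_apply (η : E → E [⋀^Fin 4]→L[ℝ] F) (y u v w x z : E) :
    extDeriv η y ![u, v, w, x, z] =
      fderiv ℝ η y u ![v, w, x, z] - fderiv ℝ η y v ![u, w, x, z] + fderiv ℝ η y w ![u, v, x, z]
        - fderiv ℝ η y x ![u, v, w, z] + fderiv ℝ η y z ![u, v, w, x] := by
  rw [extDeriv, ContinuousAlternatingMap.alternatizeUncurryFin_apply]
  have e0 : (Fin.removeNth 0 ![u, v, w, x, z] : Fin 4 → E) = ![v, w, x, z] := by
    ext i; fin_cases i <;> rfl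
  have e1 : (Fin.removeNth 1 ![u, v, w, x, z] : Fin 4 → E) = ![u, w, x, z] := by
    ext i; fin_cases i <;> rfl
  have e2 : (Fin.removeNth 2 ![u, v, w, x, z] : Fin 4 → E) = ![u, v, x, z] := by
    ext i; fin_cases i <;> rfl
  have e3 : (Fin.removeNth 3 ![u, v, w, x, z] : Fin 4 → E) = ![u, v, w, z] := by
    ext i; fin_cases i <;> rfl
  have e4 : (Fin.removeNth 4 ![u, v, w, x, z] : Fin 4 → E) = ![u, v, w, x] := by
    ext i; fin_cases i <;> rfl
  simp [Fin.sum_univ_five, e0, e1, e2, e3, e4, sub_eq_add_neg, pow_succ]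

/-- The Leibniz rule, like its companions in degrees (1,2) and (1,3), is stated on explicit vectors:
both sides are then polynomials in values of the forms and their derivatives. -/
theorem extDeriv_wedge_one_one {α β : E → E [⋀^Fin 1]→L[ℝ] A} {y : E}
    (hα : DifferentiableAt ℝ α y) (hβ : DifferentiableAt ℝ β y) (u v w : E) :
    extDeriv (fun y => wedge (α y) (β y)) y ![u, v, w] =
      extDeriv α y ![u, v] * β y ![w] - extDeriv α y ![u, w] * β y ![v]
        + extDeriv α y ![v, w] * β y ![u]
      - (α y ![u] * extDeriv β y ![v, w] - α y ![v] * extDeriv β y ![u, w]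
        + α y ![w] * extDeriv β y ![u, v]) := by
  rw [extDeriv_two_apply]
  simp only [fderiv_wedge hα hβ, ContinuousAlternatingMap.add_apply, wedge_one_one,
    extDeriv_one_apply, Matrix.cons_val_zero, Matrix.cons_val_one]
  ring

theorem extDeriv_wedge_one_two {α : E → E [⋀^Fin 1]→L[ℝ] A} {β : E → E [⋀^Fin 2]→L[ℝ] A} {y : E}
    (hα : DifferentiableAt ℝ α y) (hβ : DifferentiableAt ℝ β y) (u v w x : E) :
    extDeriv (fun y => wedge (α y) (β y)) y ![u, v, w, x] =
      extDeriv α y ![u, v] * β y ![w, x] - extDeriv α y ![u, w] * β y ![v, x]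
        + extDeriv α y ![u, x] * β y ![v, w] + extDeriv α y ![v, w] * β y ![u, x]
        - extDeriv α y ![v, x] * β y ![u, w] + extDeriv α y ![w, x] * β y ![u, v]
      - (α y ![u] * extDeriv β y ![v, w, x] - α y ![v] * extDeriv β y ![u, w, x]
        + α y ![w] * extDeriv β y ![u, v, x] - α y ![x] * extDeriv β y ![u, v, w]) := by
  rw [extDeriv_three_apply]
  simp only [fderiv_wedge hα hβ, ContinuousAlternatingMap.add_apply, wedge_one_two,
    extDeriv_one_apply, extDeriv_two_apply, Matrix.cons_val_zero, Matrix.cons_val_one,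
    Matrix.cons_val]
  ring

theorem extDeriv_wedge_one_three {α : E → E [⋀^Fin 1]→L[ℝ] A} {β : E → E [⋀^Fin 3]→L[ℝ] A} {y : E}
    (hα : DifferentiableAt ℝ α y) (hβ : DifferentiableAt ℝ β y) (u v w x z : E) :
    extDeriv (fun y => wedge (α y) (β y)) y ![u, v, w, x, z] =
      extDeriv α y ![u, v] * β y ![w, x, z] - extDeriv α y ![u, w] * β y ![v, x, z]
        + extDeriv α y ![u, x] * β y ![v, w, z] - extDeriv α y ![u, z] * β y ![v, w, x]
        + extDeriv α y ![v, w] * β y ![u, x, z] - extDeriv α y ![v, x] * β y ![u, w, z]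
        + extDeriv α y ![v, z] * β y ![u, w, x] + extDeriv α y ![w, x] * β y ![u, v, z]
        - extDeriv α y ![w, z] * β y ![u, v, x] + extDeriv α y ![x, z] * β y ![u, v, w]
      - (α y ![u] * extDeriv β y ![v, w, x, z] - α y ![v] * extDeriv β y ![u, w, x, z]
        + α y ![w] * extDeriv β y ![u, v, x, z] - α y ![x] * extDeriv β y ![u, v, w, z]
        + α y ![z] * extDeriv β y ![u, v, w, x]) := by
  rw [extDeriv_four_apply]
  simp only [fderiv_wedge hα hβ, ContinuousAlternatingMap.add_apply, wedge_one_three,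
    extDeriv_one_apply, extDeriv_three_apply, Matrix.cons_val_zero, Matrix.cons_val_one,
    Matrix.cons_val]
  ring

omit [FiniteDimensional ℝ E] [FiniteDimensional ℝ F] in
theorem fderiv_smul_form {k : ℕ} {f : E → ℝ} {η : E → E [⋀^Fin k]→L[ℝ] F} {y : E}
    (hf : DifferentiableAt ℝ f y) (hη : DifferentiableAt ℝ η y) (u : E) :
    fderiv ℝ (fun y => f y • η y) y u = f y • fderiv ℝ η y u + fderiv ℝ f y u • η y := by
  rw [fderiv_fun_smul hf hη]
  rfl

omit [FiniteDimensional ℝ E] [FiniteDimensional ℝ F] in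
theorem extDeriv_smul_one {f : E → ℝ} {η : E → E [⋀^Fin 1]→L[ℝ] F} {y : E}
    (hf : DifferentiableAt ℝ f y) (hη : DifferentiableAt ℝ η y) (u v : E) :
    extDeriv (fun y => f y • η y) y ![u, v] = f y • extDeriv η y ![u, v]
      + (fderiv ℝ f y u • η y ![v] - fderiv ℝ f y v • η y ![u]) := by
  simp only [extDeriv_one_apply, fderiv_smul_form hf hη, ContinuousAlternatingMap.add_apply,
    ContinuousAlternatingMap.smul_apply]
  module

omit [FiniteDimensional ℝ E] [FiniteDimensional ℝ F] in
theorem extDeriv_smul_three {f : E → ℝ} {η : E → E [⋀^Fin 3]→L[ℝ] F} {y : E}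
    (hf : DifferentiableAt ℝ f y) (hη : DifferentiableAt ℝ η y) (u v w x : E) :
    extDeriv (fun y => f y • η y) y ![u, v, w, x] = f y • extDeriv η y ![u, v, w, x]
      + (fderiv ℝ f y u • η y ![v, w, x] - fderiv ℝ f y v • η y ![u, w, x]
        + fderiv ℝ f y w • η y ![u, v, x] - fderiv ℝ f y x • η y ![u, v, w]) := by
  simp only [extDeriv_three_apply, fderiv_smul_form hf hη, ContinuousAlternatingMap.add_apply,
    ContinuousAlternatingMap.smul_apply]
  module

omit [FiniteDimensional ℝ E] [FiniteDimensional ℝ F] in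
/-- The exterior derivative commutes with continuous linear maps of the coefficients. -/
theorem extDeriv_comp_left {F' : Type*} [NormedAddCommGroup F'] [NormedSpace ℝ F'] {k : ℕ}
    (L : F →L[ℝ] F') {η : E → E [⋀^Fin k]→L[ℝ] F} {y : E} (hη : DifferentiableAt ℝ η y) :
    extDeriv (fun y => L.compContinuousAlternatingMap (η y)) y =
      L.compContinuousAlternatingMap (extDeriv η y) := by
  ext v
  have h : HasFDerivAt (fun y => L.compContinuousAlternatingMap (η y))
      ((ContinuousLinearMap.compContinuousAlternatingMapCLM ℝ E F F' (Fin k) L).comp (fderiv ℝ η y)) y :=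
    (ContinuousLinearMap.compContinuousAlternatingMapCLM ℝ E F F' (Fin k) L).hasFDerivAt.comp y
      hη.hasFDerivAt
  rw [extDeriv, h.fderiv]
  simp only [extDeriv, ContinuousLinearMap.compContinuousAlternatingMap_coe, Function.comp_apply,
    ContinuousAlternatingMap.alternatizeUncurryFin_apply, map_sum]
  refine Finset.sum_congr rfl fun i _ => ?_
  simp

end Calculus

/-! ### The Poincaré lemma on a ball -/

section Poincare

open MeasureTheory Set Metric
open scoped Interval

variable {E : Type} [NormedAddCommGroup E] [NormedSpace ℝ E]

/-- The weighted integral of `f` along the segments issuing from `c`. -/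
def radialIntegral {V : Type} [NormedAddCommGroup V] [NormedSpace ℝ V] (c : E) (m : ℕ)
    (f : E → V) (x : E) : V :=
  ∫ t in (0 : ℝ)..1, t ^ m • f (c + t • (x - c))

theorem segment_mem_ball {c x : E} {r t : ℝ} (hx : x ∈ ball c r) (ht : t ∈ Icc (0 : ℝ) 1) :
    c + t • (x - c) ∈ ball c r := by
  rw [mem_ball_iff_norm] at hx ⊢
  rw [add_sub_cancel_left, norm_smul, Real.norm_of_nonneg ht.1]
  exact (mul_le_of_le_one_left (norm_nonneg _) ht.2).trans_lt hx

variable {V : Type} [NormedAddCommGroup V] [NormedSpace ℝ V]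

theorem continuousOn_radial {c x : E} {r : ℝ} {f : E → V} (m : ℕ) (hf : ContinuousOn f (ball c r))
    (hx : x ∈ ball c r) :
    ContinuousOn (fun t : ℝ => t ^ m • f (c + t • (x - c))) (Icc 0 1) := by
  refine ContinuousOn.smul (by fun_prop) (hf.comp (by fun_prop) fun t ht => segment_mem_ball hx ht)

/-- Differentiation under the integral sign; the chain rule for x ↦ c + t(x - c) produces a factor
t, which raises the weight from m to m + 1. -/
theorem hasFDerivAt_radialIntegral [FiniteDimensional ℝ E] [CompleteSpace V] {c x : E} {r : ℝ}
    {f : E → V} (m : ℕ) (hf : ContDiffOn ℝ 1 f (ball c r)) (hx : x ∈ ball c r) :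
    HasFDerivAt (radialIntegral c m f) (radialIntegral c (m + 1) (fderiv ℝ f) x) x := by
  have hcont := hf.continuousOn
  have hcont' : ContinuousOn (fderiv ℝ f) (ball c r) :=
    hf.continuousOn_fderiv_of_isOpen isOpen_ball le_rfl
  -- On a slightly smaller closed ball, which is compact, the derivative of f is bounded; the bound
  -- is the dominating constant.
  obtain ⟨r', hxr', hr'⟩ := exists_between (mem_ball.1 hx)
  have hsub : closedBall c r' ⊆ ball c r := closedBall_subset_ball hr'
  obtain ⟨C, hC⟩ := (isCompact_closedBall c r').exists_bound_of_continuousOn (hcont'.mono hsub)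
  have h01 : uIcc (0 : ℝ) 1 = Icc 0 1 := uIcc_of_le zero_le_one
  have hI : Ι (0 : ℝ) 1 ⊆ Icc 0 1 := by
    rw [uIoc_of_le zero_le_one]; exact Ioc_subset_Icc_self
  refine intervalIntegral.hasFDerivAt_integral_of_dominated_of_fderiv_le (s := ball c r')
    (bound := fun _ => C) (F := fun x t => t ^ m • f (c + t • (x - c)))
    (F' := fun x t => t ^ (m + 1) • fderiv ℝ f (c + t • (x - c)))
    (isOpen_ball.mem_nhds hxr') ?_ ?_ ?_ ?_ ?_ ?_
  · filter_upwards [isOpen_ball.mem_nhds hx] with y hy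
    exact (((continuousOn_radial m hcont hy).mono hI).aestronglyMeasurable measurableSet_uIoc)
  · exact (h01 ▸ continuousOn_radial m hcont hx).intervalIntegrable
  · exact (((continuousOn_radial (m + 1) hcont' hx).mono hI).aestronglyMeasurable
      measurableSet_uIoc)
  · refine Filter.Eventually.of_forall fun t ht y hy => ?_
    have ht' := hI ht
    have h1 := hC _ (ball_subset_closedBall (segment_mem_ball hy ht'))
    rw [norm_smul, Real.norm_of_nonneg (pow_nonneg ht'.1 _)]
    exact (mul_le_of_le_one_left (norm_nonneg _) (pow_le_one₀ ht'.1 ht'.2)).trans h1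
  · exact intervalIntegrable_const
  · refine Filter.Eventually.of_forall fun t ht y hy => ?_
    have hmem := segment_mem_ball (ball_subset_ball hr'.le hy) (hI ht)
    have h1 : HasFDerivAt f (fderiv ℝ f (c + t • (y - c))) (c + t • (y - c)) :=
      ((hf.differentiableOn one_ne_zero).differentiableAt
        (isOpen_ball.mem_nhds hmem)).hasFDerivAt
    have h2 : HasFDerivAt (fun y : E => c + t • (y - c)) (t • ContinuousLinearMap.id ℝ E) y :=
      (((hasFDerivAt_id y).sub_const c).const_smul t).const_add c
    have h3 := (h1.comp y h2).const_smul (t ^ m)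
    refine h3.congr_fderiv ?_
    ext v
    simp [pow_succ, mul_smul]

/-- The derivative is again a radial integral, but with values in `E →L[ℝ] V`. The induction on n
therefore has to quantify over the value space and the weight. -/
theorem contDiffOn_radialIntegral_nat [FiniteDimensional ℝ E] {c : E} {r : ℝ} (n : ℕ) :
    ∀ {V : Type} [NormedAddCommGroup V] [NormedSpace ℝ V] [CompleteSpace V] (m : ℕ) {f : E → V},
      ContDiffOn ℝ ∞ f (ball c r) → ContDiffOn ℝ n (radialIntegral c m f) (ball c r) := by
  induction n with
  | zero =>
    intro V _ _ _ m f hf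
    exact contDiffOn_zero.2 fun x hx => (hasFDerivAt_radialIntegral m
      (hf.of_le (by simp)) hx).continuousAt.continuousWithinAt
  | succ n ih =>
    intro V _ _ _ m f hf
    have hd : ∀ x ∈ ball c r, HasFDerivAt (radialIntegral c m f)
        (radialIntegral c (m + 1) (fderiv ℝ f) x) x := fun x hx =>
      hasFDerivAt_radialIntegral m (hf.of_le (by simp)) hx
    push_cast
    rw [contDiffOn_succ_iff_fderiv_of_isOpen isOpen_ball]
    refine ⟨fun x hx => (hd x hx).differentiableAt.differentiableWithinAt, by simp, ?_⟩
    exact (ih (m + 1) (hf.fderiv_of_isOpen isOpen_ball (by simp))).congr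
      fun x hx => (hd x hx).fderiv

theorem contDiffOn_radialIntegral [FiniteDimensional ℝ E] [CompleteSpace V] {c : E} {r : ℝ}
    (m : ℕ) {f : E → V} (hf : ContDiffOn ℝ ∞ f (ball c r)) :
    ContDiffOn ℝ ∞ (radialIntegral c m f) (ball c r) :=
  contDiffOn_infty.2 fun n => contDiffOn_radialIntegral_nat n m hf

/-- Integrate d/dt of t^(k+1) f(c + t(x - c)) over [0, 1]; the positive power of t removes the
boundary term at 0. -/
theorem radialIntegral_ftc [FiniteDimensional ℝ E] [CompleteSpace V] {c x : E} {r : ℝ} (k : ℕ)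
    {f : E → V} (hf : ContDiffOn ℝ 1 f (ball c r)) (hx : x ∈ ball c r) :
    ((k : ℝ) + 1) • radialIntegral c k f x + radialIntegral c (k + 1) (fderiv ℝ f) x (x - c)
      = f x := by
  have hfd : ∀ y ∈ ball c r, HasFDerivAt f (fderiv ℝ f y) y := fun y hy =>
    ((hf.differentiableOn one_ne_zero).differentiableAt (isOpen_ball.mem_nhds hy)).hasFDerivAt
  have hcontD : ContinuousOn (fderiv ℝ f) (ball c r) :=
    hf.continuousOn_fderiv_of_isOpen isOpen_ball le_rfl
  have h01 : uIcc (0 : ℝ) 1 = Icc 0 1 := uIcc_of_le zero_le_one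
  have hintD : IntervalIntegrable (fun t : ℝ => t ^ (k + 1) • fderiv ℝ f (c + t • (x - c)))
      volume 0 1 := (h01 ▸ continuousOn_radial (k + 1) hcontD hx).intervalIntegrable
  have hder : ∀ t ∈ uIcc (0 : ℝ) 1, HasDerivAt (fun t : ℝ => t ^ (k + 1) • f (c + t • (x - c)))
      (((k : ℝ) + 1) • (t ^ k • f (c + t • (x - c)))
        + (t ^ (k + 1) • fderiv ℝ f (c + t • (x - c))) (x - c)) t := by
    intro t ht
    have h1 : HasDerivAt (fun t : ℝ => c + t • (x - c)) (x - c) t := by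
      simpa using ((hasDerivAt_id t).smul_const (x - c)).const_add c
    have h2 := (hfd _ (segment_mem_ball hx (h01 ▸ ht))).comp_hasDerivAt t h1
    have h3 := (hasDerivAt_pow (k + 1) t).smul h2
    refine h3.congr_deriv ?_
    simp only [Nat.cast_add, Nat.cast_one, add_tsub_cancel_right, Function.comp_apply]
    rw [add_comm, smul_smul]
    rfl
  have hint1 : IntervalIntegrable (fun t : ℝ => t ^ k • f (c + t • (x - c))) volume 0 1 :=
    (h01 ▸ continuousOn_radial k hf.continuousOn hx).intervalIntegrable
  have hint2 : IntervalIntegrable (fun t : ℝ =>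
      (t ^ (k + 1) • fderiv ℝ f (c + t • (x - c))) (x - c)) volume 0 1 :=
    ContinuousOn.intervalIntegrable (h01 ▸ ContinuousOn.clm_apply
      (continuousOn_radial (k + 1) hcontD hx) continuousOn_const)
  have hint3 : IntervalIntegrable (fun t : ℝ => ((k : ℝ) + 1) • (t ^ k • f (c + t • (x - c))))
      volume 0 1 := hint1.smul _
  have h := intervalIntegral.integral_eq_sub_of_hasDerivAt hder (hint3.add hint2)
  rw [intervalIntegral.integral_add hint3 hint2,
    intervalIntegral.integral_smul, ← ContinuousLinearMap.intervalIntegral_apply hintD] at h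
  simpa [radialIntegral] using h

theorem map_radialIntegral_eq_zero {W : Type*} [NormedAddCommGroup W] [NormedSpace ℝ W]
    [CompleteSpace W] [CompleteSpace V] {c x : E} {r : ℝ} (k : ℕ)
    {f : E → V} (hf : ContinuousOn f (ball c r)) (hx : x ∈ ball c r) (L : V →L[ℝ] W)
    (hL : ∀ y ∈ ball c r, L (f y) = 0) : L (radialIntegral c k f x) = 0 := by
  have h01 : uIcc (0 : ℝ) 1 = Icc 0 1 := uIcc_of_le zero_le_one
  have hint : IntervalIntegrable (fun t : ℝ => t ^ k • f (c + t • (x - c)))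
      volume 0 1 := (h01 ▸ continuousOn_radial k hf hx).intervalIntegrable
  rw [radialIntegral, ← L.intervalIntegral_comp_comm hint]
  refine (intervalIntegral.integral_congr (g := fun _ => 0) fun t ht => ?_).trans
    intervalIntegral.integral_zero
  simp only [map_smul]
  rw [hL _ (segment_mem_ball hx (h01 ▸ ht)), smul_zero]

/-- Evaluate the vanishing alternation on (X, v) and separate the term in which K is fed X. This
replaces the use of Cartan's formula in the homotopy argument. -/
theorem alternatizeUncurryFin_contract {k : ℕ} (K : E →L[ℝ] E [⋀^Fin (k + 1)]→L[ℝ] V)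
    (hK : ContinuousAlternatingMap.alternatizeUncurryFin K = 0) (X : E) (v : Fin (k + 1) → E) :
    ∑ i : Fin (k + 1), (-1) ^ (i : ℕ) • K (v i) (Matrix.vecCons X (i.removeNth v)) = K X v := by
  have h0 := congrArg (fun f => f (Matrix.vecCons X v)) hK
  simp only [ContinuousAlternatingMap.alternatizeUncurryFin_apply, Fin.sum_univ_succ (n := k + 1),
    ContinuousAlternatingMap.coe_zero, Pi.zero_apply] at h0
  have e0 : (Fin.removeNth 0 (Matrix.vecCons X v) : Fin (k + 1) → E) = v := rfl
  have e1 : ∀ i : Fin (k + 1), (Fin.removeNth i.succ (Matrix.vecCons X v) : Fin (k + 1) → E)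
      = Matrix.vecCons X (i.removeNth v) := by
    intro i
    ext j
    refine Fin.cases ?_ (fun l => ?_) j
    · simp [Fin.removeNth]
    · simp [Fin.removeNth]
  simp only [e0, e1, Matrix.cons_val_zero, Matrix.cons_val_succ, Fin.val_zero, pow_zero, one_smul,
    Fin.val_succ, pow_succ, mul_neg, mul_one, neg_smul, Finset.sum_neg_distrib] at h0
  exact (eq_of_sub_eq_zero (by rw [sub_eq_add_neg]; exact h0)).symm

/-- The Poincaré lemma on a ball. -/
theorem exists_extDeriv_eq [FiniteDimensional ℝ E] [FiniteDimensional ℝ V] {k : ℕ} {c : E} {r : ℝ}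
    {η : E → E [⋀^Fin (k + 1)]→L[ℝ] V} (hη : ContDiffOn ℝ ∞ η (ball c r))
    (hd : ∀ x ∈ ball c r, extDeriv η x = 0) :
    ∃ ζ : E → E [⋀^Fin k]→L[ℝ] V, ContDiffOn ℝ ∞ ζ (ball c r) ∧
      ∀ x ∈ ball c r, extDeriv ζ x = η x := by
  have hcompl : CompleteSpace (E [⋀^Fin (k + 1)]→L[ℝ] V) := FiniteDimensional.complete ℝ _
  have hcompl' : CompleteSpace (E [⋀^Fin (k + 1 + 1)]→L[ℝ] V) := FiniteDimensional.complete ℝ _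
  set J := radialIntegral c k η with hJ
  have hJs : ContDiffOn ℝ ∞ J (ball c r) := contDiffOn_radialIntegral k hη
  -- The homotopy operator: the integral of t^k η at c + t(x - c), contracted with x - c.
  let ζ : E → E [⋀^Fin k]→L[ℝ] V := fun x => (J x).curryLeft (x - c)
  have hζ : ∀ x w, ζ x w = J x (Matrix.vecCons (x - c) w) := fun x w =>
    ContinuousAlternatingMap.curryLeft_apply_apply _ _ _
  have hζs : ContDiffOn ℝ ∞ ζ (ball c r) := by
    refine contDiffOn_form fun w => ?_
    have e : (fun y => ζ y w) =
        fun y => J y (fun i => (Matrix.vecCons (y - c) w : Fin (k + 1) → E) i) := by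
      funext y; exact hζ y w
    rw [e]
    refine contDiffOn_form_apply
      (X := fun i y => (Matrix.vecCons (y - c) w : Fin (k + 1) → E) i) hJs fun i => ?_
    refine Fin.cases ?_ (fun j => ?_) i
    · simpa using contDiffOn_id.sub contDiffOn_const
    · simpa using contDiffOn_const
  refine ⟨ζ, hζs, fun x hx => ?_⟩
  have hnhds := isOpen_ball.mem_nhds hx
  have hJd : HasFDerivAt J (radialIntegral c (k + 1) (fderiv ℝ η) x) x :=
    hasFDerivAt_radialIntegral k (hη.of_le (by simp)) hx
  -- Alternation is continuous and linear, hence passes through the integral, where it meets dη = 0.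
  have hK0 : ContinuousAlternatingMap.alternatizeUncurryFin
      (radialIntegral c (k + 1) (fderiv ℝ η) x) = 0 :=
    map_radialIntegral_eq_zero (k + 1)
      (hη.continuousOn_fderiv_of_isOpen isOpen_ball (by simp)) hx
      (ContinuousAlternatingMap.alternatizeUncurryFinCLM (n := k + 1) ℝ E V) hd
  have hftc := radialIntegral_ftc k (hη.of_le (by simp)) hx
  set K := radialIntegral c (k + 1) (fderiv ℝ η) x with hK
  have hζd : DifferentiableAt ℝ ζ x := (hζs.differentiableOn (by simp)).differentiableAt hnhds
  have hdζ : ∀ u w, fderiv ℝ ζ x u w =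
      K u (Matrix.vecCons (x - c) w) + J x (Matrix.vecCons u w) := by
    intro u w
    let X : Fin (k + 1) → E → E := fun i y => (Matrix.vecCons (y - c) w : Fin (k + 1) → E) i
    let X' : Fin (k + 1) → E →L[ℝ] E :=
      Matrix.vecCons (ContinuousLinearMap.id ℝ E) (fun _ => 0)
    have hX : ∀ i, HasFDerivAt (X i) (X' i) x := by
      intro i
      refine Fin.cases ?_ (fun j => ?_) i
      · simpa [X, X'] using (hasFDerivAt_id x).sub_const c
      · simpa [X, X'] using hasFDerivAt_const (w j) x
    have h1 := (hJd.continuousAlternatingMap_apply hX).fderiv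
    have h2 : fderiv ℝ ζ x u w = fderiv ℝ (fun y => J y (X · y)) x u := by
      rw [← fderiv_continuousAlternatingMap_apply_const_apply hζd]
      exact congrArg (fun f => fderiv ℝ f x u) (funext fun y => hζ y w)
    rw [h2, h1, add_apply, sum_apply, Fin.sum_univ_succ]
    have h3 : ∀ i : Fin k, ((J x).toContinuousLinearMap (X · x) i.succ ∘L X' i.succ) u = 0 := by
      intro i
      simp [X']
    rw [Finset.sum_eq_zero fun i _ => h3 i, add_zero]
    congr 1
    simp only [ContinuousLinearMap.comp_apply, ContinuousAlternatingMap.toContinuousLinearMap_apply]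
    congr 1
    ext i
    refine Fin.cases ?_ (fun j => ?_) i
    · simp [X']
    · simp [X]
  ext v
  have h1 := congrArg (fun f => f v)
    (ContinuousAlternatingMap.alternatizeUncurryFin_curryLeft (J x))
  simp only [ContinuousAlternatingMap.alternatizeUncurryFin_apply,
    ContinuousAlternatingMap.curryLeft_apply_apply] at h1
  rw [extDeriv, ContinuousAlternatingMap.alternatizeUncurryFin_apply]
  simp only [hdζ, smul_add, Finset.sum_add_distrib]
  -- Of the two sums coming from the product rule, one is K (x - c) v and the other (k + 1) J x v;
  -- `radialIntegral_ftc` says that they add up to η.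
  rw [alternatizeUncurryFin_contract K hK0, h1, ← hftc]
  simp [add_comm, ← Nat.cast_smul_eq_nsmul ℝ, hJ]

end Poincare

/-! ### Coframings on open sets of ℝ⁵ and the contact equation -/

section StructureEquations

open Set

/-- `X` is the frame dual to the real coframe `π⁰, Re π¹, Im π¹, Re π², Im π²`. -/
structure IsDualFrame {E : Type*} [AddCommGroup E] [Module ℝ E] [TopologicalSpace E]
    (π₀ : E [⋀^Fin 1]→L[ℝ] ℝ) (π : Fin 2 → E [⋀^Fin 1]→L[ℝ] ℂ) (X : Fin 5 → E) : Prop where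
  z0 : π₀ ![X 0] = 1
  z1 : π₀ ![X 1] = 0
  z2 : π₀ ![X 2] = 0
  z3 : π₀ ![X 3] = 0
  z4 : π₀ ![X 4] = 0
  a0 : π 0 ![X 0] = 0
  a1 : π 0 ![X 1] = 1
  a2 : π 0 ![X 2] = Complex.I
  a3 : π 0 ![X 3] = 0
  a4 : π 0 ![X 4] = 0
  b0 : π 1 ![X 0] = 0
  b1 : π 1 ![X 1] = 0
  b2 : π 1 ![X 2] = 0
  b3 : π 1 ![X 3] = 1
  b4 : π 1 ![X 4] = Complex.I

/-- A smooth coframing over the open set `W` of `ℝ⁵`. -/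
structure IsCoframing (W : Set R5) (π₀ : R5 → R5 [⋀^Fin 1]→L[ℝ] ℝ)
    (π : Fin 2 → R5 → R5 [⋀^Fin 1]→L[ℝ] ℂ) : Prop where
  isOpen : IsOpen W
  smooth₀ : ContDiffOn ℝ ∞ π₀ W
  smooth : ∀ i, ContDiffOn ℝ ∞ (π i) W
  coframe : ∀ y ∈ W, ∀ v, π₀ y ![v] = 0 → (∀ i, π i y ![v] = 0) → v = 0

variable {W : Set R5} {π₀ : R5 → R5 [⋀^Fin 1]→L[ℝ] ℝ} {π : Fin 2 → R5 → R5 [⋀^Fin 1]→L[ℝ] ℂ}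

theorem minSmoothness_two_le : minSmoothness ℝ 2 ≤ (∞ : WithTop ℕ∞) := by
  simp only [minSmoothness_of_isRCLikeNormedField]
  exact WithTop.coe_le_coe.2 (le_top : (2 : ℕ∞) ≤ ⊤)

theorem map_one_add {E A : Type*} [AddCommGroup E] [Module ℝ E] [TopologicalSpace E]
    [AddCommGroup A] [Module ℝ A] [TopologicalSpace A]
    (α : E [⋀^Fin 1]→L[ℝ] A) (u v : E) : α ![u + v] = α ![u] + α ![v] := by
  have e : ∀ x, Function.update ![u] 0 x = ![x] := fun x => by ext i; fin_cases i; simp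
  simpa only [e] using α.map_update_add ![u] 0 u v

theorem map_one_smul {E A : Type*} [AddCommGroup E] [Module ℝ E] [TopologicalSpace E]
    [AddCommGroup A] [Module ℝ A] [TopologicalSpace A]
    (α : E [⋀^Fin 1]→L[ℝ] A) (c : ℝ) (v : E) : α ![c • v] = c • α ![v] := by
  have e : ∀ x, Function.update ![v] 0 x = ![x] := fun x => by ext i; fin_cases i; simp
  simpa only [e] using α.map_update_smul ![v] 0 c v

/-- The components of a vector in the real coframe. -/
def coframeMap (π₀ : R5 [⋀^Fin 1]→L[ℝ] ℝ) (π : Fin 2 → R5 [⋀^Fin 1]→L[ℝ] ℂ) : R5 →L[ℝ] R5 :=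
  LinearMap.toContinuousLinearMap
    { toFun := fun v => !₂[π₀ ![v], (π 0 ![v]).re, (π 0 ![v]).im, (π 1 ![v]).re, (π 1 ![v]).im]
      map_add' := fun u v => by
        ext i; fin_cases i <;> simp [map_one_add]
      map_smul' := fun c v => by
        ext i; fin_cases i <;> simp [map_one_smul] }

theorem coframeMap_apply (π₀ : R5 [⋀^Fin 1]→L[ℝ] ℝ) (π : Fin 2 → R5 [⋀^Fin 1]→L[ℝ] ℂ) (v : R5) :
    coframeMap π₀ π v =
      !₂[π₀ ![v], (π 0 ![v]).re, (π 0 ![v]).im, (π 1 ![v]).re, (π 1 ![v]).im] := rfl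

theorem isDualFrame_of_coframeMap {π₀ : R5 [⋀^Fin 1]→L[ℝ] ℝ} {π : Fin 2 → R5 [⋀^Fin 1]→L[ℝ] ℂ}
    {X : Fin 5 → R5} (h : ∀ a, coframeMap π₀ π (X a) = EuclideanSpace.single a 1) :
    IsDualFrame π₀ π X := by
  have h' : ∀ a i, coframeMap π₀ π (X a) i = if i = a then 1 else 0 := fun a i => by
    rw [h]; simp
  simp only [coframeMap_apply] at h'
  have e0 := fun a => h' a 0
  have e1 := fun a => h' a 1
  have e2 := fun a => h' a 2
  have e3 := fun a => h' a 3
  have e4 := fun a => h' a 4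
  simp at e0 e1 e2 e3 e4
  constructor <;> first | (rw [e0]; rfl) | (apply Complex.ext <;> simp [e1, e2, e3, e4])

/-- The coframe gives an injective endomorphism of ℝ⁵, hence an invertible one. Its inverse applied
to the standard basis is the dual frame, and it is smooth because inversion of invertible operators
is. -/
theorem IsCoframing.exists_frame (h : IsCoframing W π₀ π) :
    ∃ X : Fin 5 → R5 → R5, (∀ a, ContDiffOn ℝ ∞ (X a) W) ∧
      ∀ y ∈ W, IsDualFrame (π₀ y) (fun i => π i y) (fun a => X a y) := by
  let T : R5 → R5 →L[ℝ] R5 := fun y => coframeMap (π₀ y) (fun i => π i y)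
  have hT : ContDiffOn ℝ ∞ T W := by
    refine contDiffOn_clm_apply.2 fun v => ?_
    rw [contDiffOn_euclidean]
    have h0 : ContDiffOn ℝ ∞ (fun y => π₀ y ![v]) W := contDiffOn_form_apply_const h.smooth₀ _
    have h1 := fun i => contDiffOn_form_apply_const (h.smooth i) ![v]
    have hre := fun i => Complex.reCLM.contDiff.comp_contDiffOn (h1 i)
    have him := fun i => Complex.imCLM.contDiff.comp_contDiffOn (h1 i)
    intro i
    fin_cases i
    · exact h0
    · exact hre 0
    · exact him 0
    · exact hre 1
    · exact him 1
  have hinj : ∀ y ∈ W, Function.Injective (T y) := by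
    intro y hy
    rw [injective_iff_map_eq_zero]
    intro v hv
    have e : ∀ i, T y v i = 0 := fun i => by rw [hv]; rfl
    simp only [T, coframeMap_apply] at e
    have e0 := e 0
    have e1 := e 1
    have e2 := e 2
    have e3 := e 3
    have e4 := e 4
    simp at e0 e1 e2 e3 e4
    refine h.coframe y hy v e0 fun i => ?_
    fin_cases i
    · exact Complex.ext e1 e2
    · exact Complex.ext e3 e4
  have hequiv : ∀ y ∈ W, ∃ e : R5 ≃L[ℝ] R5, (e : R5 →L[ℝ] R5) = T y := fun y hy =>
    ⟨(LinearEquiv.ofInjectiveEndo (T y).toLinearMap (hinj y hy)).toContinuousLinearEquiv, by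
      ext v; rfl⟩
  refine ⟨fun a y => (T y).inverse (EuclideanSpace.single a 1), fun a => ?_, fun y hy => ?_⟩
  · refine ContDiffOn.clm_apply (fun y hy => ?_) contDiffOn_const
    obtain ⟨e, he⟩ := hequiv y hy
    have h1 : ContDiffAt ℝ ∞ ContinuousLinearMap.inverse (T y) := he ▸ contDiffAt_map_inverse e
    exact h1.comp_contDiffWithinAt y (hT y hy)
  · refine isDualFrame_of_coframeMap fun a => ?_
    obtain ⟨e, he⟩ := hequiv y hy
    change T y ((T y).inverse _) = _
    rw [← he, ContinuousLinearMap.inverse_equiv]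
    simp

/-- The form `Ω = π¹ ∧ π²`. -/
def vol (π : Fin 2 → R5 → R5 [⋀^Fin 1]→L[ℝ] ℂ) (y : R5) : R5 [⋀^Fin 2]→L[ℝ] ℂ :=
  wedge (π 0 y) (π 1 y)

/-- The form `ρ = π⁰ ∧ Re Ω`. -/
def pcLocal (π₀ : R5 → R5 [⋀^Fin 1]→L[ℝ] ℝ) (π : Fin 2 → R5 → R5 [⋀^Fin 1]→L[ℝ] ℂ) (y : R5) :
    R5 [⋀^Fin 3]→L[ℝ] ℝ :=
  wedge (π₀ y) (reForm (wedge (π 0 y) (π 1 y)))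

theorem contDiffOn_reForm {k : ℕ} {α : R5 → R5 [⋀^Fin k]→L[ℝ] ℂ} (h : ContDiffOn ℝ ∞ α W) :
    ContDiffOn ℝ ∞ (fun y => reForm (α y)) W :=
  contDiffOn_form fun v => Complex.reCLM.contDiff.comp_contDiffOn (contDiffOn_form_apply_const h v)

theorem contDiffOn_imForm {k : ℕ} {α : R5 → R5 [⋀^Fin k]→L[ℝ] ℂ} (h : ContDiffOn ℝ ∞ α W) :
    ContDiffOn ℝ ∞ (fun y => imForm (α y)) W :=
  contDiffOn_form fun v => Complex.imCLM.contDiff.comp_contDiffOn (contDiffOn_form_apply_const h v)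

theorem contDiffOn_ofRealForm {k : ℕ} {α : R5 → R5 [⋀^Fin k]→L[ℝ] ℝ} (h : ContDiffOn ℝ ∞ α W) :
    ContDiffOn ℝ ∞ (fun y => ofRealForm (α y)) W :=
  contDiffOn_form fun v =>
    Complex.ofRealCLM.contDiff.comp_contDiffOn (contDiffOn_form_apply_const h v)

theorem differentiableAt_of_contDiffOn {V : Type*} [NormedAddCommGroup V] [NormedSpace ℝ V]
    {f : R5 → V} (hW : IsOpen W) (h : ContDiffOn ℝ ∞ f W) {y : R5} (hy : y ∈ W) :
    DifferentiableAt ℝ f y :=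
  (h.differentiableOn (by simp)).differentiableAt (hW.mem_nhds hy)

theorem contDiffAt_of_contDiffOn {V : Type*} [NormedAddCommGroup V] [NormedSpace ℝ V]
    {f : R5 → V} (hW : IsOpen W) (h : ContDiffOn ℝ ∞ f W) {y : R5} (hy : y ∈ W) :
    ContDiffAt ℝ ∞ f y := h.contDiffAt (hW.mem_nhds hy)

theorem IsCoframing.contDiffOn_vol (h : IsCoframing W π₀ π) : ContDiffOn ℝ ∞ (vol π) W :=
  contDiffOn_wedge (h.smooth 0) (h.smooth 1)

theorem IsCoframing.contDiffOn_pcLocal (h : IsCoframing W π₀ π) :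
    ContDiffOn ℝ ∞ (pcLocal π₀ π) W :=
  contDiffOn_wedge (p := 1) (q := 2) h.smooth₀ (contDiffOn_reForm h.contDiffOn_vol)

theorem IsCoframing.extDeriv_vol (h : IsCoframing W π₀ π) {y : R5} (hy : y ∈ W) (u v w : R5) :
    extDeriv (vol π) y ![u, v, w] =
      extDeriv (π 0) y ![u, v] * π 1 y ![w] - extDeriv (π 0) y ![u, w] * π 1 y ![v]
        + extDeriv (π 0) y ![v, w] * π 1 y ![u]
      - (π 0 y ![u] * extDeriv (π 1) y ![v, w] - π 0 y ![v] * extDeriv (π 1) y ![u, w]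
        + π 0 y ![w] * extDeriv (π 1) y ![u, v]) :=
  extDeriv_wedge_one_one (differentiableAt_of_contDiffOn h.isOpen (h.smooth 0) hy)
    (differentiableAt_of_contDiffOn h.isOpen (h.smooth 1) hy) u v w

theorem vol_apply (y u v : R5) :
    vol π y ![u, v] = π 0 y ![u] * π 1 y ![v] - π 0 y ![v] * π 1 y ![u] := by
  rw [vol, wedge_one_one]; rfl

theorem pcLocal_apply (y u v w : R5) :
    pcLocal π₀ π y ![u, v, w] = π₀ y ![u] * (vol π y ![v, w]).re - π₀ y ![v] * (vol π y ![u, w]).re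
      + π₀ y ![w] * (vol π y ![u, v]).re := by
  rw [pcLocal, wedge_one_two]; rfl

/-- The structure equation `dπ⁰ = -ψ⁰₀ ∧ π⁰ + Im (π¹ ∧ π²)`. -/
structure IsContactEq (W : Set R5) (π₀ : R5 → R5 [⋀^Fin 1]→L[ℝ] ℝ)
    (π : Fin 2 → R5 → R5 [⋀^Fin 1]→L[ℝ] ℂ) (ψ₀ : R5 → R5 [⋀^Fin 1]→L[ℝ] ℝ) : Prop where
  smooth : ContDiffOn ℝ ∞ ψ₀ W
  eq : ∀ y ∈ W, extDeriv π₀ y = -wedge (ψ₀ y) (π₀ y) + imForm (wedge (π 0 y) (π 1 y))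

variable {ψ₀ : R5 → R5 [⋀^Fin 1]→L[ℝ] ℝ}

theorem IsContactEq.apply (hψ : IsContactEq W π₀ π ψ₀) {y : R5} (hy : y ∈ W) (u v : R5) :
    extDeriv π₀ y ![u, v] =
      -(ψ₀ y ![u] * π₀ y ![v] - ψ₀ y ![v] * π₀ y ![u]) + (vol π y ![u, v]).im := by
  have h := congrArg (fun f => f ![u, v]) (hψ.eq y hy)
  simp only [ContinuousAlternatingMap.add_apply, ContinuousAlternatingMap.neg_apply,
    imForm_apply] at h
  rw [h, wedge_one_one]
  rfl

/-- The consequence of `d(dπ⁰) = 0`. -/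
theorem IsContactEq.extDeriv_psi (hc : IsCoframing W π₀ π) (hψ : IsContactEq W π₀ π ψ₀) {y : R5}
    (hy : y ∈ W) (u v w : R5) :
    extDeriv ψ₀ y ![u, v] * π₀ y ![w] - extDeriv ψ₀ y ![u, w] * π₀ y ![v]
        + extDeriv ψ₀ y ![v, w] * π₀ y ![u] =
      ψ₀ y ![u] * (vol π y ![v, w]).im - ψ₀ y ![v] * (vol π y ![u, w]).im
        + ψ₀ y ![w] * (vol π y ![u, v]).im + (extDeriv (vol π) y ![u, v, w]).im := by
  have h1 : extDeriv (extDeriv π₀) y = 0 := extDeriv_extDeriv_apply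
    (contDiffAt_of_contDiffOn hc.isOpen hc.smooth₀ hy) minSmoothness_two_le
  have e : extDeriv π₀ =ᶠ[nhds y]
      ((-fun y => wedge (ψ₀ y) (π₀ y)) + fun y => imForm (vol π y)) := by
    filter_upwards [hc.isOpen.mem_nhds hy] with z hz
    exact hψ.eq z hz
  have d1 : DifferentiableAt ℝ (fun y => wedge (ψ₀ y) (π₀ y)) y :=
    differentiableAt_of_contDiffOn hc.isOpen (contDiffOn_wedge hψ.smooth hc.smooth₀) hy
  have d2 : DifferentiableAt ℝ (fun y => imForm (vol π y)) y :=
    differentiableAt_of_contDiffOn hc.isOpen (contDiffOn_imForm hc.contDiffOn_vol) hy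
  have e2 : extDeriv (-fun y => wedge (ψ₀ y) (π₀ y)) y = -extDeriv (fun y => wedge (ψ₀ y) (π₀ y)) y := by
    have := extDeriv_smul (-1 : ℝ) (fun y => wedge (ψ₀ y) (π₀ y)) (x := y)
    simpa using this
  have e3 : extDeriv (fun y => imForm (vol π y)) y = imForm (extDeriv (vol π) y) :=
    extDeriv_comp_left Complex.imCLM
      (differentiableAt_of_contDiffOn hc.isOpen hc.contDiffOn_vol hy)
  rw [e.extDeriv_eq, extDeriv_add d1.neg d2, e2, e3] at h1
  have h2 := congrArg (fun f => f ![u, v, w]) h1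
  simp only [ContinuousAlternatingMap.add_apply, ContinuousAlternatingMap.neg_apply,
    imForm_apply, ContinuousAlternatingMap.coe_zero, Pi.zero_apply] at h2
  rw [extDeriv_wedge_one_one (differentiableAt_of_contDiffOn hc.isOpen hψ.smooth hy)
    (differentiableAt_of_contDiffOn hc.isOpen hc.smooth₀ hy)] at h2
  -- Substituting dπ⁰ into ψ⁰₀ ∧ dπ⁰ leaves ψ⁰₀ ∧ Im Ω only, because ψ⁰₀ ∧ ψ⁰₀ = 0.
  simp only [hψ.apply hy] at h2
  linarith

/-- The exterior derivative of `π⁰ ∧ Re Ω`. -/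
theorem IsContactEq.extDeriv_pcLocal (hc : IsCoframing W π₀ π) (hψ : IsContactEq W π₀ π ψ₀) {y : R5}
    (hy : y ∈ W) (u v w x : R5) :
    extDeriv (pcLocal π₀ π) y ![u, v, w, x] =
      -(ψ₀ y ![u] * pcLocal π₀ π y ![v, w, x] - ψ₀ y ![v] * pcLocal π₀ π y ![u, w, x]
        + ψ₀ y ![w] * pcLocal π₀ π y ![u, v, x] - ψ₀ y ![x] * pcLocal π₀ π y ![u, v, w])
      - (π₀ y ![u] * (extDeriv (vol π) y ![v, w, x]).re
        - π₀ y ![v] * (extDeriv (vol π) y ![u, w, x]).re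
        + π₀ y ![w] * (extDeriv (vol π) y ![u, v, x]).re
        - π₀ y ![x] * (extDeriv (vol π) y ![u, v, w]).re) := by
  have e3 : extDeriv (fun y => reForm (vol π y)) y = reForm (extDeriv (vol π) y) :=
    extDeriv_comp_left Complex.reCLM
      (differentiableAt_of_contDiffOn hc.isOpen hc.contDiffOn_vol hy)
  have h := extDeriv_wedge_one_two (differentiableAt_of_contDiffOn hc.isOpen hc.smooth₀ hy)
    (differentiableAt_of_contDiffOn hc.isOpen (contDiffOn_reForm hc.contDiffOn_vol) hy) u v w x
  refine h.trans ?_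
  simp only [e3, reForm_apply, hψ.apply hy, pcLocal_apply]
  -- The term Im Ω ∧ Re Ω from dπ⁰ ∧ Re Ω vanishes since Ω ∧ Ω = 0. To see this Ω must be expanded
  -- into its two factors.
  simp only [vol_apply, Complex.sub_re, Complex.sub_im, Complex.mul_re, Complex.mul_im]
  ring

/-- If `dρ = -2 ψ ∧ ρ`, then `dψ ∧ ρ = 0`. -/
theorem extDeriv_wedge_eq_zero_of_extDeriv_eq (hW : IsOpen W) {ψ : R5 → R5 [⋀^Fin 1]→L[ℝ] ℝ}
    {ρ : R5 → R5 [⋀^Fin 3]→L[ℝ] ℝ} (hψ : ContDiffOn ℝ ∞ ψ W) (hρ : ContDiffOn ℝ ∞ ρ W)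
    (h : ∀ y ∈ W, extDeriv ρ y = (-2 : ℝ) • wedge (ψ y) (ρ y)) {y : R5} (hy : y ∈ W)
    (u v w x z : R5) :
    extDeriv ψ y ![u, v] * ρ y ![w, x, z] - extDeriv ψ y ![u, w] * ρ y ![v, x, z]
        + extDeriv ψ y ![u, x] * ρ y ![v, w, z] - extDeriv ψ y ![u, z] * ρ y ![v, w, x]
        + extDeriv ψ y ![v, w] * ρ y ![u, x, z] - extDeriv ψ y ![v, x] * ρ y ![u, w, z]
        + extDeriv ψ y ![v, z] * ρ y ![u, w, x] + extDeriv ψ y ![w, x] * ρ y ![u, v, z]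
        - extDeriv ψ y ![w, z] * ρ y ![u, v, x] + extDeriv ψ y ![x, z] * ρ y ![u, v, w] = 0 := by
  have h1 : extDeriv (extDeriv ρ) y = 0 := extDeriv_extDeriv_apply
    (contDiffAt_of_contDiffOn hW hρ hy) minSmoothness_two_le
  have e : extDeriv ρ =ᶠ[nhds y] ((-2 : ℝ) • fun y => wedge (ψ y) (ρ y)) := by
    filter_upwards [hW.mem_nhds hy] with z hz
    exact h z hz
  rw [e.extDeriv_eq, extDeriv_smul] at h1
  have h2 := congrArg (fun f => f ![u, v, w, x, z]) h1
  simp only [ContinuousAlternatingMap.smul_apply, ContinuousAlternatingMap.coe_zero,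
    Pi.zero_apply] at h2
  rw [extDeriv_wedge_one_three (differentiableAt_of_contDiffOn hW hψ hy)
    (differentiableAt_of_contDiffOn hW hρ hy)] at h2
  -- In d(ψ ∧ ρ) = dψ ∧ ρ - ψ ∧ dρ the second term is a multiple of ψ ∧ ψ ∧ ρ = 0.
  have h3 : ∀ a b c d : R5, extDeriv ρ y ![a, b, c, d] = -2 * (ψ y ![a] * ρ y ![b, c, d]
      - ψ y ![b] * ρ y ![a, c, d] + ψ y ![c] * ρ y ![a, b, d] - ψ y ![d] * ρ y ![a, b, c]) := by
    intro a b c d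
    rw [h y hy, ContinuousAlternatingMap.smul_apply, wedge_one_three, smul_eq_mul]
    rfl
  simp only [h3, smul_eq_mul] at h2
  linarith

end StructureEquations

/-! ### Consequences of the reduced structure equations -/

section Reduced

open Set

variable {W : Set R5} {π₀ : R5 → R5 [⋀^Fin 1]→L[ℝ] ℝ} {π : Fin 2 → R5 → R5 [⋀^Fin 1]→L[ℝ] ℂ}
  {ψ₀ : R5 → R5 [⋀^Fin 1]→L[ℝ] ℝ}

/-- The structure equations for `dπ¹`, `dπ²` at the point `y`. -/
structure IsReducedAt (π₀ : R5 → R5 [⋀^Fin 1]→L[ℝ] ℝ) (π : Fin 2 → R5 → R5 [⋀^Fin 1]→L[ℝ] ℂ)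
    (ψ₀ : R5 → R5 [⋀^Fin 1]→L[ℝ] ℝ) (ψ : Fin 2 → Fin 2 → R5 [⋀^Fin 1]→L[ℝ] ℂ)
    (P : Matrix (Fin 2) (Fin 2) ℂ) (y : R5) : Prop where
  trace : ψ 0 0 + ψ 1 1 = ofRealForm (ψ₀ y)
  eq : ∀ i, extDeriv (π i) y = -(∑ j, wedge (ψ i j) (π j y))
    - ∑ j, P i j • wedge (conjForm (π j y)) (ofRealForm (π₀ y))

/-- The component `Q` of `dΩ = -ψ⁰₀ ∧ Ω + π⁰ ∧ Q`. -/
def torsionForm (P : Matrix (Fin 2) (Fin 2) ℂ) (π : Fin 2 → R5 [⋀^Fin 1]→L[ℝ] ℂ) (u v : R5) : ℂ :=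
  ∑ j, (P 0 j * (conj (π j ![u]) * π 1 ![v] - conj (π j ![v]) * π 1 ![u])
    - P 1 j * (conj (π j ![u]) * π 0 ![v] - conj (π j ![v]) * π 0 ![u]))

variable {ψ : Fin 2 → Fin 2 → R5 [⋀^Fin 1]→L[ℝ] ℂ} {P : Matrix (Fin 2) (Fin 2) ℂ}

theorem IsReducedAt.apply {y : R5} (h : IsReducedAt π₀ π ψ₀ ψ P y) (i : Fin 2) (u v : R5) :
    extDeriv (π i) y ![u, v] =
      -((ψ i 0 ![u] * π 0 y ![v] - ψ i 0 ![v] * π 0 y ![u])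
        + (ψ i 1 ![u] * π 1 y ![v] - ψ i 1 ![v] * π 1 y ![u]))
      - (P i 0 * (conj (π 0 y ![u]) * π₀ y ![v] - conj (π 0 y ![v]) * π₀ y ![u])
        + P i 1 * (conj (π 1 y ![u]) * π₀ y ![v] - conj (π 1 y ![v]) * π₀ y ![u])) := by
  rw [h.eq i]
  simp only [Fin.sum_univ_two, ContinuousAlternatingMap.sub_apply,
    ContinuousAlternatingMap.neg_apply, ContinuousAlternatingMap.add_apply,
    ContinuousAlternatingMap.smul_apply, wedge_one_one, conjForm_apply, ofRealForm_apply,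
    smul_eq_mul]
  rfl

/-- In dπ¹ ∧ π² - π¹ ∧ dπ² the off-diagonal ψⁱⱼ disappear and the diagonal ones enter only through
their trace ψ⁰₀; what is left is the torsion, collected in Q. -/
theorem IsReducedAt.extDeriv_vol (hc : IsCoframing W π₀ π) {y : R5} (hy : y ∈ W)
    (h : IsReducedAt π₀ π ψ₀ ψ P y) (u v w : R5) :
    extDeriv (vol π) y ![u, v, w] =
      -(ψ₀ y ![u] * vol π y ![v, w] - ψ₀ y ![v] * vol π y ![u, w] + ψ₀ y ![w] * vol π y ![u, v])
      + (π₀ y ![u] * torsionForm P (fun i => π i y) v w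
        - π₀ y ![v] * torsionForm P (fun i => π i y) u w
        + π₀ y ![w] * torsionForm P (fun i => π i y) u v) := by
  have ht : ∀ x, ψ 1 1 ![x] = ψ₀ y ![x] - ψ 0 0 ![x] := fun x => by
    have := congrArg (fun f => f ![x]) h.trace
    simp only [ContinuousAlternatingMap.add_apply, ofRealForm_apply] at this
    rw [← this]; ring
  rw [hc.extDeriv_vol hy]
  simp only [h.apply, vol_apply, torsionForm, Fin.sum_univ_two, ht]
  ring

/-- The terms ψ⁰₀ ∧ Im Ω from d(dπ⁰) and from dΩ cancel. This is the link between S₂ and dψ⁰₀: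
modulo π⁰, the curvature dψ⁰₀ is Im Q. -/
theorem extDeriv_psi_reduced (hc : IsCoframing W π₀ π) (hψ : IsContactEq W π₀ π ψ₀) {y : R5}
    (hy : y ∈ W) (h : IsReducedAt π₀ π ψ₀ ψ P y) (u v w : R5) :
    extDeriv ψ₀ y ![u, v] * π₀ y ![w] - extDeriv ψ₀ y ![u, w] * π₀ y ![v]
        + extDeriv ψ₀ y ![v, w] * π₀ y ![u] =
      π₀ y ![u] * (torsionForm P (fun i => π i y) v w).im
        - π₀ y ![v] * (torsionForm P (fun i => π i y) u w).im
        + π₀ y ![w] * (torsionForm P (fun i => π i y) u v).im := by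
  rw [hψ.extDeriv_psi hc hy, h.extDeriv_vol hc hy]
  simp only [Complex.add_im, Complex.sub_im, Complex.neg_im,
    Complex.im_ofReal_mul]
  ring

/-- One copy of -ψ⁰₀ ∧ ρ comes from dπ⁰ and one from dΩ; the torsion drops out because π⁰ ∧ π⁰ = 0.
-/
theorem extDeriv_pcLocal_reduced (hc : IsCoframing W π₀ π) (hψ : IsContactEq W π₀ π ψ₀) {y : R5}
    (hy : y ∈ W) (h : IsReducedAt π₀ π ψ₀ ψ P y) :
    extDeriv (pcLocal π₀ π) y = (-2 : ℝ) • wedge (ψ₀ y) (pcLocal π₀ π y) := by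
  ext v
  have e : v = ![v 0, v 1, v 2, v 3] := by ext i; fin_cases i <;> rfl
  rw [ContinuousAlternatingMap.smul_apply, wedge_one_three, e, hψ.extDeriv_pcLocal hc hy]
  simp only [h.extDeriv_vol hc hy, pcLocal_apply, Complex.add_re, Complex.sub_re, Complex.neg_re,
    Complex.re_ofReal_mul, smul_eq_mul, Matrix.cons_val]
  ring

theorem IsDualFrame.apply_zero {X : Fin 5 → R5} {ϖ₀ : R5 [⋀^Fin 1]→L[ℝ] ℝ}
    {ϖ : Fin 2 → R5 [⋀^Fin 1]→L[ℝ] ℂ} (hX : IsDualFrame ϖ₀ ϖ X) (a : Fin 5) (ha : 1 ≤ a) :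
    ϖ₀ ![X a] = 0 := by
  obtain ⟨z0, z1, z2, z3, z4, -⟩ := hX
  fin_cases a
  · exact absurd ha (by decide)
  all_goals assumption

theorem IsDualFrame.linearIndependent {X : Fin 5 → R5} {ϖ₀ : R5 [⋀^Fin 1]→L[ℝ] ℝ}
    {ϖ : Fin 2 → R5 [⋀^Fin 1]→L[ℝ] ℂ} (hX : IsDualFrame ϖ₀ ϖ X) : LinearIndependent ℝ X := by
  obtain ⟨z0, z1, z2, z3, z4, a0, a1, a2, a3, a4, b0, b1, b2, b3, b4⟩ := hX
  rw [Fintype.linearIndependent_iff]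
  intro g hg
  rw [Fin.sum_univ_five] at hg
  have e0 := congrArg (fun v => ϖ₀ ![v]) hg
  have e1 := congrArg (fun v => ϖ 0 ![v]) hg
  have e2 := congrArg (fun v => ϖ 1 ![v]) hg
  have n0 : ϖ₀ ![0] = 0 := ϖ₀.map_coord_zero 0 rfl
  have n1 : ∀ i, ϖ i ![0] = 0 := fun i => (ϖ i).map_coord_zero 0 rfl
  clear hg
  simp [map_one_add, map_one_smul, Complex.ext_iff, *] at e0 e1 e2
  intro i
  fin_cases i <;> simp [e0, e1, e2]

/-- The basis of `ℝ⁵` given by a dual frame. -/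
def IsDualFrame.basis {X : Fin 5 → R5} {ϖ₀ : R5 [⋀^Fin 1]→L[ℝ] ℝ}
    {ϖ : Fin 2 → R5 [⋀^Fin 1]→L[ℝ] ℂ} (hX : IsDualFrame ϖ₀ ϖ X) : Module.Basis (Fin 5) ℝ R5 :=
  basisOfLinearIndependentOfCardEqFinrank hX.linearIndependent (by simp)

theorem IsDualFrame.basis_apply {X : Fin 5 → R5} {ϖ₀ : R5 [⋀^Fin 1]→L[ℝ] ℝ}
    {ϖ : Fin 2 → R5 [⋀^Fin 1]→L[ℝ] ℂ} (hX : IsDualFrame ϖ₀ ϖ X) (a : Fin 5) :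
    hX.basis a = X a := by
  simp [IsDualFrame.basis]

theorem ext_one_basis {A : Type*} [NormedAddCommGroup A] [NormedSpace ℝ A] {n : ℕ}
    (b : Module.Basis (Fin n) ℝ R5) {α β : R5 [⋀^Fin 1]→L[ℝ] A}
    (h : ∀ a, α ![b a] = β ![b a]) : α = β := by
  refine ContinuousAlternatingMap.toAlternatingMap_injective
    (Module.Basis.ext_alternating b fun r _ => ?_)
  have e : (fun i => b (r i)) = ![b (r 0)] := by ext i; fin_cases i; rfl
  rw [e]
  exact h (r 0)

theorem ext_two_basis {A : Type*} [NormedCommRing A] [NormedAlgebra ℝ A] {n : ℕ}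
    (b : Module.Basis (Fin n) ℝ R5) {α β : R5 [⋀^Fin 2]→L[ℝ] A}
    (h : ∀ a c, a < c → α ![b a, b c] = β ![b a, b c]) : α = β := by
  refine ContinuousAlternatingMap.toAlternatingMap_injective
    (Module.Basis.ext_alternating b fun r hr => ?_)
  have e : (fun i => b (r i)) = ![b (r 0), b (r 1)] := by ext i; fin_cases i <;> rfl
  rw [e]
  change α _ = β _
  rcases lt_or_gt_of_ne (hr.ne (by decide : (0 : Fin 2) ≠ 1)) with h1 | h1
  · exact h _ _ h1
  · rw [apply_swap α, apply_swap β, h _ _ h1]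

/-- `S₂` vanishes when `Im Q` is a multiple of `Im Ω` modulo `π⁰`. -/
theorem S₂_eq_zero_of_im_torsionForm {X : Fin 5 → R5} {ϖ₀ : R5 [⋀^Fin 1]→L[ℝ] ℝ}
    {ϖ : Fin 2 → R5 [⋀^Fin 1]→L[ℝ] ℂ} (hX : IsDualFrame ϖ₀ ϖ X) {f : ℝ}
    (h : ∀ a b, 1 ≤ a → 1 ≤ b → (torsionForm P ϖ (X a) (X b)).im =
      f * (ϖ 0 ![X a] * ϖ 1 ![X b] - ϖ 0 ![X b] * ϖ 1 ![X a]).im) : S₂ P = 0 := by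
  obtain ⟨-, -, -, -, -, -, a1, a2, a3, a4, -, b1, b2, b3, b4⟩ := hX
  -- Im Q has type (1,1), so it takes opposite values on (X 1, X 4) and (X 2, X 3), while Im Ω is 1
  -- on both; hence f = 0, and the six values then give every entry of S₂.
  have h12 := h 1 2 (by decide) (by decide)
  have h13 := h 1 3 (by decide) (by decide)
  have h14 := h 1 4 (by decide) (by decide)
  have h23 := h 2 3 (by decide) (by decide)
  have h24 := h 2 4 (by decide) (by decide)
  have h34 := h 3 4 (by decide) (by decide)
  simp [torsionForm, Fin.sum_univ_two, a1, a2, a3, a4, b1, b2, b3, b4] at h12 h13 h14 h23 h24 h34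
  ext i j
  fin_cases i <;> fin_cases j <;> apply Complex.ext <;> simp [S₂] <;> linarith

/-- The coefficients of Im Q in the π̄ʲ ∧ πᵏ are the entries of S₂ up to sign and a constant. As Q
does not involve π⁰, no restriction on u and v is needed. -/
theorem im_torsionForm_eq_zero {ϖ : Fin 2 → R5 [⋀^Fin 1]→L[ℝ] ℂ} (h : S₂ P = 0) (u v : R5) :
    (torsionForm P ϖ u v).im = 0 := by
  have h00 := congrFun (congrFun h 0) 0
  have h01 := congrFun (congrFun h 0) 1
  have h10 := congrFun (congrFun h 1) 0
  simp only [S₂, Complex.ext_iff] at h00 h01 h10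
  simp at h00 h01 h10
  simp [torsionForm, Fin.sum_univ_two]
  obtain ⟨e1, e2⟩ := h00
  have e3 : (P 0 0).re = (P 1 1).re := by linarith
  have e4 : (P 0 0).im = -(P 1 1).im := by linarith
  have e5 : (P 0 1).re = 0 := by linarith
  have e6 : (P 1 0).re = 0 := by linarith
  simp only [e3, e4, e5, e6]
  ring

/-- A closed form which is a nonvanishing multiple of `π⁰ ∧ Re Ω` forces `S₂ = 0`. -/
theorem S₂_eq_zero_of_closed (hc : IsCoframing W π₀ π) (hψ : IsContactEq W π₀ π ψ₀)
    {y : R5} (hy : y ∈ W)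
    (hr : ∀ z ∈ W, ∃ (ψ : Fin 2 → Fin 2 → R5 [⋀^Fin 1]→L[ℝ] ℂ) (P : Matrix (Fin 2) (Fin 2) ℂ),
      IsReducedAt π₀ π ψ₀ ψ P z)
    (h : IsReducedAt π₀ π ψ₀ ψ P y) {η : R5 → R5 [⋀^Fin 3]→L[ℝ] ℝ} (hη : ContDiffOn ℝ ∞ η W)
    (hd : ∀ z ∈ W, extDeriv η z = 0)
    (hρ : ∀ z ∈ W, ∃ c : ℝ, c ≠ 0 ∧ η z = c • pcLocal π₀ π z) : S₂ P = 0 := by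
  obtain ⟨X, hXs, hX⟩ := hc.exists_frame
  -- The factor c is given only pointwise. Since ρ is 1 on this triple, evaluating η there recovers
  -- c as a smooth function.
  let g : R5 → ℝ := fun z => η z ![X 0 z, X 1 z, X 3 z]
  have hgs : ContDiffOn ℝ ∞ g W := by
    have e : g = fun z => η z (fun i => (![X 0, X 1, X 3] : Fin 3 → R5 → R5) i z) := by
      funext z
      simp only [g]
      congr 1
      ext i; fin_cases i <;> rfl
    rw [e]
    refine contDiffOn_form_apply hη fun i => ?_
    fin_cases i <;> simp [hXs]
  have hval : ∀ z ∈ W, pcLocal π₀ π z ![X 0 z, X 1 z, X 3 z] = 1 := fun z hz => by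
    obtain ⟨z0, z1, z2, z3, z4, a0, a1, a2, a3, a4, b0, b1, b2, b3, b4⟩ := hX z hz
    simp [pcLocal_apply, vol_apply, *]
  have hg : ∀ z ∈ W, g z ≠ 0 ∧ η z = g z • pcLocal π₀ π z := fun z hz => by
    obtain ⟨c, hc0, hc⟩ := hρ z hz
    have : g z = c := by
      simp only [g, hc, ContinuousAlternatingMap.smul_apply, hval z hz, smul_eq_mul, mul_one]
    rw [this]; exact ⟨hc0, hc⟩
  have hgd : ∀ z ∈ W, DifferentiableAt ℝ g z := fun z hz =>
    differentiableAt_of_contDiffOn hc.isOpen hgs hz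
  -- `dg = 2 g ψ` on the kernel of `π⁰`
  have hker : ∀ z ∈ W, ∀ a, 1 ≤ a → fderiv ℝ g z (X a z) = 2 * g z * ψ₀ z ![X a z] := by
    intro z hz
    obtain ⟨ψ', P', hr'⟩ := hr z hz
    have e : η =ᶠ[nhds z] fun z => g z • pcLocal π₀ π z := by
      filter_upwards [hc.isOpen.mem_nhds hz] with x hx
      exact (hg x hx).2
    have h0 := hd z hz
    rw [e.extDeriv_eq] at h0
    have h1 : ∀ u v w x, _ = (0 : ℝ) := fun u v w x =>
      (extDeriv_smul_three (hgd z hz) (differentiableAt_of_contDiffOn hc.isOpen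
        hc.contDiffOn_pcLocal hz) u v w x).symm.trans (congrArg (fun f => f ![u, v, w, x]) h0)
    simp only [extDeriv_pcLocal_reduced hc hψ hz hr', ContinuousAlternatingMap.smul_apply,
      wedge_one_three, smul_eq_mul, Matrix.cons_val] at h1
    obtain ⟨z0, z1, z2, z3, z4, a0, a1, a2, a3, a4, b0, b1, b2, b3, b4⟩ := hX z hz
    -- Closedness reads (dg - 2gψ⁰₀) ∧ ρ = 0. As Re Ω is nonzero only on the pairs (1,3) and (2,4),
    -- each of these quadruples isolates one component.
    have k1 := h1 (X 0 z) (X 1 z) (X 2 z) (X 4 z)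
    have k2 := h1 (X 0 z) (X 1 z) (X 2 z) (X 3 z)
    have k3 := h1 (X 0 z) (X 2 z) (X 3 z) (X 4 z)
    have k4 := h1 (X 0 z) (X 1 z) (X 3 z) (X 4 z)
    simp [pcLocal_apply, vol_apply, *] at k1 k2 k3 k4
    intro a ha
    fin_cases a
    · exact absurd ha (by decide)
    all_goals simp only [Fin.mk_one, Fin.reduceFinMk]; linarith
  -- hence `ψ = d log |g| / 2 + f π⁰`
  let L : R5 → ℝ := fun z => 1 / 2 * Real.log (g z)
  -- `Real.log` is log|·|, so g may have either sign.
  have hLs : ContDiffOn ℝ ∞ L W := contDiffOn_const.mul (hgs.log fun z hz => (hg z hz).1)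
  have hLd : ∀ z ∈ W, ∀ v, fderiv ℝ L z v = 1 / 2 * ((g z)⁻¹ * fderiv ℝ g z v) := fun z hz v => by
    have := ((hgd z hz).hasFDerivAt.log (hg z hz).1).const_mul (1 / 2 : ℝ)
    rw [this.fderiv]
    simp
  let dL : R5 → R5 [⋀^Fin 1]→L[ℝ] ℝ :=
    extDeriv fun z => ContinuousAlternatingMap.constOfIsEmpty ℝ R5 (Fin 0) (L z)
  have hL0 : ContDiffOn ℝ ∞ (fun z => ContinuousAlternatingMap.constOfIsEmpty ℝ R5 (Fin 0) (L z)) W :=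
    contDiffOn_form fun v => hLs
  have hdL : ∀ z ∈ W, ∀ v, dL z ![v] = 1 / 2 * ((g z)⁻¹ * fderiv ℝ g z v) := fun z hz v => by
    simp only [dL, extDeriv_constOfIsEmpty]
    exact hLd z hz v
  have hdLs : ContDiffOn ℝ ∞ dL W := contDiffOn_extDeriv hc.isOpen hL0
  have hddL : ∀ z ∈ W, extDeriv dL z = 0 := fun z hz =>
    extDeriv_extDeriv_apply (contDiffAt_of_contDiffOn hc.isOpen hL0 hz) minSmoothness_two_le
  let f : R5 → ℝ := fun z => ψ₀ z ![X 0 z] - dL z ![X 0 z]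
  have hfs : ContDiffOn ℝ ∞ f W := by
    have e : ∀ z, ![X 0 z] = fun i => (![X 0] : Fin 1 → R5 → R5) i z := fun z => by
      ext i; fin_cases i; rfl
    simp only [f, e]
    refine ContDiffOn.sub (contDiffOn_form_apply hψ.smooth fun i => ?_)
      (contDiffOn_form_apply hdLs fun i => ?_) <;> fin_cases i <;> exact hXs 0
  have hψf : ∀ z ∈ W, ψ₀ z = dL z + f z • π₀ z := fun z hz => by
    refine ext_one_basis (hX z hz).basis fun a => ?_
    rw [(hX z hz).basis_apply, ContinuousAlternatingMap.add_apply,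
      ContinuousAlternatingMap.smul_apply]
    by_cases ha : a = 0
    · subst ha
      simp [f, (hX z hz).z0]
    · have ha' : 1 ≤ a := Fin.one_le_of_ne_zero ha
      have hz0 := (hX z hz).apply_zero a ha'
      rw [hdL z hz, hker z hz a ha', hz0]
      have := (hg z hz).1
      field_simp
      simp
  -- The exact part dL contributes nothing, and modulo π⁰ the derivative of f π⁰ is f dπ⁰ ≡ f Im Ω.
  have hdψ : ∀ a b, 1 ≤ a → 1 ≤ b → extDeriv ψ₀ y ![X a y, X b y] =
      f y * (vol π y ![X a y, X b y]).im := by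
    intro a b ha hb
    have hz0 := (hX y hy).apply_zero
    have e : ψ₀ =ᶠ[nhds y] dL + fun z => f z • π₀ z := by
      filter_upwards [hc.isOpen.mem_nhds hy] with z hz
      exact hψf z hz
    have d1 := differentiableAt_of_contDiffOn hc.isOpen hdLs hy
    have d2 := differentiableAt_of_contDiffOn hc.isOpen hfs hy
    have d3 := differentiableAt_of_contDiffOn hc.isOpen hc.smooth₀ hy
    have d4 : DifferentiableAt ℝ (fun z => f z • π₀ z) y := d2.smul d3
    rw [e.extDeriv_eq, extDeriv_add d1 d4, hddL y hy, zero_add,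
      extDeriv_smul_one d2 d3, hψ.apply hy, hz0 a ha, hz0 b hb]
    simp
  refine S₂_eq_zero_of_im_torsionForm (hX y hy) (f := f y) fun a b ha hb => ?_
  have h1 := extDeriv_psi_reduced hc hψ hy h (X 0 y) (X a y) (X b y)
  have hz0 := (hX y hy).apply_zero
  rw [hz0 a ha, hz0 b hb, (hX y hy).z0, hdψ a b ha hb, vol_apply] at h1
  simpa using h1.symm

end Reduced

/-! ### Absorption of torsion -/

section Absorption

open Set

variable {W : Set R5} {π₀ : R5 → R5 [⋀^Fin 1]→L[ℝ] ℝ} {π : Fin 2 → R5 → R5 [⋀^Fin 1]→L[ℝ] ℂ}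

/-- Sorting an injective index tuple changes both sides by the same sign. -/
theorem ext_basis_strictMono {A : Type*} [NormedAddCommGroup A] [NormedSpace ℝ A] {k n : ℕ}
    (b : Module.Basis (Fin n) ℝ R5) {α β : R5 [⋀^Fin k]→L[ℝ] A}
    (h : ∀ r : Fin k → Fin n, StrictMono r → α (fun i => b (r i)) = β (fun i => b (r i))) :
    α = β := by
  refine ContinuousAlternatingMap.toAlternatingMap_injective
    (Module.Basis.ext_alternating b fun r hr => ?_)
  have hm : StrictMono (r ∘ Tuple.sort r) :=
    (Tuple.monotone_sort r).strictMono_of_injective (hr.comp (Tuple.sort r).injective)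
  have h1 := h _ hm
  have hα := α.toAlternatingMap.map_perm (fun i => b (r i)) (Tuple.sort r)
  have hβ := β.toAlternatingMap.map_perm (fun i => b (r i)) (Tuple.sort r)
  have h2 : Equiv.Perm.sign (Tuple.sort r) • α.toAlternatingMap (fun i => b (r i)) =
      Equiv.Perm.sign (Tuple.sort r) • β.toAlternatingMap (fun i => b (r i)) :=
    hα.symm.trans (h1.trans hβ)
  exact smul_left_cancel _ h2

theorem ext_four_basis {A : Type*} [NormedAddCommGroup A] [NormedSpace ℝ A]
    (b : Module.Basis (Fin 5) ℝ R5) {α β : R5 [⋀^Fin 4]→L[ℝ] A}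
    (h0 : α ![b 1, b 2, b 3, b 4] = β ![b 1, b 2, b 3, b 4])
    (h1 : α ![b 0, b 2, b 3, b 4] = β ![b 0, b 2, b 3, b 4])
    (h2 : α ![b 0, b 1, b 3, b 4] = β ![b 0, b 1, b 3, b 4])
    (h3 : α ![b 0, b 1, b 2, b 4] = β ![b 0, b 1, b 2, b 4])
    (h4 : α ![b 0, b 1, b 2, b 3] = β ![b 0, b 1, b 2, b 3]) : α = β := by
  refine ext_basis_strictMono b fun r hr => ?_
  have e : (fun i => b (r i)) = ![b (r 0), b (r 1), b (r 2), b (r 3)] := by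
    ext i; fin_cases i <;> rfl
  have key : ∀ p q s t : Fin 5, p < q → q < s → s < t →
      (p = 1 ∧ q = 2 ∧ s = 3 ∧ t = 4) ∨ (p = 0 ∧ q = 2 ∧ s = 3 ∧ t = 4) ∨
      (p = 0 ∧ q = 1 ∧ s = 3 ∧ t = 4) ∨ (p = 0 ∧ q = 1 ∧ s = 2 ∧ t = 4) ∨
      (p = 0 ∧ q = 1 ∧ s = 2 ∧ t = 3) := by decide
  rw [e]
  rcases key _ _ _ _ (hr (by decide : (0 : Fin 4) < 1)) (hr (by decide : (1 : Fin 4) < 2))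
    (hr (by decide : (2 : Fin 4) < 3)) with h | h | h | h | h <;>
  · obtain ⟨p, q, s, t⟩ := h
    rw [p, q, s, t]
    assumption

/-- A complex 1-form with given components in the coframe `π⁰, π¹, π², π̄¹, π̄²`. -/
def formOfComponents (π₀ : R5 → R5 [⋀^Fin 1]→L[ℝ] ℝ) (π : Fin 2 → R5 → R5 [⋀^Fin 1]→L[ℝ] ℂ)
    (c₀ c₁ c₂ d₁ d₂ : R5 → ℂ) (y : R5) : R5 [⋀^Fin 1]→L[ℝ] ℂ :=
  c₀ y • ofRealForm (π₀ y) + c₁ y • π 0 y + c₂ y • π 1 y + d₁ y • conjForm (π 0 y)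
    + d₂ y • conjForm (π 1 y)

theorem formOfComponents_apply (c₀ c₁ c₂ d₁ d₂ : R5 → ℂ) (y u : R5) :
    formOfComponents π₀ π c₀ c₁ c₂ d₁ d₂ y ![u] = c₀ y * π₀ y ![u] + c₁ y * π 0 y ![u]
      + c₂ y * π 1 y ![u] + d₁ y * conj (π 0 y ![u]) + d₂ y * conj (π 1 y ![u]) := by
  simp [formOfComponents]

theorem contDiffOn_formOfComponents (hc : IsCoframing W π₀ π) {c₀ c₁ c₂ d₁ d₂ : R5 → ℂ}
    (h₀ : ContDiffOn ℝ ∞ c₀ W) (h₁ : ContDiffOn ℝ ∞ c₁ W) (h₂ : ContDiffOn ℝ ∞ c₂ W)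
    (h₃ : ContDiffOn ℝ ∞ d₁ W) (h₄ : ContDiffOn ℝ ∞ d₂ W) :
    ContDiffOn ℝ ∞ (formOfComponents π₀ π c₀ c₁ c₂ d₁ d₂) W := by
  refine contDiffOn_form fun v => ?_
  have e : v = ![v 0] := by ext i; fin_cases i; rfl
  rw [e]
  simp only [formOfComponents_apply]
  have k0 := contDiffOn_form_apply_const (contDiffOn_ofRealForm hc.smooth₀) ![v 0]
  have k1 := fun i => contDiffOn_form_apply_const (hc.smooth i) ![v 0]
  have k2 : ∀ i, ContDiffOn ℝ ∞ (fun y => conj (π i y ![v 0])) W := fun i =>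
    (Complex.conjCLE : ℂ →L[ℝ] ℂ).contDiff.comp_contDiffOn (k1 i)
  exact ((((h₀.mul k0).add (h₁.mul (k1 0))).add (h₂.mul (k1 1))).add (h₃.mul (k2 0))).add
    (h₄.mul (k2 1))

theorem contDiffOn_apply_one {A : Type*} [NormedAddCommGroup A] [NormedSpace ℝ A]
    {α : R5 → R5 [⋀^Fin 1]→L[ℝ] A} {X : R5 → R5} (hα : ContDiffOn ℝ ∞ α W)
    (hX : ContDiffOn ℝ ∞ X W) : ContDiffOn ℝ ∞ (fun y => α y ![X y]) W := by
  have e : ∀ z, ![X z] = fun i => (![X] : Fin 1 → R5 → R5) i z := fun z => by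
    ext i; fin_cases i; rfl
  simp only [e]
  exact contDiffOn_form_apply hα fun i => by fin_cases i; exact hX

theorem contDiffOn_apply_two {A : Type*} [NormedAddCommGroup A] [NormedSpace ℝ A]
    {α : R5 → R5 [⋀^Fin 2]→L[ℝ] A} {X Y : R5 → R5} (hα : ContDiffOn ℝ ∞ α W)
    (hX : ContDiffOn ℝ ∞ X W) (hY : ContDiffOn ℝ ∞ Y W) :
    ContDiffOn ℝ ∞ (fun y => α y ![X y, Y y]) W := by
  have e : ∀ z, ![X z, Y z] = fun i => (![X, Y] : Fin 2 → R5 → R5) i z := fun z => by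
    ext i; fin_cases i <;> rfl
  simp only [e]
  exact contDiffOn_form_apply hα fun i => by fin_cases i <;> assumption

/-- The `π̄¹ ∧ π̄²` component of a 2-form, up to the factor `1 / 4`. -/
def antiholComponent (β : R5 [⋀^Fin 2]→L[ℝ] ℂ) (X : Fin 5 → R5) : ℂ :=
  β ![X 1, X 3] + Complex.I * β ![X 1, X 4] + Complex.I * β ![X 2, X 3] - β ![X 2, X 4]

set_option maxHeartbeats 4000000 in
/-- Absorption of torsion: if the `π̄¹ ∧ π̄²` components of `dπ¹, dπ²` vanish, then the reduced
structure equations hold for suitable pseudo-connection forms. -/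
theorem exists_reduced (hc : IsCoframing W π₀ π) {ψ₁ : R5 → R5 [⋀^Fin 1]→L[ℝ] ℝ}
    (hψ : IsContactEq W π₀ π ψ₁) {X : Fin 5 → R5 → R5} (hXs : ∀ a, ContDiffOn ℝ ∞ (X a) W)
    (hX : ∀ y ∈ W, IsDualFrame (π₀ y) (fun i => π i y) (fun a => X a y))
    (hU : ∀ y ∈ W, ∀ i, antiholComponent (extDeriv (π i) y) (fun a => X a y) = 0) :
    ∃ (ψ₀ : R5 → R5 [⋀^Fin 1]→L[ℝ] ℝ) (ψ : Fin 2 → Fin 2 → R5 → R5 [⋀^Fin 1]→L[ℝ] ℂ)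
      (P : R5 → Matrix (Fin 2) (Fin 2) ℂ), IsContactEq W π₀ π ψ₀ ∧
      (∀ i j, ContDiffOn ℝ ∞ (ψ i j) W) ∧ (∀ i j, ContDiffOn ℝ ∞ (fun y => P y i j) W) ∧
      ∀ y ∈ W, IsReducedAt π₀ π ψ₀ (fun i j => ψ i j y) (P y) y := by
  let β : Fin 2 → Fin 5 → Fin 5 → R5 → ℂ := fun i a b y => extDeriv (π i) y ![X a y, X b y]
  have hβs : ∀ i a b, ContDiffOn ℝ ∞ (β i a b) W := fun i a b =>
    contDiffOn_apply_two (contDiffOn_extDeriv hc.isOpen (hc.smooth i)) (hXs a) (hXs b)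
  let p : Fin 5 → R5 → ℝ := fun a y => ψ₁ y ![X a y]
  have hps : ∀ a, ContDiffOn ℝ ∞ (p a) W := fun a => contDiffOn_apply_one hψ.smooth (hXs a)
  have hU0 : ∀ y ∈ W, ∀ i, β i 1 3 y + Complex.I * β i 1 4 y + Complex.I * β i 2 3 y - β i 2 4 y = 0 :=
    hU
  have hvol : ∀ y ∈ W, ∀ a b c, extDeriv (vol π) y ![X a y, X b y, X c y] =
      β 0 a b y * π 1 y ![X c y] - β 0 a c y * π 1 y ![X b y] + β 0 b c y * π 1 y ![X a y]
      - (π 0 y ![X a y] * β 1 b c y - π 0 y ![X b y] * β 1 a c y + π 0 y ![X c y] * β 1 a b y) :=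
    fun y hy a b c => hc.extDeriv_vol hy _ _ _
  have hψp : ∀ y ∈ W, ∀ a b c, _ = _ := fun y hy a b c =>
    hψ.extDeriv_psi hc hy (X a y) (X b y) (X c y)
  -- `d(dπ⁰) = 0` on triples of contact vectors
  have hD : ∀ y ∈ W, (p 1 y + (β 0 1 2 y - β 1 2 3 y + Complex.I * β 1 1 3 y).im = 0) ∧
      (-p 2 y + (Complex.I * β 0 1 2 y - β 1 2 4 y + Complex.I * β 1 1 4 y).im = 0) ∧
      (-p 3 y + (Complex.I * β 0 1 3 y - β 0 1 4 y - β 1 3 4 y).im = 0) ∧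
      (p 4 y + (Complex.I * β 0 2 3 y - β 0 2 4 y - Complex.I * β 1 3 4 y).im = 0) := by
    intro y hy
    have t1 := hψp y hy 1 2 3
    have t2 := hψp y hy 1 2 4
    have t3 := hψp y hy 1 3 4
    have t4 := hψp y hy 2 3 4
    simp only [hvol y hy] at t1 t2 t3 t4
    obtain ⟨z0, z1, z2, z3, z4, a0, a1, a2, a3, a4, b0, b1, b2, b3, b4⟩ := hX y hy
    simp [vol_apply, *] at t1 t2 t3 t4
    simp [p]
    refine ⟨?_, ?_, ?_, ?_⟩ <;> linarith
  -- `dρ = -2 ψ ∧ ρ`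
  have hρ : ∀ y ∈ W, extDeriv (pcLocal π₀ π) y = (-2 : ℝ) • wedge (ψ₁ y) (pcLocal π₀ π y) := by
    intro y hy
    obtain ⟨d1, d2, d3, d4⟩ := hD y hy
    -- Without π̄¹ ∧ π̄² torsion, dΩ has type (2,1) on contact vectors, so it is determined by its
    -- imaginary part. The latter is known from `hD`, which yields dΩ ≡ -ψ ∧ Ω and in particular the
    -- real part needed here.
    have u0 := hU0 y hy 0
    have u1 := hU0 y hy 1
    simp [Complex.ext_iff] at u0 u1
    obtain ⟨u0, u0'⟩ := u0
    obtain ⟨u1, u1'⟩ := u1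
    simp [p] at d1 d2 d3 d4
    have hb := (hX y hy).basis_apply
    have hv := hvol y hy
    obtain ⟨z0, z1, z2, z3, z4, a0, a1, a2, a3, a4, b0, b1, b2, b3, b4⟩ := hX y hy
    refine ext_four_basis (hX y hy).basis ?_ ?_ ?_ ?_ ?_ <;>
    · simp only [hb, hψ.extDeriv_pcLocal hc hy, hv, ContinuousAlternatingMap.smul_apply,
        wedge_one_three, pcLocal_apply, vol_apply]
      simp [*]
      try linarith
  -- the imaginary part of the remaining trace vanishes
  have hτ : ∀ y ∈ W, ((β 0 0 1 y - Complex.I * β 0 0 2 y) + (β 1 0 3 y - Complex.I * β 1 0 4 y)).im = 0 := by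
    intro y hy
    -- On the full frame, dψ ∧ ρ = 0 involves dψ only on (X 1, X 3) and (X 2, X 4), the pairs where
    -- Re Ω is nonzero. The identity d(dπ⁰) = 0 expresses these two values through dπ¹ and dπ².
    have k := extDeriv_wedge_eq_zero_of_extDeriv_eq hc.isOpen hψ.smooth hc.contDiffOn_pcLocal hρ hy
      (X 0 y) (X 1 y) (X 2 y) (X 3 y) (X 4 y)
    have t1 := hψp y hy 0 1 3
    have t2 := hψp y hy 0 2 4
    simp only [hvol y hy] at t1 t2
    obtain ⟨z0, z1, z2, z3, z4, a0, a1, a2, a3, a4, b0, b1, b2, b3, b4⟩ := hX y hy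
    simp [vol_apply, pcLocal_apply, *] at k t1 t2
    simp
    linarith
  -- Coefficients of ψⁱⱼ: `a₀` along π⁰, `c₁` and `c₂` along π¹ and π², `d` along π̄¹ and π̄². The
  -- choices of `a₀`, `d` and `P` are read off from dπⁱ. The coefficients along π¹, π² are
  -- constrained only by the π¹ ∧ π² part `r` of dπⁱ; this is put into off-diagonal entries, which
  -- leaves the diagonal free to match the trace with ψ₁.
  let a₀ : Fin 2 → Fin 2 → R5 → ℂ := fun i j y =>
    ![-(1 / 2) * (β i 0 1 y - Complex.I * β i 0 2 y), -(1 / 2) * (β i 0 3 y - Complex.I * β i 0 4 y)] j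
  let r : Fin 2 → R5 → ℂ := fun i y =>
    1 / 4 * (β i 1 3 y - Complex.I * β i 1 4 y - Complex.I * β i 2 3 y - β i 2 4 y)
  let d : Fin 2 → Fin 2 → Fin 2 → R5 → ℂ := fun i j k y =>
    ![![Complex.I / 2 * β i 1 2 y,
        1 / 4 * (β i 1 3 y - Complex.I * β i 2 3 y + Complex.I * β i 1 4 y + β i 2 4 y)],
      ![-(1 / 4) * (β i 1 3 y - Complex.I * β i 1 4 y + Complex.I * β i 2 3 y + β i 2 4 y),
        Complex.I / 2 * β i 3 4 y]] j k
  let c₁ : Fin 2 → Fin 2 → R5 → ℂ := fun i j y =>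
    ![![1 / 2 * (p 1 y - Complex.I * p 2 y), -r 0 y], ![0, 0]] i j
  let c₂ : Fin 2 → Fin 2 → R5 → ℂ := fun i j y =>
    ![![0, 0], ![r 1 y, 1 / 2 * (p 3 y - Complex.I * p 4 y)]] i j
  let ψ : Fin 2 → Fin 2 → R5 → R5 [⋀^Fin 1]→L[ℝ] ℂ := fun i j =>
    formOfComponents π₀ π (a₀ i j) (c₁ i j) (c₂ i j) (d i j 0) (d i j 1)
  let P : R5 → Matrix (Fin 2) (Fin 2) ℂ := fun y i j =>
    ![1 / 2 * (β i 0 1 y + Complex.I * β i 0 2 y), 1 / 2 * (β i 0 3 y + Complex.I * β i 0 4 y)] j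
  -- Adding f π⁰ to ψ₁ does not affect ψ₁ ∧ π⁰, so the real part of the π⁰-component of the trace
  -- can be matched freely.
  let f : R5 → ℝ := fun y => (a₀ 0 0 y + a₀ 1 1 y).re - p 0 y
  have hpc : ∀ a, ContDiffOn ℝ ∞ (fun y => (p a y : ℂ)) W := fun a =>
    Complex.ofRealCLM.contDiff.comp_contDiffOn (hps a)
  have hk : ∀ k : ℂ, ContDiffOn ℝ ∞ (fun _ : R5 => k) W := fun k => contDiffOn_const
  have ha₀ : ∀ i j, ContDiffOn ℝ ∞ (a₀ i j) W := fun i j => by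
    fin_cases j
    · exact (hk _).mul ((hβs i 0 1).sub ((hk _).mul (hβs i 0 2)))
    · exact (hk _).mul ((hβs i 0 3).sub ((hk _).mul (hβs i 0 4)))
  have hr : ∀ i, ContDiffOn ℝ ∞ (r i) W := fun i => (hk _).mul ((((hβs i 1 3).sub
    ((hk _).mul (hβs i 1 4))).sub ((hk _).mul (hβs i 2 3))).sub (hβs i 2 4))
  have hd : ∀ i j k, ContDiffOn ℝ ∞ (d i j k) W := fun i j k => by
    fin_cases j <;> fin_cases k
    · exact (hk _).mul (hβs i 1 2)
    · exact (hk _).mul ((((hβs i 1 3).sub ((hk _).mul (hβs i 2 3))).add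
        ((hk _).mul (hβs i 1 4))).add (hβs i 2 4))
    · exact (hk _).mul ((((hβs i 1 3).sub ((hk _).mul (hβs i 1 4))).add
        ((hk _).mul (hβs i 2 3))).add (hβs i 2 4))
    · exact (hk _).mul (hβs i 3 4)
  have hc₁ : ∀ i j, ContDiffOn ℝ ∞ (c₁ i j) W := fun i j => by
    fin_cases i <;> fin_cases j
    · exact (hk _).mul ((hpc 1).sub ((hk _).mul (hpc 2)))
    · exact (hr 0).neg
    · exact hk 0
    · exact hk 0
  have hc₂ : ∀ i j, ContDiffOn ℝ ∞ (c₂ i j) W := fun i j => by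
    fin_cases i <;> fin_cases j
    · exact hk 0
    · exact hk 0
    · exact hr 1
    · exact (hk _).mul ((hpc 3).sub ((hk _).mul (hpc 4)))
  have hP : ∀ i j, ContDiffOn ℝ ∞ (fun y => P y i j) W := fun i j => by
    fin_cases j
    · exact (hk _).mul ((hβs i 0 1).add ((hk _).mul (hβs i 0 2)))
    · exact (hk _).mul ((hβs i 0 3).add ((hk _).mul (hβs i 0 4)))
  have hf : ContDiffOn ℝ ∞ f W :=
    (Complex.reCLM.contDiff.comp_contDiffOn ((ha₀ 0 0).add (ha₀ 1 1))).sub (hps 0)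
  refine ⟨fun y => ψ₁ y + f y • π₀ y, ψ, P,
    ⟨hψ.smooth.add (hf.smul hc.smooth₀), fun y hy => ?_⟩,
    fun i j => contDiffOn_formOfComponents hc (ha₀ i j) (hc₁ i j) (hc₂ i j) (hd i j 0) (hd i j 1),
    hP, fun y hy => ⟨?_, fun i => ?_⟩⟩
  · rw [hψ.eq y hy]
    congr 2
    ext v
    simp only [wedge_one_one, ContinuousAlternatingMap.add_apply,
      ContinuousAlternatingMap.smul_apply, smul_eq_mul]
    ring
  -- Nothing is left to choose in the trace equation: the components along π̄¹, π̄² agree by `hD`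
  -- and `hU`, and the π⁰-component of the trace is real by `hτ`.
  · obtain ⟨d1, d2, d3, d4⟩ := hD y hy
    have u0 := hU0 y hy 0
    have u1 := hU0 y hy 1
    have t := hτ y hy
    simp [Complex.ext_iff] at u0 u1
    obtain ⟨u0, u0'⟩ := u0
    obtain ⟨u1, u1'⟩ := u1
    simp at d1 d2 d3 d4 t
    have hb := (hX y hy).basis_apply
    have hp : ∀ a, ψ₁ y ![X a y] = p a y := fun a => rfl
    obtain ⟨z0, z1, z2, z3, z4, a0, a1, a2, a3, a4, b0, b1, b2, b3, b4⟩ := hX y hy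
    refine ext_one_basis (hX y hy).basis fun a => ?_
    rw [hb]
    simp only [ContinuousAlternatingMap.add_apply, ofRealForm_apply,
      ContinuousAlternatingMap.smul_apply, ψ, formOfComponents_apply]
    fin_cases a <;> apply Complex.ext <;>
      simp [a₀, c₁, c₂, d, f, z0, z1, z2, z3, z4, a0, a1, a2, a3, a4, b0, b1, b2, b3, b4, hp] <;>
      linarith
  · have u := hU0 y hy i
    simp [Complex.ext_iff] at u
    obtain ⟨u0, u0'⟩ := u
    have hb := (hX y hy).basis_apply
    have hβ : ∀ a b, extDeriv (π i) y ![X a y, X b y] = β i a b y := fun a b => rfl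
    obtain ⟨z0, z1, z2, z3, z4, a0, a1, a2, a3, a4, b0, b1, b2, b3, b4⟩ := hX y hy
    refine ext_two_basis (hX y hy).basis fun a c hac => ?_
    rw [hb, hb, hβ]
    simp only [Fin.sum_univ_two, ContinuousAlternatingMap.sub_apply,
      ContinuousAlternatingMap.neg_apply, ContinuousAlternatingMap.add_apply,
      ContinuousAlternatingMap.smul_apply, wedge_one_one, conjForm_apply, ofRealForm_apply,
      smul_eq_mul, ψ, formOfComponents_apply, Matrix.cons_val_zero, Matrix.cons_val_one]
    fin_cases i <;> fin_cases a <;> fin_cases c <;>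
    first
    | exact absurd hac (by decide)
    | (apply Complex.ext <;>
      simp [a₀, c₁, c₂, d, r, P, z0, z1, z2, z3, z4, a0, a1, a2, a3, a4, b0, b1, b2, b3, b4]
        at u0 u0' ⊢ <;>
      linarith)

end Absorption

/-! ### Linear algebra on a contact hyperplane -/

section ContactLinearAlgebra

/-- If `θ ∧ ζ ≠ 0`, then `ζ` does not vanish on the kernel of `θ`. -/
theorem exists_ne_zero_of_wedge_ne_zero {q : ℕ} {θ : R5 [⋀^Fin 1]→L[ℝ] ℝ} {ζ : R5 [⋀^Fin q]→L[ℝ] ℝ}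
    (h : wedge θ ζ ≠ 0) :
    (∃ R, θ ![R] ≠ 0) ∧ ∃ d : Fin q → R5, (∀ i, θ ![d i] = 0) ∧ ζ d ≠ 0 := by
  have hR : ∃ R, θ ![R] ≠ 0 := by
    by_contra! h0
    refine h (ContinuousAlternatingMap.ext fun v => ?_)
    refine wedge_apply_eq_zero_of_left (D := Set.univ) θ ζ (fun w _ => ?_) fun i => Set.mem_univ _
    have e : w = ![w 0] := by ext i; fin_cases i; rfl
    rw [e, h0]
  refine ⟨hR, ?_⟩
  by_contra! h0
  obtain ⟨R, hR⟩ := hR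
  let ℓ : R5 →ₗ[ℝ] ℝ :=
    { toFun := fun v => θ ![v], map_add' := map_one_add θ, map_smul' := map_one_smul θ }
  let b := Module.finBasis ℝ (LinearMap.ker ℓ)
  let B := Module.Basis.mkFinCons R b
    (fun c x hx hc => by
      have h1 := congrArg ℓ hc
      rw [map_add, map_smul, LinearMap.mem_ker.1 hx, map_zero, add_zero, smul_eq_mul] at h1
      exact (mul_eq_zero.1 h1).resolve_right hR)
    (fun z => ⟨-(ℓ z / ℓ R), by
      have : ℓ R ≠ 0 := hR
      simp [this]⟩)
  have hB : ∀ i, i ≠ 0 → θ ![B i] = 0 := by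
    intro i
    refine Fin.cases (fun h => absurd rfl h) (fun j _ => ?_) i
    rw [Module.Basis.coe_mkFinCons]
    exact (b j).2
  refine h (ContinuousAlternatingMap.toAlternatingMap_injective
    (Module.Basis.ext_alternating B fun r hr => ?_))
  change wedge θ ζ (fun i => B (r i)) = 0
  rw [wedge_apply, Finset.sum_eq_zero, smul_zero]
  intro σ _
  have e : (fun i => B (r (σ (Fin.castAdd q i)))) = ![B (r (σ (Fin.castAdd q (0 : Fin 1))))] := by
    ext i; fin_cases i; rfl
  -- In a basis made of R and a basis of ker θ, either θ is fed a kernel vector, or it is fed R and,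
  -- the indices being distinct, ζ receives kernel vectors only.
  by_cases h1 : r (σ (Fin.castAdd q (0 : Fin 1))) = 0
  · rw [h0 (fun j => B (r (σ (Fin.natAdd 1 j)))) (fun j => hB _ fun h2 => ?_), mul_zero, smul_zero]
    have := σ.injective (hr (h2.trans h1.symm))
    simp [Fin.ext_iff] at this
  · rw [e, hB _ h1, zero_mul, smul_zero]

/-- A 2-form whose square is nonzero on the kernel of `θ` is nondegenerate there. -/
theorem eq_zero_of_wedge_self_ne_zero {θ : R5 [⋀^Fin 1]→L[ℝ] ℝ} {η : R5 [⋀^Fin 2]→L[ℝ] ℝ} {R : R5}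
    {d : Fin 4 → R5} (hR : θ ![R] = 1) (hd : ∀ i, θ ![d i] = 0)
    (hη : wedge (p := 2) (q := 2) η η d ≠ 0) {v : R5} (hv : θ ![v] = 0)
    (h : ∀ i, η ![v, d i] = 0) : v = 0 := by
  have hli : LinearIndependent ℝ (Fin.cons R d : Fin 5 → R5) := by
    refine linearIndependent_finCons.2 ⟨?_, fun hm => ?_⟩
    · by_contra hd'
      exact hη ((wedge (p := 2) (q := 2) η η).toAlternatingMap.map_linearDependent d hd')
    · let ℓ : R5 →ₗ[ℝ] ℝ :=
        { toFun := fun v => θ ![v], map_add' := map_one_add θ, map_smul' := map_one_smul θ }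
      have : Submodule.span ℝ (Set.range d) ≤ LinearMap.ker ℓ := by
        rw [Submodule.span_le]
        rintro _ ⟨i, rfl⟩
        exact hd i
      have := this hm
      rw [LinearMap.mem_ker] at this
      exact one_ne_zero (hR.symm.trans this)
  let B := basisOfLinearIndependentOfCardEqFinrank hli (by simp)
  have hB : ⇑B = Fin.cons R d := by simp [B]
  have hv' : ∀ i, η ![d i, v] = 0 := fun i => by rw [apply_swap, h, neg_zero]
  have h0 : B.repr v 0 = 0 := by
    let ℓ : R5 →ₗ[ℝ] ℝ :=
      { toFun := fun v => θ ![v], map_add' := map_one_add θ, map_smul' := map_one_smul θ }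
    have e := congrArg ℓ (B.sum_repr v)
    rw [map_sum, Fin.sum_univ_succ, Finset.sum_eq_zero] at e
    · rw [map_smul, hB] at e
      have e1 : ℓ R = 1 := hR
      have e2 : ℓ v = 0 := hv
      simpa [e1, e2] using e
    · intro i _
      rw [map_smul, hB, Fin.cons_succ]
      have : ℓ (d i) = 0 := hd i
      rw [this, smul_zero]
  -- Replacing d i by v in (η ∧ η)(d) multiplies it by the i-th coordinate of v, yet the result is 0
  -- because η pairs v trivially with every d j.
  have hs : ∀ i : Fin 4, B.repr v i.succ = 0 := by
    intro i
    let ℓ : R5 →ₗ[ℝ] ℝ :=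
      (wedge (p := 2) (q := 2) η η).toAlternatingMap.toMultilinearMap.toLinearMap d i
    have e := congrArg ℓ (B.sum_repr v)
    have e1 : ℓ v = 0 := by
      change wedge (p := 2) (q := 2) η η (Function.update d i v) = 0
      rw [wedge_two_two]
      fin_cases i <;> simp [h, hv']
    rw [map_sum, Fin.sum_univ_succ, h0, zero_smul, map_zero, zero_add, e1,
      Finset.sum_eq_single i] at e
    · have e2 : ℓ (d i) = wedge (p := 2) (q := 2) η η d := by
        change wedge (p := 2) (q := 2) η η (Function.update d i (d i)) = _
        rw [Function.update_eq_self]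
      rw [map_smul, hB, Fin.cons_succ, e2, smul_eq_mul] at e
      exact (mul_eq_zero.1 e).resolve_right hη
    · intro j _ hj
      rw [map_smul, hB, Fin.cons_succ]
      have : ℓ (d j) = 0 :=
        (wedge (p := 2) (q := 2) η η).toAlternatingMap.map_update_self d hj.symm
      rw [this, smul_zero]
    · simp
  rw [← B.sum_repr v, Fin.sum_univ_succ, h0, Finset.sum_eq_zero (fun i _ => by rw [hs, zero_smul]),
    zero_smul, zero_add]

/-- A 2-form vanishing on the kernel of `θ` is a multiple of `θ`. -/
theorem eq_neg_wedge_of_forall_ker {θ : R5 [⋀^Fin 1]→L[ℝ] ℝ} {ζ : R5 [⋀^Fin 2]→L[ℝ] ℝ} {R : R5}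
    (hR : θ ![R] = 1) (h : ∀ u v, θ ![u] = 0 → θ ![v] = 0 → ζ ![u, v] = 0) :
    ζ = -wedge (ζ.curryLeft R) θ := by
  have e1 : ∀ u, ζ.curryLeft R ![u] = ζ ![R, u] := fun u => rfl
  have a1 : ∀ x y u : R5, ζ ![x + y, u] = ζ ![x, u] + ζ ![y, u] := fun x y u => by
    have := map_one_add (ζ.curryLeft u) x y
    have k : ∀ x, ζ.curryLeft u ![x] = ζ ![u, x] := fun _ => rfl
    rw [k, k, k] at this
    rw [apply_swap, this, apply_swap, apply_swap ζ u y]; ring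
  have a2 : ∀ (c : ℝ) (x u : R5), ζ ![c • x, u] = c * ζ ![x, u] := fun c x u => by
    have := map_one_smul (ζ.curryLeft u) c x
    have k : ∀ x, ζ.curryLeft u ![x] = ζ ![u, x] := fun _ => rfl
    rw [k, k, smul_eq_mul] at this
    rw [apply_swap, this, apply_swap]; ring
  ext v
  have ev : v = ![v 0, v 1] := by ext i; fin_cases i <;> rfl
  rw [ContinuousAlternatingMap.neg_apply, wedge_one_one, e1, e1, ev]
  simp only [Matrix.cons_val_zero, Matrix.cons_val_one]
  generalize v 0 = x
  generalize v 1 = y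
  -- Projection to ker θ along R; expanding ζ on two projected vectors gives the formula.
  have hz : ∀ u, θ ![u + (-(θ ![u])) • R] = 0 := fun u => by
    rw [map_one_add, map_one_smul, hR, smul_eq_mul]; ring
  have := h _ _ (hz x) (hz y)
  rw [a1, a2, apply_swap ζ x, a1, a2, apply_swap ζ R (_ + _), a1, a2, apply_self, apply_swap ζ y x,
    apply_swap ζ y R] at this
  linarith

end ContactLinearAlgebra

/-! ### Adapted coframings from ellipticity -/

section Existence

open Set

variable {W : Set R5}

theorem ModEq.apply_eq_of_ker {k : ℕ} {θ : R5 [⋀^Fin 1]→L[ℝ] ℝ} {η η' : R5 [⋀^Fin (k + 1)]→L[ℝ] ℝ}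
    (h : ModEq θ η η') {w : Fin (k + 1) → R5} (hw : ∀ i, θ ![w i] = 0) : η w = η' w := by
  obtain ⟨γ, hγ⟩ := h
  have h1 : wedge γ θ w = 0 := wedge_apply_eq_zero_of_right (D := {v | θ ![v] = 0}) γ θ
    (fun u hu => by
      have e : u = ![u 0] := by ext i; fin_cases i; rfl
      rw [e]; exact hu 0) hw
  rw [← hγ, ContinuousAlternatingMap.sub_apply] at h1
  exact sub_eq_zero.1 h1

theorem isOpen_inter_ne_zero {A : Type*} [NormedAddCommGroup A] {f : R5 → A} (hW : IsOpen W)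
    (hf : ContinuousOn f W) : IsOpen {y ∈ W | f y ≠ 0} :=
  hf.isOpen_inter_preimage hW isOpen_compl_singleton

theorem contDiffOn_curryLeft {A : Type*} [NormedAddCommGroup A] [NormedSpace ℝ A]
    [FiniteDimensional ℝ A] {η : R5 → R5 [⋀^Fin 2]→L[ℝ] A} {X : R5 → R5} (hη : ContDiffOn ℝ ∞ η W)
    (hX : ContDiffOn ℝ ∞ X W) : ContDiffOn ℝ ∞ (fun y => (η y).curryLeft (X y)) W := by
  refine contDiffOn_form fun v => ?_
  have e : ∀ y, (η y).curryLeft (X y) v = η y ![X y, v 0] := fun y => by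
    rw [ContinuousAlternatingMap.curryLeft_apply_apply]
    congr 1
    ext i; fin_cases i <;> rfl
  simp only [e]
  exact contDiffOn_apply_two hη hX contDiffOn_const

/-- The Plücker relation for `m Ψ + i dθ`. -/
theorem plucker {η ζ : R5 [⋀^Fin 2]→L[ℝ] ℝ} {m c : ℝ} (hm : m ^ 2 * c = 1) {a b u v : R5}
    (h1 : wedge (p := 2) (q := 2) η ζ ![a, b, u, v] = 0)
    (h2 : wedge (p := 2) (q := 2) η η ![a, b, u, v] =
      c * wedge (p := 2) (q := 2) ζ ζ ![a, b, u, v]) {ϖ : R5 → R5 → ℂ}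
    (hϖ : ∀ x y, ϖ x y = m * η ![x, y] + Complex.I * ζ ![x, y]) :
    ϖ a b * ϖ u v = ϖ a u * ϖ b v - ϖ a v * ϖ b u := by
  rw [wedge_two_two] at h1 h2
  rw [wedge_two_two] at h2
  simp only [Matrix.cons_val] at h1 h2
  simp only [hϖ]
  -- The relation says that the square of mη + iζ vanishes: its real part m² η ∧ η - ζ ∧ ζ does so
  -- by `h2` and m²c = 1, its imaginary part 2m η ∧ ζ by `h1`.
  apply Complex.ext
  · simp
    linear_combination (m ^ 2 / 2) * h2 + (ζ ![a, b] * ζ ![u, v] - ζ ![a, u] * ζ ![b, v]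
      + ζ ![a, v] * ζ ![b, u]) * hm
  · simp
    linear_combination m * h1

/-- Near every point, an elliptic system admits a coframing `θ, κ¹, κ²` with
`κ¹ ∧ κ² ≡ m Ψ + i dθ` modulo `θ`. -/
theorem exists_isCoframing (hW : IsOpen W) {θ : R5 → R5 [⋀^Fin 1]→L[ℝ] ℝ}
    {Ψ : R5 → R5 [⋀^Fin 2]→L[ℝ] ℝ} (hθ : ContDiffOn ℝ ∞ θ W) (hΨ : ContDiffOn ℝ ∞ Ψ W)
    (hnd : ∀ y ∈ W, wedge (θ y) (wedge (extDeriv θ y) (extDeriv θ y)) ≠ 0)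
    (hprim : ∀ y ∈ W, ModEq (k := 3) (θ y) (wedge (p := 2) (q := 2) (Ψ y) (extDeriv θ y)) 0)
    (hell : ∀ y ∈ W, ∃ c : ℝ, 0 < c ∧ ModEq (k := 3) (θ y)
      (wedge (p := 2) (q := 2) (Ψ y) (Ψ y)) (c • wedge (extDeriv θ y) (extDeriv θ y)))
    {y₀ : R5} (hy₀ : y₀ ∈ W) :
    ∃ (W' : Set R5) (κ : Fin 2 → R5 → R5 [⋀^Fin 1]→L[ℝ] ℂ) (m : R5 → ℝ), W' ⊆ W ∧ y₀ ∈ W' ∧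
      IsCoframing W' θ κ ∧ ∀ y ∈ W', m y ≠ 0 ∧ ∀ u v, θ y ![u] = 0 → θ y ![v] = 0 →
        vol κ y ![u, v] = m y * Ψ y ![u, v] + Complex.I * extDeriv θ y ![u, v] := by
  have hdθ : ContDiffOn ℝ ∞ (extDeriv θ) W := contDiffOn_extDeriv hW hθ
  obtain ⟨⟨R₀, hR₀⟩, v, hv, hv'⟩ := exists_ne_zero_of_wedge_ne_zero (hnd y₀ hy₀)
  have hθR : ContDiffOn ℝ ∞ (fun y => θ y ![R₀]) W := contDiffOn_form_apply_const hθ _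
  -- The successive shrinkings `W₁`, `W₂`, `W₃` keep nonzero the quantities to be inverted: θ on R₀,
  -- dθ ∧ dθ on the d i, and ϖ on one pair of the d i.
  let W₁ : Set R5 := {y ∈ W | θ y ![R₀] ≠ 0}
  have hW₁ : IsOpen W₁ := isOpen_inter_ne_zero hW hθR.continuousOn
  have h₁ : W₁ ⊆ W := fun y hy => hy.1
  let R : R5 → R5 := fun y => (θ y ![R₀])⁻¹ • R₀
  have hRs : ContDiffOn ℝ ∞ R W₁ :=
    ((hθR.mono h₁).inv fun y hy => hy.2).smul contDiffOn_const
  have hR : ∀ y ∈ W₁, θ y ![R y] = 1 := fun y hy => by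
    rw [map_one_smul, smul_eq_mul, inv_mul_cancel₀ hy.2]
  let d : Fin 4 → R5 → R5 := fun i y => v i + (-θ y ![v i]) • R y
  have hds : ∀ i, ContDiffOn ℝ ∞ (d i) W₁ := fun i =>
    contDiffOn_const.add ((contDiffOn_form_apply_const (hθ.mono h₁) _).neg.smul hRs)
  have hd : ∀ y ∈ W₁, ∀ i, θ y ![d i y] = 0 := fun y hy i => by
    rw [map_one_add, map_one_smul, hR y hy, smul_eq_mul]; ring
  let Δ : R5 → ℝ := fun y => wedge (p := 2) (q := 2) (extDeriv θ y) (extDeriv θ y) fun i => d i y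
  have hΔs : ContDiffOn ℝ ∞ Δ W₁ :=
    contDiffOn_form_apply (contDiffOn_wedge (p := 2) (q := 2) (hdθ.mono h₁) (hdθ.mono h₁)) hds
  let W₂ : Set R5 := {y ∈ W₁ | Δ y ≠ 0}
  have hW₂ : IsOpen W₂ := isOpen_inter_ne_zero hW₁ hΔs.continuousOn
  have h₂ : W₂ ⊆ W₁ := fun y hy => hy.1
  have hy₂ : y₀ ∈ W₂ := by
    refine ⟨⟨hy₀, hR₀⟩, ?_⟩
    have e : (fun i => d i y₀) = v := by ext1 i; simp [d, hv]
    simp only [Δ, e]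
    exact hv'
  -- Ellipticity gives the ratio only point by point; as a quotient of values on a smooth frame of
  -- ker θ it is smooth.
  let c : R5 → ℝ := fun y => wedge (p := 2) (q := 2) (Ψ y) (Ψ y) (fun i => d i y) / Δ y
  have hcs : ContDiffOn ℝ ∞ c W₂ :=
    (contDiffOn_form_apply (contDiffOn_wedge (p := 2) (q := 2) (hΨ.mono (h₂.trans h₁))
      (hΨ.mono (h₂.trans h₁))) fun i => (hds i).mono h₂).div (hΔs.mono h₂) fun y hy => hy.2
  have hc : ∀ y ∈ W₂, 0 < c y ∧ ∀ w : Fin 4 → R5, (∀ i, θ y ![w i] = 0) →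
      wedge (p := 2) (q := 2) (Ψ y) (Ψ y) w =
        c y * wedge (p := 2) (q := 2) (extDeriv θ y) (extDeriv θ y) w := fun y hy => by
    obtain ⟨c', hc', hmod⟩ := hell y (h₁ (h₂ hy))
    have e : c y = c' := by
      have := hmod.apply_eq_of_ker (hd y (h₂ hy))
      simp only [c]
      rw [this, div_eq_iff hy.2]
      rfl
    rw [e]
    exact ⟨hc', fun w hw => hmod.apply_eq_of_ker hw⟩
  let m : R5 → ℝ := fun y => (√(c y))⁻¹
  have hms : ContDiffOn ℝ ∞ m W₂ :=
    (hcs.sqrt fun y hy => (hc y hy).1.ne').inv fun y hy => (Real.sqrt_pos.2 (hc y hy).1).ne'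
  have hm : ∀ y ∈ W₂, m y ^ 2 * c y = 1 := fun y hy => by
    have := (hc y hy).1
    simp only [m]
    rw [inv_pow, Real.sq_sqrt this.le, inv_mul_cancel₀ this.ne']
  let ϖ : R5 → R5 [⋀^Fin 2]→L[ℝ] ℂ := fun y =>
    m y • ofRealForm (Ψ y) + Complex.I • ofRealForm (extDeriv θ y)
  have hϖ : ∀ y x z, ϖ y ![x, z] = m y * Ψ y ![x, z] + Complex.I * extDeriv θ y ![x, z] :=
    fun y x z => by simp [ϖ]
  have hϖs : ContDiffOn ℝ ∞ ϖ W₂ :=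
    (hms.smul (contDiffOn_ofRealForm (hΨ.mono (h₂.trans h₁)))).add
      ((contDiffOn_ofRealForm (hdθ.mono (h₂.trans h₁))).const_smul Complex.I)
  have hpl : ∀ y ∈ W₂, ∀ a b u v : R5, θ y ![a] = 0 → θ y ![b] = 0 → θ y ![u] = 0 →
      θ y ![v] = 0 → ϖ y ![a, b] * ϖ y ![u, v] = ϖ y ![a, u] * ϖ y ![b, v]
        - ϖ y ![a, v] * ϖ y ![b, u] := by
    intro y hy a b u v ha hb hu hv
    have hw : ∀ i, θ y ![(![a, b, u, v] : Fin 4 → R5) i] = 0 := fun i => by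
      fin_cases i <;> assumption
    exact plucker (hm y hy) ((hprim y (h₁ (h₂ hy))).apply_eq_of_ker hw)
      ((hc y hy).2 _ hw) (ϖ := fun x z => ϖ y ![x, z]) (hϖ y)
  -- Otherwise Im ϖ = dθ would vanish on all pairs of the d i, contrary to Δ ≠ 0.
  obtain ⟨i, j, hij⟩ : ∃ i j, ϖ y₀ ![d i y₀, d j y₀] ≠ 0 := by
    by_contra! h0
    refine hy₂.2 ?_
    have h0' : ∀ i j, extDeriv θ y₀ ![d i y₀, d j y₀] = 0 := fun i j => by
      have := congrArg Complex.im ((hϖ y₀ _ _).symm.trans (h0 i j))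
      simpa using this
    simp [Δ, wedge_two_two, h0']
  have hωs : ContDiffOn ℝ ∞ (fun y => ϖ y ![d i y, d j y]) W₂ :=
    contDiffOn_apply_two hϖs ((hds i).mono h₂) ((hds j).mono h₂)
  let W₃ : Set R5 := {y ∈ W₂ | ϖ y ![d i y, d j y] ≠ 0}
  have hW₃ : IsOpen W₃ := isOpen_inter_ne_zero hW₂ hωs.continuousOn
  have h₃ : W₃ ⊆ W₂ := fun y hy => hy.1
  -- A 2-form satisfying the Plücker relations is the wedge of its contractions with two vectors,
  -- divided by its nonzero value on them.
  let κ : Fin 2 → R5 → R5 [⋀^Fin 1]→L[ℝ] ℂ :=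
    ![fun y => (ϖ y ![d i y, d j y])⁻¹ • (ϖ y).curryLeft (d i y), fun y => (ϖ y).curryLeft (d j y)]
  have hκ₀ : ∀ y u, κ 0 y ![u] = (ϖ y ![d i y, d j y])⁻¹ * ϖ y ![d i y, u] := fun y u => rfl
  have hκ₁ : ∀ y u, κ 1 y ![u] = ϖ y ![d j y, u] := fun y u => rfl
  have hvol : ∀ y ∈ W₃, ∀ u v, θ y ![u] = 0 → θ y ![v] = 0 → vol κ y ![u, v] = ϖ y ![u, v] := by
    intro y hy u v hu hv
    have hd' := hd y (h₂ (h₃ hy))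
    have := hpl y (h₃ hy) _ _ u v (hd' i) (hd' j) hu hv
    rw [vol_apply, hκ₀, hκ₀, hκ₁, hκ₁]
    have hne := hy.2
    field_simp
    linear_combination -this
  refine ⟨W₃, κ, m, (h₃.trans h₂).trans h₁, ⟨hy₂, hij⟩, ⟨hW₃, hθ.mono ((h₃.trans h₂).trans h₁),
    fun k => ?_, fun y hy z hz hzκ => ?_⟩, fun y hy => ⟨?_, fun u v hu hv => ?_⟩⟩
  · fin_cases k
    · exact ((hωs.mono h₃).inv fun y hy => hy.2).smul
        (contDiffOn_curryLeft (hϖs.mono h₃) ((hds i).mono (h₃.trans h₂)))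
    · exact contDiffOn_curryLeft (hϖs.mono h₃) ((hds j).mono (h₃.trans h₂))
  -- A vector killed by θ, κ¹ and κ² pairs trivially with ker θ under κ¹ ∧ κ², hence under dθ, which
  -- is nondegenerate there.
  · refine eq_zero_of_wedge_self_ne_zero (hR y (h₂ (h₃ hy))) (hd y (h₂ (h₃ hy))) (h₃ hy).2 hz
      fun k => ?_
    have h0 := hvol y hy z _ hz (hd y (h₂ (h₃ hy)) k)
    rw [vol_apply, hzκ 0, hzκ 1, hϖ] at h0
    have := congrArg Complex.im h0
    simpa using this.symm
  · exact inv_ne_zero (Real.sqrt_pos.2 (hc y (h₃ hy)).1).ne'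
  · rw [hvol y hy u v hu hv, hϖ]

end Existence

/-! ### Reduced coframings, and the closed multiple of ρ when S₂ = 0 -/

section ReducedExistence

open Set

variable {W : Set R5}

theorem wedge_neg_left {E A : Type*} [AddCommGroup E] [Module ℝ E] [TopologicalSpace E]
    [NormedCommRing A] [NormedAlgebra ℝ A] {p q : ℕ} (α : E [⋀^Fin p]→L[ℝ] A)
    (β : E [⋀^Fin q]→L[ℝ] A) : wedge (-α) β = -wedge α β := by
  ext v
  simp [wedge_apply]

theorem modEq_of_forall_ker {θ : R5 [⋀^Fin 1]→L[ℝ] ℝ} {η η' : R5 [⋀^Fin 2]→L[ℝ] ℝ} {R : R5}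
    (hR : θ ![R] = 1) (h : ∀ u v, θ ![u] = 0 → θ ![v] = 0 → η ![u, v] = η' ![u, v]) :
    ModEq (k := 1) θ η η' := by
  refine ⟨-(η - η').curryLeft R, ?_⟩
  rw [wedge_neg_left]
  refine eq_neg_wedge_of_forall_ker hR fun u v hu hv => ?_
  rw [ContinuousAlternatingMap.sub_apply, h u v hu hv, sub_self]

/-- Near every point, an elliptic system admits a reduced coframing with `π⁰ = θ`. -/
theorem exists_reduced_coframing (hW : IsOpen W) {θ : R5 → R5 [⋀^Fin 1]→L[ℝ] ℝ}
    {Ψ : R5 → R5 [⋀^Fin 2]→L[ℝ] ℝ} (hθ : ContDiffOn ℝ ∞ θ W) (hΨ : ContDiffOn ℝ ∞ Ψ W)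
    (hnd : ∀ y ∈ W, wedge (θ y) (wedge (extDeriv θ y) (extDeriv θ y)) ≠ 0)
    (hprim : ∀ y ∈ W, ModEq (k := 3) (θ y) (wedge (p := 2) (q := 2) (Ψ y) (extDeriv θ y)) 0)
    (hell : ∀ y ∈ W, ∃ c : ℝ, 0 < c ∧ ModEq (k := 3) (θ y)
      (wedge (p := 2) (q := 2) (Ψ y) (Ψ y)) (c • wedge (extDeriv θ y) (extDeriv θ y)))
    {y₀ : R5} (hy₀ : y₀ ∈ W) :
    ∃ (W' : Set R5) (π : Fin 2 → R5 → R5 [⋀^Fin 1]→L[ℝ] ℂ) (ψ₀ : R5 → R5 [⋀^Fin 1]→L[ℝ] ℝ)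
      (ψ : Fin 2 → Fin 2 → R5 → R5 [⋀^Fin 1]→L[ℝ] ℂ) (P : R5 → Matrix (Fin 2) (Fin 2) ℂ),
      W' ⊆ W ∧ y₀ ∈ W' ∧ IsCoframing W' θ π ∧ IsContactEq W' θ π ψ₀ ∧
      (∀ i j, ContDiffOn ℝ ∞ (ψ i j) W') ∧ (∀ i j, ContDiffOn ℝ ∞ (fun y => P y i j) W') ∧
      (∀ y ∈ W', IsReducedAt θ π ψ₀ (fun i j => ψ i j y) (P y) y) ∧
      ∀ y ∈ W', ∃ μ : ℝ, μ ≠ 0 ∧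
        ModEq (k := 1) (θ y) (Ψ y) (μ • reForm (wedge (π 0 y) (π 1 y))) := by
  obtain ⟨W', κ, m, hW', hy', hκ, hm⟩ := exists_isCoframing hW hθ hΨ hnd hprim hell hy₀
  have hθ' := hθ.mono hW'
  obtain ⟨X, hXs, hX⟩ := hκ.exists_frame
  have hdκ : ∀ i a b, ContDiffOn ℝ ∞ (fun y => extDeriv (κ i) y ![X a y, X b y]) W' := fun i a b =>
    contDiffOn_apply_two (contDiffOn_extDeriv hκ.isOpen (hκ.smooth i)) (hXs a) (hXs b)
  have hk : ∀ k : ℂ, ContDiffOn ℝ ∞ (fun _ : R5 => k) W' := fun k => contDiffOn_const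
  -- Adding cⁱ θ changes dκⁱ on contact vectors by cⁱ Im Ω, and `antiholComponent` of Im Ω is 2i.
  -- The factor i/2 is thus the one that cancels the π̄¹ ∧ π̄² torsion.
  let c : Fin 2 → R5 → ℂ := fun i y =>
    Complex.I / 2 * antiholComponent (extDeriv (κ i) y) (fun a => X a y)
  have hcs : ∀ i, ContDiffOn ℝ ∞ (c i) W' := fun i => (hk _).mul ((((hdκ i 1 3).add
    ((hk _).mul (hdκ i 1 4))).add ((hk _).mul (hdκ i 2 3))).sub (hdκ i 2 4))
  let π : Fin 2 → R5 → R5 [⋀^Fin 1]→L[ℝ] ℂ := fun i y => κ i y + c i y • ofRealForm (θ y)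
  have hπ : ∀ i y u, π i y ![u] = κ i y ![u] + c i y * θ y ![u] := fun i y u => by simp [π]
  have hcθ : ∀ i, ContDiffOn ℝ ∞ (fun y => c i y • ofRealForm (θ y)) W' := fun i =>
    (hcs i).smul (contDiffOn_ofRealForm hθ')
  have hcf : IsCoframing W' θ π := ⟨hκ.isOpen, hθ', fun i => (hκ.smooth i).add (hcθ i),
    fun y hy v h0 h1 => hκ.coframe y hy v h0 fun i => by simpa [hπ, h0] using h1 i⟩
  -- The frame dual to the corrected coframing; only X 0 moves, since θ kills the others.
  let Y : Fin 5 → R5 → R5 := fun a y => X a y + (-θ y ![X a y]) •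
    ((c 0 y).re • X 1 y + (c 0 y).im • X 2 y + (c 1 y).re • X 3 y + (c 1 y).im • X 4 y)
  have hre : ∀ i, ContDiffOn ℝ ∞ (fun y => (c i y).re) W' := fun i =>
    Complex.reCLM.contDiff.comp_contDiffOn (hcs i)
  have him : ∀ i, ContDiffOn ℝ ∞ (fun y => (c i y).im) W' := fun i =>
    Complex.imCLM.contDiff.comp_contDiffOn (hcs i)
  have hYs : ∀ a, ContDiffOn ℝ ∞ (Y a) W' := fun a =>
    (hXs a).add ((contDiffOn_apply_one hθ' (hXs a)).neg.smul (((((hre 0).smul (hXs 1)).add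
      ((him 0).smul (hXs 2))).add ((hre 1).smul (hXs 3))).add ((him 1).smul (hXs 4))))
  have hYX : ∀ y ∈ W', ∀ a, 1 ≤ a → Y a y = X a y := fun y hy a ha => by
    simp [Y, (hX y hy).apply_zero a ha]
  have hY : ∀ y ∈ W', IsDualFrame (θ y) (fun i => π i y) (fun a => Y a y) := by
    intro y hy
    obtain ⟨z0, z1, z2, z3, z4, a0, a1, a2, a3, a4, b0, b1, b2, b3, b4⟩ := hX y hy
    constructor <;>
      simp only [Y, hπ, map_one_add, map_one_smul] <;>
      simp [z0, z1, z2, z3, z4, a0, a1, a2, a3, a4, b0, b1, b2, b3, b4]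
  have hvol : ∀ y ∈ W', ∀ u v, θ y ![u] = 0 → θ y ![v] = 0 →
      vol π y ![u, v] = m y * Ψ y ![u, v] + Complex.I * extDeriv θ y ![u, v] := by
    intro y hy u v hu hv
    rw [← (hm y hy).2 u v hu hv]
    simp [vol_apply, hπ, hu, hv]
  have him' : ∀ y ∈ W', ∀ u v, θ y ![u] = 0 → θ y ![v] = 0 →
      extDeriv θ y ![u, v] = (vol π y ![u, v]).im := fun y hy u v hu hv => by
    simp [hvol y hy u v hu hv]
  let ζ : R5 → R5 [⋀^Fin 2]→L[ℝ] ℝ := fun y => extDeriv θ y - imForm (vol π y)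
  have hζs : ContDiffOn ℝ ∞ ζ W' :=
    (contDiffOn_extDeriv hκ.isOpen hθ').sub (contDiffOn_imForm hcf.contDiffOn_vol)
  -- dθ - Im Ω vanishes on ker θ, so it is minus its contraction with X 0 wedged with θ; that
  -- contraction serves as a provisional ψ⁰₀.
  have hψ₁ : IsContactEq W' θ π fun y => (ζ y).curryLeft (X 0 y) := by
    refine ⟨contDiffOn_curryLeft hζs (hXs 0), fun y hy => ?_⟩
    have := eq_neg_wedge_of_forall_ker (ζ := ζ y) (hX y hy).z0 fun u v hu hv => by
      simp [ζ, him' y hy u v hu hv]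
    rw [← this]
    simp [ζ, vol]
  have hU : ∀ y ∈ W', ∀ i, antiholComponent (extDeriv (π i) y) (fun a => Y a y) = 0 := by
    intro y hy i
    have hd : ∀ a b, 1 ≤ a → 1 ≤ b → extDeriv (π i) y ![Y a y, Y b y] =
        extDeriv (κ i) y ![X a y, X b y] + c i y * (vol π y ![X a y, X b y]).im := by
      intro a b ha hb
      have ea := (hX y hy).apply_zero a ha
      have eb := (hX y hy).apply_zero b hb
      have hoR : DifferentiableAt ℝ (fun y => ofRealForm (θ y)) y :=
        differentiableAt_of_contDiffOn hκ.isOpen (contDiffOn_ofRealForm hθ') hy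
      have hcd := differentiableAt_of_contDiffOn hκ.isOpen (hcs i) hy
      have e : π i = κ i + fun y => c i y • ofRealForm (θ y) := rfl
      rw [e, extDeriv_add (differentiableAt_of_contDiffOn hκ.isOpen (hκ.smooth i) hy)
        (differentiableAt_of_contDiffOn hκ.isOpen (hcθ i) hy),
        ContinuousAlternatingMap.add_apply, hYX y hy a ha, hYX y hy b hb, ← him' y hy _ _ ea eb]
      congr 1
      have ed : extDeriv (fun y => ofRealForm (θ y)) y = ofRealForm (extDeriv θ y) :=
        extDeriv_comp_left Complex.ofRealCLM (differentiableAt_of_contDiffOn hκ.isOpen hθ' hy)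
      have ef : ∀ u, fderiv ℝ (fun y => c i y • ofRealForm (θ y)) y u =
          c i y • fderiv ℝ (fun y => ofRealForm (θ y)) y u + fderiv ℝ (c i) y u • ofRealForm (θ y) :=
        fun u => by rw [fderiv_fun_smul hcd hoR]; rfl
      have ed' := extDeriv_one_apply (fun y => ofRealForm (θ y)) y (X a y) (X b y)
      rw [ed, ofRealForm_apply] at ed'
      rw [extDeriv_one_apply, ef, ef, ed']
      simp [ea, eb]
      ring
    obtain ⟨z0, z1, z2, z3, z4, a0, a1, a2, a3, a4, b0, b1, b2, b3, b4⟩ := hX y hy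
    have hv : ∀ a b, 1 ≤ a → 1 ≤ b → vol π y ![X a y, X b y] =
        κ 0 y ![X a y] * κ 1 y ![X b y] - κ 0 y ![X b y] * κ 1 y ![X a y] := fun a b ha hb => by
      simp [vol_apply, hπ, (hX y hy).apply_zero a ha, (hX y hy).apply_zero b hb]
    have h1 : (1 : Fin 5) ≤ 1 := le_refl _
    have h2 : (1 : Fin 5) ≤ 2 := by decide
    have h3 : (1 : Fin 5) ≤ 3 := by decide
    have h4 : (1 : Fin 5) ≤ 4 := by decide
    rw [antiholComponent, hd 1 3 h1 h3, hd 1 4 h1 h4, hd 2 3 h2 h3, hd 2 4 h2 h4, hv 1 3 h1 h3,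
      hv 1 4 h1 h4, hv 2 3 h2 h3, hv 2 4 h2 h4]
    simp [a1, a2, a3, a4, b1, b2, b3, b4, c, antiholComponent]
    ring_nf
    simp [Complex.I_sq]
    ring
  obtain ⟨ψ₀, ψ, P, hψ₀, hψ, hP, hred⟩ := exists_reduced hcf hψ₁ hYs hY hU
  refine ⟨W', π, ψ₀, ψ, P, hW', hy', hcf, hψ₀, hψ, hP, hred, fun y hy =>
    ⟨(m y)⁻¹, inv_ne_zero (hm y hy).1, modEq_of_forall_ker (hX y hy).z0 fun u v hu hv => ?_⟩⟩
  have := congrArg Complex.re (hvol y hy u v hu hv)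
  have hne := (hm y hy).1
  rw [ContinuousAlternatingMap.smul_apply, reForm_apply]
  change _ = _ • (vol π y ![u, v]).re
  rw [this]
  simp
  field_simp

/-- If `S₂ = 0`, then near every point `π⁰ ∧ Re (π¹ ∧ π²)` can be rescaled to a closed form. -/
theorem exists_closed_pcLocal {π₀ : R5 → R5 [⋀^Fin 1]→L[ℝ] ℝ}
    {π : Fin 2 → R5 → R5 [⋀^Fin 1]→L[ℝ] ℂ} {ψ₀ : R5 → R5 [⋀^Fin 1]→L[ℝ] ℝ}
    (hc : IsCoframing W π₀ π) (hψ : IsContactEq W π₀ π ψ₀)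
    (hr : ∀ y ∈ W, ∃ (ψ : Fin 2 → Fin 2 → R5 [⋀^Fin 1]→L[ℝ] ℂ) (P : Matrix (Fin 2) (Fin 2) ℂ),
      IsReducedAt π₀ π ψ₀ ψ P y ∧ S₂ P = 0) {y₀ : R5} (hy₀ : y₀ ∈ W) :
    ∃ r : ℝ, 0 < r ∧ Metric.ball y₀ r ⊆ W ∧ ∃ l : R5 → ℝ,
      ContDiffOn ℝ ∞ l (Metric.ball y₀ r) ∧ (∀ y, 0 < l y) ∧
      ∀ y ∈ Metric.ball y₀ r, extDeriv (fun y => l y • pcLocal π₀ π y) y = 0 := by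
  obtain ⟨X, hXs, hX⟩ := hc.exists_frame
  have hdψs := contDiffOn_extDeriv hc.isOpen hψ.smooth
  have h3 : ∀ y ∈ W, ∀ u v w, extDeriv ψ₀ y ![u, v] * π₀ y ![w] - extDeriv ψ₀ y ![u, w] * π₀ y ![v]
        + extDeriv ψ₀ y ![v, w] * π₀ y ![u] = 0 := by
    intro y hy u v w
    obtain ⟨ψ, P, h, hS⟩ := hr y hy
    rw [extDeriv_psi_reduced hc hψ hy h]
    simp [im_torsionForm_eq_zero hS]
  have hker : ∀ y ∈ W, ∀ u v, π₀ y ![u] = 0 → π₀ y ![v] = 0 → extDeriv ψ₀ y ![u, v] = 0 := by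
    intro y hy u v hu hv
    simpa [hu, hv, (hX y hy).z0] using h3 y hy u v (X 0 y)
  let κ : R5 → R5 [⋀^Fin 1]→L[ℝ] ℝ := fun y => (extDeriv ψ₀ y).curryLeft (X 0 y)
  have hκs : ContDiffOn ℝ ∞ κ W := contDiffOn_curryLeft hdψs (hXs 0)
  have hdψ : ∀ y ∈ W, extDeriv ψ₀ y = -wedge (κ y) (π₀ y) := fun y hy =>
    eq_neg_wedge_of_forall_ker (hX y hy).z0 (hker y hy)
  -- `d(dψ) = 0` forces `κ` to be a multiple of `π⁰`
  have hκ : ∀ y ∈ W, ∀ a, 1 ≤ a → κ y ![X a y] = 0 := by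
    intro y hy
    have h1 : extDeriv (extDeriv ψ₀) y = 0 := extDeriv_extDeriv_apply
      (contDiffAt_of_contDiffOn hc.isOpen hψ.smooth hy) minSmoothness_two_le
    have e : extDeriv ψ₀ =ᶠ[nhds y] (-1 : ℝ) • fun y => wedge (κ y) (π₀ y) := by
      filter_upwards [hc.isOpen.mem_nhds hy] with z hz
      rw [hdψ z hz]
      simp
    rw [e.extDeriv_eq, extDeriv_smul] at h1
    have h2 : ∀ u v w : R5, _ = (0 : ℝ) := fun u v w =>
      (extDeriv_wedge_one_one (differentiableAt_of_contDiffOn hc.isOpen hκs hy)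
        (differentiableAt_of_contDiffOn hc.isOpen hc.smooth₀ hy) u v w).symm.trans
        (by simpa using congrArg (fun f => f ![u, v, w]) h1)
    simp only [hψ.apply hy, vol_apply] at h2
    obtain ⟨z0, z1, z2, z3, z4, a0, a1, a2, a3, a4, b0, b1, b2, b3, b4⟩ := hX y hy
    -- In dκ ∧ π⁰ - κ ∧ dπ⁰ = 0 only κ ∧ Im Ω survives on contact vectors. Im Ω is nonzero only on
    -- the pairs (1,4) and (2,3), so each triple isolates one value of κ.
    have k1 := h2 (X 1 y) (X 2 y) (X 3 y)
    have k2 := h2 (X 1 y) (X 2 y) (X 4 y)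
    have k3 := h2 (X 1 y) (X 3 y) (X 4 y)
    have k4 := h2 (X 2 y) (X 3 y) (X 4 y)
    have k5 := h2 (X 1 y) (X 4 y) (X 2 y)
    simp [*] at k1 k2 k3 k4 k5
    intro a ha
    fin_cases a
    · exact absurd ha (by decide)
    all_goals simp only [Fin.mk_one, Fin.reduceFinMk]; linarith
  have hclosed : ∀ y ∈ W, extDeriv ψ₀ y = 0 := by
    intro y hy
    rw [hdψ y hy]
    refine ext_two_basis (hX y hy).basis fun a b hab => ?_
    rw [(hX y hy).basis_apply, (hX y hy).basis_apply]
    have hb : 1 ≤ b := Fin.one_le_of_ne_zero (fun h => Fin.not_lt_zero a (h ▸ hab))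
    have ha : π₀ y ![X a y] = 0 ∨ κ y ![X a y] = 0 := by
      by_cases ha : a = 0
      · right
        subst ha
        simp only [κ, ContinuousAlternatingMap.curryLeft_apply_apply]
        exact apply_self _ _
      · exact Or.inl ((hX y hy).apply_zero a (Fin.one_le_of_ne_zero ha))
    simp [wedge_one_one, (hX y hy).apply_zero b hb, hκ y hy b hb]
  obtain ⟨r, hr0, hrW⟩ := Metric.isOpen_iff.1 hc.isOpen y₀ hy₀
  obtain ⟨ζ, hζs, hζ⟩ := exists_extDeriv_eq (hψ.smooth.mono hrW) fun y hy => hclosed y (hrW hy)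
  let g : R5 → ℝ := fun y => ζ y ![]
  have hgs : ContDiffOn ℝ ∞ g (Metric.ball y₀ r) := contDiffOn_form_apply_const hζs _
  have hg : ∀ y ∈ Metric.ball y₀ r, ∀ u, fderiv ℝ g y u = ψ₀ y ![u] := by
    intro y hy u
    have hd : DifferentiableAt ℝ ζ y := differentiableAt_of_contDiffOn Metric.isOpen_ball hζs hy
    rw [← hζ y hy, extDeriv_zero_apply]
    have e : g = fun y => ζ y ![] := rfl
    have := (ContinuousAlternatingMap.apply ℝ R5 ℝ (![] : Fin 0 → R5)).hasFDerivAt.comp y hd.hasFDerivAt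
    exact congrArg (fun L => L u) this.fderiv
  -- With ψ⁰₀ = dg one has dl = 2l ψ⁰₀, which cancels l dρ = -2l ψ⁰₀ ∧ ρ.
  let l : R5 → ℝ := fun y => Real.exp (2 * g y)
  have hls : ContDiffOn ℝ ∞ l (Metric.ball y₀ r) := (contDiffOn_const.mul hgs).exp
  refine ⟨r, hr0, hrW, l, hls, fun y => Real.exp_pos _, fun y hy => ?_⟩
  have hgd := differentiableAt_of_contDiffOn Metric.isOpen_ball hgs hy
  have hld : ∀ u, fderiv ℝ l y u = 2 * l y * ψ₀ y ![u] := fun u => by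
    have := ((hgd.hasFDerivAt.const_mul (2 : ℝ)).exp).fderiv
    rw [← hg y hy u]
    refine (congrArg (fun L => L u) this).trans ?_
    simp [l]
    ring
  obtain ⟨ψ, P, h, hS⟩ := hr y (hrW hy)
  ext v
  have e : v = ![v 0, v 1, v 2, v 3] := by ext i; fin_cases i <;> rfl
  rw [e, extDeriv_smul_three (differentiableAt_of_contDiffOn Metric.isOpen_ball hls hy)
    (differentiableAt_of_contDiffOn hc.isOpen hc.contDiffOn_pcLocal (hrW hy)),
    extDeriv_pcLocal_reduced hc hψ (hrW hy) h]
  simp only [ContinuousAlternatingMap.smul_apply, wedge_one_three, hld, smul_eq_mul,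
    Matrix.cons_val, ContinuousAlternatingMap.coe_zero, Pi.zero_apply]
  ring

end ReducedExistence

/-! ### Forms in charts and independence of the chart -/

section Charts

open Set

variable {M : Type*} [TopologicalSpace M] [ChartedSpace R5 M]
variable {F : Type*} [NormedAddCommGroup F] [NormedSpace ℝ F]

/-- `e` is a diffeomorphism between open subsets of `M` and `ℝ⁵`. -/
structure IsDiffeoChart (e : OpenPartialHomeomorph M R5) : Prop where
  contMDiffOn : ContMDiffOn 𝓘(ℝ, R5) 𝓘(ℝ, R5) ∞ e e.source
  contMDiffOn_symm : ContMDiffOn 𝓘(ℝ, R5) 𝓘(ℝ, R5) ∞ e.symm e.target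

theorem IsDiffeoChart.of_mem_maximalAtlas [IsManifold 𝓘(ℝ, R5) ∞ M]
    {e : OpenPartialHomeomorph M R5} (he : e ∈ IsManifold.maximalAtlas 𝓘(ℝ, R5) ∞ M) :
    IsDiffeoChart e :=
  ⟨contMDiffOn_of_mem_maximalAtlas he, contMDiffOn_symm_of_mem_maximalAtlas he⟩

theorem IsDiffeoChart.chartAt [IsManifold 𝓘(ℝ, R5) ∞ M] (x : M) : IsDiffeoChart (chartAt R5 x) :=
  .of_mem_maximalAtlas (IsManifold.chart_mem_maximalAtlas x)

variable {e e' : OpenPartialHomeomorph M R5}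

theorem IsDiffeoChart.mdifferentiable (he : IsDiffeoChart e) :
    e.MDifferentiable 𝓘(ℝ, R5) 𝓘(ℝ, R5) :=
  ⟨he.contMDiffOn.mdifferentiableOn (by simp), he.contMDiffOn_symm.mdifferentiableOn (by simp)⟩

/-- The value of a form at a point, as a form on the model space. -/
def Form.at {k : ℕ} (η : Form M F k) (x : M) : R5 [⋀^Fin k]→L[ℝ] F := η x

/-- The derivative of a chart, as a map of the model space. -/
def chartDeriv (e : OpenPartialHomeomorph M R5) (x : M) : R5 →L[ℝ] R5 :=
  mfderiv 𝓘(ℝ, R5) 𝓘(ℝ, R5) e x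

/-- The derivative of an inverse chart, as a map of the model space. -/
def chartSymmDeriv (e : OpenPartialHomeomorph M R5) (y : R5) : R5 →L[ℝ] R5 :=
  mfderiv 𝓘(ℝ, R5) 𝓘(ℝ, R5) e.symm y

theorem inChart_eq_comp {k : ℕ} (e : OpenPartialHomeomorph M R5) (η : Form M F k) (y : R5) :
    inChart e η y = (η.at (e.symm y)).compContinuousLinearMap (chartSymmDeriv e y) := rfl

theorem comp_comp {k : ℕ} (α : R5 [⋀^Fin k]→L[ℝ] F) (A B : R5 →L[ℝ] R5) :
    (α.compContinuousLinearMap A).compContinuousLinearMap B =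
      α.compContinuousLinearMap (A.comp B) := rfl

theorem comp_id {k : ℕ} (α : R5 [⋀^Fin k]→L[ℝ] F) :
    α.compContinuousLinearMap (ContinuousLinearMap.id ℝ R5) = α := rfl

theorem IsDiffeoChart.symm_deriv_comp_deriv (he : IsDiffeoChart e) {x : M} (hx : x ∈ e.source) :
    (chartSymmDeriv e (e x)).comp (chartDeriv e x) = ContinuousLinearMap.id ℝ R5 :=
  he.mdifferentiable.symm_comp_deriv hx

theorem IsDiffeoChart.deriv_comp_symm_deriv (he : IsDiffeoChart e) {y : R5} (hy : y ∈ e.target) :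
    (chartDeriv e (e.symm y)).comp (chartSymmDeriv e y) = ContinuousLinearMap.id ℝ R5 :=
  he.mdifferentiable.comp_symm_deriv hy

/-- A form is recovered from its expression in a chart. -/
theorem IsDiffeoChart.at_eq_inChart {k : ℕ} (he : IsDiffeoChart e) (η : Form M F k) {x : M}
    (hx : x ∈ e.source) :
    η.at x = (inChart e η (e x)).compContinuousLinearMap (chartDeriv e x) := by
  rw [inChart_eq_comp, comp_comp, he.symm_deriv_comp_deriv hx, comp_id, e.left_inv hx]

/-- Two forms agree at a point if and only if their expressions in a chart do. -/
theorem IsDiffeoChart.eq_iff {k : ℕ} (he : IsDiffeoChart e) {η ζ : Form M F k} {x : M}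
    (hx : x ∈ e.source) : η x = ζ x ↔ inChart e η (e x) = inChart e ζ (e x) := by
  constructor
  · intro h
    have h' : η.at x = ζ.at x := h
    rw [inChart_eq_comp, inChart_eq_comp, e.left_inv hx, h']
  · intro h
    have h1 := he.at_eq_inChart η hx
    rw [h, ← he.at_eq_inChart ζ hx] at h1
    exact h1

/-- The transition map between two charts. -/
theorem IsDiffeoChart.contDiffOn_transition (he : IsDiffeoChart e) (he' : IsDiffeoChart e') :
    ContDiffOn ℝ ∞ (e' ∘ e.symm) (e.target ∩ e.symm ⁻¹' e'.source) :=
  contMDiffOn_iff_contDiffOn.1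
    (he'.contMDiffOn.comp (he.contMDiffOn_symm.mono inter_subset_left) fun _ hy => hy.2)

omit [ChartedSpace R5 M] in
theorem isOpen_transition_domain (e e' : OpenPartialHomeomorph M R5) :
    IsOpen (e.target ∩ e.symm ⁻¹' e'.source) :=
  e.symm.isOpen_inter_preimage e'.open_source

theorem IsDiffeoChart.fderiv_transition (he : IsDiffeoChart e) (he' : IsDiffeoChart e') {y : R5}
    (hy : y ∈ e.target ∩ e.symm ⁻¹' e'.source) :
    fderiv ℝ (e' ∘ e.symm) y = (chartDeriv e' (e.symm y)).comp (chartSymmDeriv e y) := by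
  rw [← mfderiv_eq_fderiv]
  exact mfderiv_comp y (he'.mdifferentiable.mdifferentiableAt hy.2)
    (he.mdifferentiable.mdifferentiableAt_symm hy.1)

/-- Change of chart for the expression of a form. -/
theorem IsDiffeoChart.inChart_eq {k : ℕ} (he : IsDiffeoChart e) (he' : IsDiffeoChart e')
    (η : Form M F k) {y : R5} (hy : y ∈ e.target ∩ e.symm ⁻¹' e'.source) :
    inChart e η y =
      (inChart e' η ((e' ∘ e.symm) y)).compContinuousLinearMap (fderiv ℝ (e' ∘ e.symm) y) := by
  rw [he.fderiv_transition he' hy, inChart_eq_comp, he'.at_eq_inChart η hy.2, comp_comp]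
  rfl

/-- Naturality of d under the transition map; it makes the exterior derivative on M independent of
the preferred charts used to define it. -/
theorem IsDiffeoChart.extDeriv_inChart {k : ℕ} (he : IsDiffeoChart e) (he' : IsDiffeoChart e')
    {η : Form M F k} {y : R5} (hy : y ∈ e.target ∩ e.symm ⁻¹' e'.source)
    (hη : DifferentiableAt ℝ (inChart e' η) (e' (e.symm y))) :
    extDeriv (inChart e η) y =
      (extDeriv (inChart e' η) (e' (e.symm y))).compContinuousLinearMap
        (fderiv ℝ (e' ∘ e.symm) y) := by
  have ho := isOpen_transition_domain e e'
  have h1 : inChart e η =ᶠ[nhds y] fun y =>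
      (inChart e' η ((e' ∘ e.symm) y)).compContinuousLinearMap (fderiv ℝ (e' ∘ e.symm) y) := by
    filter_upwards [ho.mem_nhds hy] with z hz
    exact he.inChart_eq he' η hz
  rw [h1.extDeriv_eq]
  exact extDeriv_pullback (f := e' ∘ e.symm) hη
    ((he.contDiffOn_transition he').contDiffAt (ho.mem_nhds hy)) minSmoothness_two_le

variable [FiniteDimensional ℝ F]

theorem IsDiffeoChart.contDiffOn_inChart {k : ℕ} (he : IsDiffeoChart e) (he' : IsDiffeoChart e')
    {η : Form M F k} {V : Set R5} (hη : ContDiffOn ℝ ∞ (inChart e' η) V) :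
    ContDiffOn ℝ ∞ (inChart e η) (e.target ∩ e.symm ⁻¹' (e'.source ∩ e' ⁻¹' V)) := by
  have hs : e.target ∩ e.symm ⁻¹' (e'.source ∩ e' ⁻¹' V) ⊆ e.target ∩ e.symm ⁻¹' e'.source :=
    fun y hy => ⟨hy.1, hy.2.1⟩
  have ht := he.contDiffOn_transition he'
  have ht' : ContDiffOn ℝ ∞ (fderiv ℝ (e' ∘ e.symm)) (e.target ∩ e.symm ⁻¹' e'.source) :=
    ht.fderiv_of_isOpen (isOpen_transition_domain e e') (by simp)
  have h1 : ContDiffOn ℝ ∞ (fun z => inChart e' η ((e' ∘ e.symm) z))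
      (e.target ∩ e.symm ⁻¹' (e'.source ∩ e' ⁻¹' V)) := hη.comp (ht.mono hs) fun y hy => hy.2.2
  refine ContDiffOn.congr (contDiffOn_form fun v => ?_) fun y hy => he.inChart_eq he' η (hs hy)
  exact contDiffOn_form_apply (X := fun i y => fderiv ℝ (e' ∘ e.symm) y (v i)) h1
    fun i => (ht'.mono hs).clm_apply contDiffOn_const

/-- Smoothness of a form can be checked in one chart around each point. -/
theorem smoothFormOn_of_inChart [IsManifold 𝓘(ℝ, R5) ∞ M] {k : ℕ} {η : Form M F k} {U : Set M}
    (h : ∀ x ∈ U, ∃ e : OpenPartialHomeomorph M R5, IsDiffeoChart e ∧ x ∈ e.source ∧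
      ∃ V : Set R5, IsOpen V ∧ e x ∈ V ∧ ContDiffOn ℝ ∞ (inChart e η) V) : SmoothFormOn η U := by
  intro e he y hy
  obtain ⟨e', he', hx, V, hV, hxV, hη⟩ := h _ hy.2
  refine (((IsDiffeoChart.of_mem_maximalAtlas he).contDiffOn_inChart he' hη).contDiffAt
    (IsOpen.mem_nhds ?_ ⟨hy.1, hx, hxV⟩)).contDiffWithinAt
  exact e.symm.isOpen_inter_preimage (e'.isOpen_inter_preimage hV)

/-- Smoothness of a form refers to the maximal atlas, whereas the diffeomorphism in an
Euler–Lagrange equivalence is known only to be smooth in both directions. Comparison with the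
preferred chart at each point bridges the two. -/
theorem IsDiffeoChart.contDiffOn_of_smoothFormOn [IsManifold 𝓘(ℝ, R5) ∞ M] {k : ℕ}
    {η : Form M F k} {U : Set M} (he : IsDiffeoChart e) (hU : IsOpen U) (hη : SmoothFormOn η U) :
    ContDiffOn ℝ ∞ (inChart e η) (e.target ∩ e.symm ⁻¹' U) := by
  intro y hy
  have h := hη _ (IsManifold.chart_mem_maximalAtlas (I := 𝓘(ℝ, R5)) (n := ∞) (e.symm y))
  have hc := IsDiffeoChart.chartAt (e.symm y)
  have h1 := he.contDiffOn_inChart hc h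
  have hs := mem_chart_source R5 (e.symm y)
  refine (h1.contDiffAt (IsOpen.mem_nhds ?_ ⟨hy.1, hs, mem_chart_target R5 _, ?_⟩)).contDiffWithinAt
  · exact e.symm.isOpen_inter_preimage ((_root_.chartAt R5 (e.symm y)).isOpen_inter_preimage
      ((_root_.chartAt R5 (e.symm y)).symm.isOpen_inter_preimage hU))
  · change (_root_.chartAt R5 (e.symm y)).symm ((_root_.chartAt R5 (e.symm y)) (e.symm y)) ∈ U
    rw [(_root_.chartAt R5 (e.symm y)).left_inv hs]
    exact hy.2

omit [FiniteDimensional ℝ F] in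
/-- The exterior derivative can be computed in any chart. -/
theorem IsDiffeoChart.inChart_extD [IsManifold 𝓘(ℝ, R5) ∞ M] {k : ℕ} (he : IsDiffeoChart e)
    {η : Form M F k} {y : R5} (hy : y ∈ e.target) (hη : DifferentiableAt ℝ (inChart e η) y) :
    inChart e (extD η) y = extDeriv (inChart e η) y := by
  set x := e.symm y with hx
  have hxs : x ∈ e.source := e.map_target hy
  have hc := IsDiffeoChart.chartAt x
  have hs := mem_chart_source R5 x
  have e1 : (_root_.chartAt R5 x).symm (_root_.chartAt R5 x x) = x :=
    (_root_.chartAt R5 x).left_inv hs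
  have hy' : _root_.chartAt R5 x x ∈ (_root_.chartAt R5 x).target ∩
      (_root_.chartAt R5 x).symm ⁻¹' e.source :=
    ⟨mem_chart_target R5 x, by rw [mem_preimage, e1]; exact hxs⟩
  have e2 : e x = y := e.right_inv hy
  have h1 := hc.extDeriv_inChart he hy' (η := η) (by rw [e1, e2]; exact hη)
  have h2 : (extD η).at x = (extDeriv (inChart (_root_.chartAt R5 x) η)
      (_root_.chartAt R5 x x)).compContinuousLinearMap (chartDeriv (_root_.chartAt R5 x) x) := rfl
  rw [inChart_eq_comp, ← hx, h2, h1, comp_comp, comp_comp, hc.fderiv_transition he hy', e1, e2]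
  rw [ContinuousLinearMap.comp_assoc (chartDeriv e x),
    ← ContinuousLinearMap.comp_assoc (chartSymmDeriv (_root_.chartAt R5 x) _),
    hc.symm_deriv_comp_deriv hs, ContinuousLinearMap.id_comp, hx, he.deriv_comp_symm_deriv hy, comp_id]

end Charts

/-! ### Transfer of forms between M and ℝ⁵ -/

section Transfer

open Set

variable {M : Type*} [TopologicalSpace M] [ChartedSpace R5 M]
variable {F : Type*} [NormedAddCommGroup F] [NormedSpace ℝ F]
variable {e : OpenPartialHomeomorph M R5}

theorem inChart_wedge {A : Type*} [NormedCommRing A] [NormedAlgebra ℝ A] {p q : ℕ}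
    (e : OpenPartialHomeomorph M R5) (α : Form M A p) (β : Form M A q) (y : R5) :
    inChart e (fun x => wedge (α x) (β x)) y = wedge (inChart e α y) (inChart e β y) :=
  wedge_compContinuousLinearMap (α.at (e.symm y)) (β.at (e.symm y)) (chartSymmDeriv e y)

theorem inChart_pullback {k : ℕ} (he : IsDiffeoChart e) (α : R5 → R5 [⋀^Fin k]→L[ℝ] F) {y : R5}
    (hy : y ∈ e.target) : inChart e (pullback (N := R5) e α) y = α y := by
  have h : (pullback (N := R5) e α : Form M F k).at (e.symm y) =
      (α (e (e.symm y))).compContinuousLinearMap (chartDeriv e (e.symm y)) := rfl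
  rw [inChart_eq_comp, h, comp_comp, he.deriv_comp_symm_deriv hy, comp_id, e.right_inv hy]

theorem differentiableAt_of_eqOn {k : ℕ} {α β : R5 → R5 [⋀^Fin k]→L[ℝ] F} {V : Set R5}
    (hV : IsOpen V) (hα : ContDiffOn ℝ ∞ α V) (h : ∀ z ∈ V, β z = α z) {y : R5} (hy : y ∈ V) :
    DifferentiableAt ℝ β y :=
  (differentiableAt_of_contDiffOn hV hα hy).congr_of_eventuallyEq
    (Filter.eventually_of_mem (hV.mem_nhds hy) h)

theorem IsDiffeoChart.inChart_extD_of_smoothFormOn [IsManifold 𝓘(ℝ, R5) ∞ M]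
    [FiniteDimensional ℝ F] {k : ℕ} (he : IsDiffeoChart e) {η : Form M F k} {U : Set M}
    (hU : IsOpen U) (hη : SmoothFormOn η U) {y : R5} (hy : y ∈ e.target ∩ e.symm ⁻¹' U) :
    inChart e (extD η) y = extDeriv (inChart e η) y :=
  he.inChart_extD hy.1 (differentiableAt_of_contDiffOn (e.symm.isOpen_inter_preimage hU)
    (he.contDiffOn_of_smoothFormOn hU hη) hy)

/-- A form on `U` whose expression in the chart `e` agrees with a smooth one is smooth. -/
theorem IsDiffeoChart.smoothFormOn [IsManifold 𝓘(ℝ, R5) ∞ M] [FiniteDimensional ℝ F] {k : ℕ}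
    (he : IsDiffeoChart e) {η : Form M F k} {α : R5 → R5 [⋀^Fin k]→L[ℝ] F} {V : Set R5}
    (hV : IsOpen V) (hα : ContDiffOn ℝ ∞ α V) (hη : ∀ y ∈ V, inChart e η y = α y) {U : Set M}
    (hU : ∀ x ∈ U, x ∈ e.source ∧ e x ∈ V) : SmoothFormOn η U :=
  smoothFormOn_of_inChart fun x hx =>
    ⟨e, he, (hU x hx).1, V, hV, (hU x hx).2, hα.congr hη⟩

theorem IsDiffeoChart.smoothFormOn_pullback [IsManifold 𝓘(ℝ, R5) ∞ M] [FiniteDimensional ℝ F]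
    {k : ℕ} (he : IsDiffeoChart e) {α : R5 → R5 [⋀^Fin k]→L[ℝ] F} {V : Set R5}
    (hV : IsOpen V) (hα : ContDiffOn ℝ ∞ α V) {U : Set M} (hU : ∀ x ∈ U, x ∈ e.source ∧ e x ∈ V) :
    SmoothFormOn (pullback (N := R5) e α) U :=
  he.smoothFormOn (hV.inter e.open_target) (hα.mono inter_subset_left)
    (fun _ hy => inChart_pullback he α hy.2)
    fun x hx => ⟨(hU x hx).1, (hU x hx).2, e.map_source (hU x hx).1⟩

theorem smoothFormOn_zero [IsManifold 𝓘(ℝ, R5) ∞ M] [FiniteDimensional ℝ F] {k : ℕ} {U : Set M} :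
    SmoothFormOn (fun _ => 0 : Form M F k) U :=
  smoothFormOn_of_inChart fun x _ => ⟨chartAt R5 x, .chartAt x, mem_chart_source R5 x, univ,
    isOpen_univ, mem_univ _, contDiffOn_const (c := (0 : R5 [⋀^Fin k]→L[ℝ] F))⟩

theorem smoothFormOn_one [IsManifold 𝓘(ℝ, R5) ∞ M] {U : Set M} :
    SmoothFormOn (fun x => ContinuousAlternatingMap.constOfIsEmpty ℝ (TangentSpace 𝓘(ℝ, R5) x)
      (Fin 0) (1 : ℝ) : Form M ℝ 0) U :=
  smoothFormOn_of_inChart fun x _ => ⟨chartAt R5 x, .chartAt x, mem_chart_source R5 x, univ,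
    isOpen_univ, mem_univ _,
    contDiffOn_const (c := ContinuousAlternatingMap.constOfIsEmpty ℝ R5 (Fin 0) (1 : ℝ))⟩

theorem isDiffeoChart_refl : IsDiffeoChart (M := R5) (OpenPartialHomeomorph.refl R5) :=
  ⟨contMDiff_id.contMDiffOn, contMDiff_id.contMDiffOn⟩

theorem inChart_refl {k : ℕ} (η : Form R5 F k) (y : R5) :
    inChart (OpenPartialHomeomorph.refl R5) η y = η.at y := by
  have h : chartSymmDeriv (M := R5) (OpenPartialHomeomorph.refl R5) y =
      ContinuousLinearMap.id ℝ R5 := mfderiv_id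
  rw [inChart_eq_comp, h]
  rfl

/-- The identity is a diffeomorphic chart of ℝ⁵ in which a form is its own expression. -/
theorem smoothFormOn_model_iff [FiniteDimensional ℝ F] {k : ℕ} {η : Form R5 F k} {V : Set R5}
    (hV : IsOpen V) :
    SmoothFormOn η V ↔ ContDiffOn ℝ ∞ η.at V := by
  constructor
  · intro h
    have h1 := isDiffeoChart_refl.contDiffOn_of_smoothFormOn hV h
    refine (h1.mono fun y hy => ⟨mem_univ _, hy⟩).congr fun y _ => (inChart_refl η y).symm
  · intro h
    exact isDiffeoChart_refl.smoothFormOn hV h (fun y _ => inChart_refl η y)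
      fun x hx => ⟨mem_univ _, hx⟩

theorem extD_model {k : ℕ} {η : Form R5 F k} {y : R5}
    (hη : DifferentiableAt ℝ η.at y) :
    (extD η).at y = extDeriv η.at y := by
  have e1 : inChart (OpenPartialHomeomorph.refl R5) η = fun y => (η y : R5 [⋀^Fin k]→L[ℝ] F) :=
    funext (inChart_refl η)
  have h := isDiffeoChart_refl.inChart_extD (η := η) (mem_univ y) (e1 ▸ hη)
  rw [inChart_refl, e1] at h
  exact h

end Transfer

/-! ### Adapted and reduced coframings in a chart -/

section LocalCoframing

open Set

variable {M : Type*} [TopologicalSpace M] [ChartedSpace R5 M] [IsManifold 𝓘(ℝ, R5) ∞ M]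
  {S : MongeAmpereSystem M} {U : Set M} {e : OpenPartialHomeomorph M R5}

theorem isCoframing_inChart (he : IsDiffeoChart e) (hU : IsOpen U) (c : AdaptedCoframing S U) :
    IsCoframing (e.target ∩ e.symm ⁻¹' U) (inChart e c.π₀) (fun i => inChart e (c.π i)) := by
  refine ⟨e.symm.isOpen_inter_preimage hU, he.contDiffOn_of_smoothFormOn hU c.smooth₀,
    fun i => he.contDiffOn_of_smoothFormOn hU (c.smooth i), fun y hy v h0 h1 => ?_⟩
  have hv : ∀ {A : Type} [NormedAddCommGroup A] [NormedSpace ℝ A] (η : Form M A 1),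
      inChart e η y ![v] = η.at (e.symm y) (fun _ => chartSymmDeriv e y v) := fun η => by
    rw [inChart_eq_comp, ContinuousAlternatingMap.compContinuousLinearMap_apply]
    congr 1
    ext i; fin_cases i; rfl
  have h2 : chartSymmDeriv e y v = 0 := c.coframe _ hy.2 _ ((hv c.π₀).symm.trans h0)
    fun i => (hv (c.π i)).symm.trans (h1 i)
  have h3 := congrArg (fun L => L v) (he.deriv_comp_symm_deriv hy.1)
  simp only [ContinuousLinearMap.comp_apply, h2, map_zero] at h3
  exact h3.symm

theorem isContactEq_inChart (he : IsDiffeoChart e) (hU : IsOpen U) {c : AdaptedCoframing S U}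
    (r : ReducedStructure c) : IsContactEq (e.target ∩ e.symm ⁻¹' U) (inChart e c.π₀)
      (fun i => inChart e (c.π i)) (inChart e r.ψ₀) := by
  refine ⟨he.contDiffOn_of_smoothFormOn hU r.smooth₀, fun y hy => ?_⟩
  rw [← he.inChart_extD_of_smoothFormOn hU c.smooth₀ hy, ← inChart_wedge, ← inChart_wedge]
  have h : (extD c.π₀).at (e.symm y) = -Form.at (M := M) (F := ℝ) (fun x => wedge (r.ψ₀ x) (c.π₀ x)) (e.symm y)
      + imForm (Form.at (M := M) (F := ℂ) (fun x => wedge (c.π 0 x) (c.π 1 x)) (e.symm y)) :=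
    r.eq₀ _ hy.2
  rw [inChart_eq_comp, h]
  rfl

theorem isReducedAt_inChart (he : IsDiffeoChart e) (hU : IsOpen U) {c : AdaptedCoframing S U}
    (r : ReducedStructure c) {y : R5} (hy : y ∈ e.target ∩ e.symm ⁻¹' U) :
    IsReducedAt (inChart e c.π₀) (fun i => inChart e (c.π i)) (inChart e r.ψ₀)
      (fun i j => inChart e (r.ψ i j) y) (r.P (e.symm y)) y := by
  refine ⟨?_, fun i => ?_⟩
  · have h : (r.ψ 0 0).at (e.symm y) + (r.ψ 1 1).at (e.symm y) = ofRealForm (r.ψ₀.at (e.symm y)) :=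
      r.trace _ hy.2
    simp only [inChart_eq_comp]
    have := congrArg (fun α => α.compContinuousLinearMap (chartSymmDeriv e y)) h
    exact this
  · rw [← he.inChart_extD_of_smoothFormOn hU (c.smooth i) hy]
    have h : (extD (c.π i)).at (e.symm y) =
        -(∑ j, wedge ((r.ψ i j).at (e.symm y)) ((c.π j).at (e.symm y)))
        - ∑ j, r.P (e.symm y) i j • wedge (conjForm ((c.π j).at (e.symm y)))
          (ofRealForm (c.π₀.at (e.symm y))) := r.eq _ hy.2 i
    rw [inChart_eq_comp, h]
    simp only [Fin.sum_univ_two, inChart_eq_comp]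
    have e1 : ∀ α : R5 [⋀^Fin 1]→L[ℝ] ℂ, conjForm (α.compContinuousLinearMap (chartSymmDeriv e y)) =
      (conjForm α).compContinuousLinearMap (chartSymmDeriv e y) := fun α => rfl
    have e2 : ∀ α : R5 [⋀^Fin 1]→L[ℝ] ℝ,
      ofRealForm (α.compContinuousLinearMap (chartSymmDeriv e y)) =
      (ofRealForm α).compContinuousLinearMap (chartSymmDeriv e y) := fun α => rfl
    simp only [e1, e2, ← wedge_compContinuousLinearMap]
    rfl

end LocalCoframing

/-! ### Comparison of θ ∧ Ψ with ρ -/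

section LocalIdeal

open Set

variable {W : Set R5} {π₀ : R5 → R5 [⋀^Fin 1]→L[ℝ] ℝ} {π : Fin 2 → R5 → R5 [⋀^Fin 1]→L[ℝ] ℂ}

/-- The part of Ψ divisible by π⁰ dies against θ, so knowing Ψ on ker π⁰ is enough. -/
theorem wedge_eq_smul_pcLocal {y R : R5} (hR : π₀ y ![R] = 1) {θ : R5 [⋀^Fin 1]→L[ℝ] ℝ}
    {Ψ : R5 [⋀^Fin 2]→L[ℝ] ℝ} {t q : ℝ} (hθ : θ = t • π₀ y)
    (hΨ : ∀ u v, π₀ y ![u] = 0 → π₀ y ![v] = 0 → Ψ ![u, v] = q * (vol π y ![u, v]).re) :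
    wedge θ Ψ = (t * q) • pcLocal π₀ π y := by
  obtain ⟨γ, hγ⟩ := modEq_of_forall_ker (θ := π₀ y) (η := Ψ) (η' := q • reForm (vol π y)) hR hΨ
  have e : Ψ = q • reForm (vol π y) + wedge γ (π₀ y) := by rw [← hγ]; abel
  ext v
  rw [hθ, e, ContinuousAlternatingMap.smul_apply, pcLocal, wedge_one_two, wedge_one_two]
  simp only [ContinuousAlternatingMap.smul_apply, ContinuousAlternatingMap.add_apply, wedge_one_one,
    reForm_apply, smul_eq_mul, Matrix.cons_val_zero, Matrix.cons_val_one]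
  simp only [vol, wedge_one_one, Matrix.cons_val_zero, Matrix.cons_val_one]
  ring

theorem pcLocal_frame {y : R5} {X : Fin 5 → R5} (hX : IsDualFrame (π₀ y) (fun i => π i y) X) :
    pcLocal π₀ π y ![X 0, X 1, X 3] = 1 := by
  obtain ⟨z0, z1, z2, z3, z4, a0, a1, a2, a3, a4, b0, b1, b2, b3, b4⟩ := hX
  simp [pcLocal_apply, vol_apply, *]

theorem contDiffOn_apply_three {A : Type*} [NormedAddCommGroup A] [NormedSpace ℝ A]
    {α : R5 → R5 [⋀^Fin 3]→L[ℝ] A} {X Y Z : R5 → R5} (hα : ContDiffOn ℝ ∞ α W)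
    (hX : ContDiffOn ℝ ∞ X W) (hY : ContDiffOn ℝ ∞ Y W) (hZ : ContDiffOn ℝ ∞ Z W) :
    ContDiffOn ℝ ∞ (fun y => α y ![X y, Y y, Z y]) W := by
  have e : ∀ z, ![X z, Y z, Z z] = fun i => (![X, Y, Z] : Fin 3 → R5 → R5) i z := fun z => by
    ext i; fin_cases i <;> rfl
  simp only [e]
  exact contDiffOn_form_apply hα fun i => by fin_cases i <;> assumption

/-- If `Ψ` is a nonzero multiple of `Re Ω` modulo `π⁰`, then `π⁰ ∧ Re Ω` is a smooth nonvanishing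
multiple of `θ ∧ Ψ`. -/
theorem IsCoframing.exists_pcLocal_eq_smul (hc : IsCoframing W π₀ π)
    {θ : R5 → R5 [⋀^Fin 1]→L[ℝ] ℝ} {Ψ : R5 → R5 [⋀^Fin 2]→L[ℝ] ℝ} (hθ : ContDiffOn ℝ ∞ θ W)
    (hΨ : ContDiffOn ℝ ∞ Ψ W) (ht : ∀ y ∈ W, ∃ t : ℝ, t ≠ 0 ∧ θ y = t • π₀ y)
    (hq : ∀ y ∈ W, ∃ q : ℝ, q ≠ 0 ∧ ∀ u v, π₀ y ![u] = 0 → π₀ y ![v] = 0 →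
      Ψ y ![u, v] = q * (vol π y ![u, v]).re) :
    ∃ h : R5 → ℝ, ContDiffOn ℝ ∞ h W ∧
      ∀ y ∈ W, h y ≠ 0 ∧ pcLocal π₀ π y = h y • wedge (θ y) (Ψ y) := by
  obtain ⟨X, hXs, hX⟩ := hc.exists_frame
  let g : R5 → ℝ := fun y => wedge (p := 1) (q := 2) (θ y) (Ψ y) ![X 0 y, X 1 y, X 3 y]
  have hgs : ContDiffOn ℝ ∞ g W :=
    contDiffOn_apply_three (contDiffOn_wedge (p := 1) (q := 2) hθ hΨ) (hXs 0) (hXs 1) (hXs 3)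
  have hg : ∀ y ∈ W, g y ≠ 0 ∧ wedge (θ y) (Ψ y) = g y • pcLocal π₀ π y := fun y hy => by
    obtain ⟨t, ht0, ht⟩ := ht y hy
    obtain ⟨q, hq0, hq⟩ := hq y hy
    have e := wedge_eq_smul_pcLocal (hX y hy).z0 ht hq
    have : g y = t * q := by
      simp only [g, e]
      change (t * q) * pcLocal π₀ π y ![X 0 y, X 1 y, X 3 y] = _
      rw [pcLocal_frame (hX y hy), mul_one]
    rw [this]
    exact ⟨mul_ne_zero ht0 hq0, e⟩
  refine ⟨fun y => (g y)⁻¹, hgs.inv fun y hy => (hg y hy).1, fun y hy =>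
    ⟨inv_ne_zero (hg y hy).1, ?_⟩⟩
  change _ = (g y)⁻¹ • wedge (θ y) (Ψ y)
  rw [(hg y hy).2, smul_smul, inv_mul_cancel₀ (hg y hy).1, one_smul]

/-- If `α` is a multiple of `π⁰`, then `dα` is the same multiple of `dπ⁰` modulo `π⁰`. -/
theorem IsCoframing.extDeriv_apply_of_eq_smul (hc : IsCoframing W π₀ π)
    {α : R5 → R5 [⋀^Fin 1]→L[ℝ] ℝ} (hα : ContDiffOn ℝ ∞ α W)
    (h : ∀ y ∈ W, ∃ t : ℝ, α y = t • π₀ y) {y : R5} (hy : y ∈ W) {t : ℝ} (ht : α y = t • π₀ y)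
    {u v : R5} (hu : π₀ y ![u] = 0) (hv : π₀ y ![v] = 0) :
    extDeriv α y ![u, v] = t * extDeriv π₀ y ![u, v] := by
  obtain ⟨X, hXs, hX⟩ := hc.exists_frame
  let f : R5 → ℝ := fun z => α z ![X 0 z]
  have hfs : ContDiffOn ℝ ∞ f W := contDiffOn_apply_one hα (hXs 0)
  have hf : ∀ z ∈ W, ∀ s : ℝ, α z = s • π₀ z → f z = s := fun z hz s hs => by
    simp [f, hs, (hX z hz).z0]
  have e : α =ᶠ[nhds y] fun z => f z • π₀ z := by
    filter_upwards [hc.isOpen.mem_nhds hy] with z hz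
    obtain ⟨s, hs⟩ := h z hz
    rw [hf z hz s hs, hs]
  rw [e.extDeriv_eq, extDeriv_smul_one (differentiableAt_of_contDiffOn hc.isOpen hfs hy)
    (differentiableAt_of_contDiffOn hc.isOpen hc.smooth₀ hy), hf y hy t ht, hu, hv]
  simp

/-- A closed form `θ' ∧ Ψ'`, where `θ'`, `dθ'`, `Ψ'` generate the ideal, is a nonvanishing multiple
of `π⁰ ∧ Re Ω`. -/
theorem wedge_eq_smul_pcLocal_of_closed (hc : IsCoframing W π₀ π)
    {ψ₀ : R5 → R5 [⋀^Fin 1]→L[ℝ] ℝ} (hψ : IsContactEq W π₀ π ψ₀)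
    {θ : R5 → R5 [⋀^Fin 1]→L[ℝ] ℝ} {Ψ : R5 → R5 [⋀^Fin 2]→L[ℝ] ℝ} (hθ : ContDiffOn ℝ ∞ θ W)
    (hΨ : ContDiffOn ℝ ∞ Ψ W) (ht : ∀ y ∈ W, ∃ t : ℝ, t ≠ 0 ∧ θ y = t • π₀ y)
    {y : R5} (hy : y ∈ W) {p q : ℝ} (hpq : ∀ u v, π₀ y ![u] = 0 → π₀ y ![v] = 0 →
      Ψ y ![u, v] = p * (vol π y ![u, v]).im + q * (vol π y ![u, v]).re)
    {b c μ : ℝ} (hμ : μ ≠ 0) (hbc : ∀ u v, π₀ y ![u] = 0 → π₀ y ![v] = 0 →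
      μ * (vol π y ![u, v]).re = b * extDeriv θ y ![u, v] + c * Ψ y ![u, v])
    (hd : extDeriv (fun z => wedge (θ z) (Ψ z)) y = 0) :
    ∃ s : ℝ, s ≠ 0 ∧ wedge (θ y) (Ψ y) = s • pcLocal π₀ π y := by
  obtain ⟨X, -, hX⟩ := hc.exists_frame
  obtain ⟨t, ht0, hty⟩ := ht y hy
  have ht' : ∀ z ∈ W, ∃ t : ℝ, θ z = t • π₀ z := fun z hz => (ht z hz).imp fun _ h => h.2
  have hdθ : ∀ u v, π₀ y ![u] = 0 → π₀ y ![v] = 0 →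
      extDeriv θ y ![u, v] = t * (vol π y ![u, v]).im := fun u v hu hv => by
    rw [hc.extDeriv_apply_of_eq_smul hθ ht' hy hty hu hv, hψ.apply hy, hu, hv]
    ring
  have hX' := hX y hy
  obtain ⟨z0, z1, z2, z3, z4, a0, a1, a2, a3, a4, b0, b1, b2, b3, b4⟩ := hX y hy
  -- On contact vectors d(θ ∧ Ψ) is dθ ∧ Ψ = t Im Ω ∧ (p Im Ω + q Re Ω). Since Im Ω ∧ Re Ω = 0 and
  -- Im Ω ∧ Im Ω ≠ 0, closedness gives tp = 0.
  have hp : p = 0 := by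
    have h1 := extDeriv_wedge_one_two (differentiableAt_of_contDiffOn hc.isOpen hθ hy)
      (differentiableAt_of_contDiffOn hc.isOpen hΨ hy) (X 1 y) (X 2 y) (X 3 y) (X 4 y)
    rw [hd] at h1
    simp only [hty, ContinuousAlternatingMap.smul_apply, z1, z2, z3, z4, hdθ _ _ z1 z2,
      hdθ _ _ z1 z3, hdθ _ _ z1 z4, hdθ _ _ z2 z3, hdθ _ _ z2 z4, hdθ _ _ z3 z4, hpq _ _ z1 z2,
      hpq _ _ z1 z3, hpq _ _ z1 z4, hpq _ _ z2 z3, hpq _ _ z2 z4, hpq _ _ z3 z4, vol_apply] at h1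
    simp [a1, a2, a3, a4, b1, b2, b3, b4] at h1
    have h2 : t * p = 0 := by linarith
    exact (mul_eq_zero.1 h2).resolve_left ht0
  -- With p = q = 0 the ideal would contain, modulo π⁰, only multiples of Im Ω in degree 2; these
  -- vanish on (X 1, X 3), where Re Ω is 1.
  have hq : q ≠ 0 := by
    rintro rfl
    have h1 := hbc _ _ z1 z3
    rw [hdθ _ _ z1 z3, hpq _ _ z1 z3, hp, vol_apply] at h1
    simp [a1, a3, b1, b3] at h1
    exact hμ h1
  refine ⟨t * q, mul_ne_zero ht0 hq, wedge_eq_smul_pcLocal z0 hty fun u v hu hv => ?_⟩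
  rw [hpq u v hu hv, hp, zero_mul, zero_add]

end LocalIdeal

/-! ### The system in a chart, and closed forms imply S₂ = 0 -/

section SystemInChart

open Set

variable {M : Type*} [TopologicalSpace M] [ChartedSpace R5 M]
  {S : MongeAmpereSystem M} {U : Set M} {e : OpenPartialHomeomorph M R5}

theorem SmoothFormOn.mono {F : Type*} [NormedAddCommGroup F] [NormedSpace ℝ F] {k : ℕ}
    {η : Form M F k} {V : Set M} (h : SmoothFormOn η U) (hV : V ⊆ U) : SmoothFormOn η V :=
  fun e he => (h e he).mono (inter_subset_inter_right _ (preimage_mono hV))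

theorem ModEq.comp {k : ℕ} {θ : R5 [⋀^Fin 1]→L[ℝ] ℝ} {η η' : R5 [⋀^Fin (k + 1)]→L[ℝ] ℝ}
    (h : ModEq θ η η') (L : R5 →L[ℝ] R5) : ModEq (θ.compContinuousLinearMap L)
      (η.compContinuousLinearMap L) (η'.compContinuousLinearMap L) := by
  obtain ⟨γ, hγ⟩ := h
  refine ⟨γ.compContinuousLinearMap L, ?_⟩
  have := congrArg (fun α => α.compContinuousLinearMap L) hγ
  simp only [wedge_compContinuousLinearMap] at this
  exact this

/-- The restriction of an adapted coframing. -/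
def AdaptedCoframing.restrict (c : AdaptedCoframing S U) {V : Set M} (h : V ⊆ U) :
    AdaptedCoframing S V where
  π₀ := c.π₀
  π := c.π
  smooth₀ := c.smooth₀.mono h
  smooth i := (c.smooth i).mono h
  coframe x hx := c.coframe x (h hx)
  contact x hx := c.contact x (h hx)
  dcontact x hx := c.dcontact x (h hx)
  psi x hx := c.psi x (h hx)

/-- The restriction of the pseudo-connection forms and torsion coefficients. -/
def ReducedStructure.restrict {c : AdaptedCoframing S U} (r : ReducedStructure c) {V : Set M}
    (h : V ⊆ U) : ReducedStructure (c.restrict h) where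
  ψ₀ := r.ψ₀
  ψ := r.ψ
  P := r.P
  smooth₀ := r.smooth₀.mono h
  smooth i j := (r.smooth i j).mono h
  smoothP i j := (r.smoothP i j).mono h
  trace x hx := r.trace x (h hx)
  eq₀ x hx := r.eq₀ x (h hx)
  eq x hx := r.eq x (h hx)

theorem AdaptedCoframing.contact_inChart (c : AdaptedCoframing S U) {y : R5}
    (hy : y ∈ e.target ∩ e.symm ⁻¹' U) :
    ∃ t : ℝ, t ≠ 0 ∧ inChart e S.θ y = t • inChart e c.π₀ y := by
  obtain ⟨a, ha, h⟩ := c.contact _ hy.2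
  have h' : c.π₀.at (e.symm y) = a • S.θ.at (e.symm y) := h
  refine ⟨a⁻¹, inv_ne_zero ha, ?_⟩
  rw [inChart_eq_comp, inChart_eq_comp, h']
  change _ = a⁻¹ • a • (S.θ.at (e.symm y)).compContinuousLinearMap (chartSymmDeriv e y)
  rw [smul_smul, inv_mul_cancel₀ ha, one_smul]

theorem AdaptedCoframing.psi_inChart (c : AdaptedCoframing S U) {y : R5}
    (hy : y ∈ e.target ∩ e.symm ⁻¹' U) :
    ∃ q : ℝ, q ≠ 0 ∧ ∀ u v, inChart e c.π₀ y ![u] = 0 → inChart e c.π₀ y ![v] = 0 →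
      inChart e S.Ψ y ![u, v] = q * (vol (fun i => inChart e (c.π i)) y ![u, v]).re := by
  obtain ⟨q, hq, h⟩ := c.psi _ hy.2
  have h' : ModEq (k := 1) (c.π₀.at (e.symm y)) (S.Ψ.at (e.symm y))
    (q • reForm (wedge ((c.π 0).at (e.symm y)) ((c.π 1).at (e.symm y)))) := h
  refine ⟨q, hq, fun u v hu hv => ?_⟩
  have := (h'.comp (chartSymmDeriv e y)).apply_eq_of_ker (w := ![u, v]) fun i => by
    fin_cases i <;> assumption
  refine Eq.trans this ?_
  rw [vol, ← inChart_wedge]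
  rfl

theorem pcForm_inChart (c : AdaptedCoframing S U) (l : M → ℝ) (y : R5) :
    inChart e (pcForm c l) y =
      l (e.symm y) • pcLocal (inChart e c.π₀) (fun i => inChart e (c.π i)) y := by
  have e1 : pcLocal (inChart e c.π₀) (fun i => inChart e (c.π i)) y =
      (wedge (c.π₀.at (e.symm y)) (reForm (wedge ((c.π 0).at (e.symm y))
        ((c.π 1).at (e.symm y))))).compContinuousLinearMap (chartSymmDeriv e y) := by
    rw [wedge_compContinuousLinearMap, pcLocal, ← inChart_wedge]
    rfl
  rw [e1]
  rfl

theorem IsDiffeoChart.contDiffOn_comp_symm (he : IsDiffeoChart e) {l : M → ℝ}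
    (hl : ContMDiffOn 𝓘(ℝ, R5) 𝓘(ℝ, ℝ) ∞ l U) :
    ContDiffOn ℝ ∞ (fun y => l (e.symm y)) (e.target ∩ e.symm ⁻¹' U) :=
  contMDiffOn_iff_contDiffOn.1
    (hl.comp (he.contMDiffOn_symm.mono inter_subset_left) fun _ hy => hy.2)

theorem IsDiffeoChart.contMDiffOn_comp {F : Type*} [NormedAddCommGroup F] [NormedSpace ℝ F]
    (he : IsDiffeoChart e) {f : R5 → F} {V : Set R5} (hf : ContDiffOn ℝ ∞ f V)
    (hU : ∀ x ∈ U, x ∈ e.source ∧ e x ∈ V) :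
    ContMDiffOn 𝓘(ℝ, R5) 𝓘(ℝ, F) ∞ (fun x => f (e x)) U :=
  (contMDiffOn_iff_contDiffOn.2 hf).comp (he.contMDiffOn.mono fun x hx => (hU x hx).1)
    fun x hx => (hU x hx).2

omit [ChartedSpace R5 M] in
theorem inter_mono_right {V : Set M} (h : V ⊆ U) :
    e.target ∩ e.symm ⁻¹' V ⊆ e.target ∩ e.symm ⁻¹' U :=
  inter_subset_inter_right _ (preimage_mono h)

variable [IsManifold 𝓘(ℝ, R5) ∞ M]

/-- Two adapted coframings have proportional forms `π⁰ ∧ Re Ω`. -/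
theorem AdaptedCoframing.pcForm_inChart_eq_smul (he : IsDiffeoChart e) (hU : IsOpen U)
    (c : AdaptedCoframing S U) {V : Set M} (c' : AdaptedCoframing S V) (l : M → ℝ) {y : R5}
    (hy : y ∈ e.target ∩ e.symm ⁻¹' U) (hy' : y ∈ e.target ∩ e.symm ⁻¹' V)
    (hl : 0 < l (e.symm y)) :
    ∃ s : ℝ, s ≠ 0 ∧ inChart e (pcForm c' l) y =
      s • pcLocal (inChart e c.π₀) (fun i => inChart e (c.π i)) y := by
  obtain ⟨t, ht, h⟩ := c.contact_inChart hy
  obtain ⟨t', ht', h'⟩ := c'.contact_inChart hy'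
  obtain ⟨q, hq, hΨ⟩ := c.psi_inChart hy
  obtain ⟨q', hq', hΨ'⟩ := c'.psi_inChart hy'
  obtain ⟨X, -, hX⟩ := (isCoframing_inChart he hU c).exists_frame
  have h0 : inChart e c'.π₀ y = (t'⁻¹ * t) • inChart e c.π₀ y := by
    rw [mul_smul, ← h, h', smul_smul, inv_mul_cancel₀ ht', one_smul]
  have hre : ∀ u v, inChart e c.π₀ y ![u] = 0 → inChart e c.π₀ y ![v] = 0 →
      reForm (vol (fun i => inChart e (c'.π i)) y) ![u, v] =
        (q'⁻¹ * q) * (vol (fun i => inChart e (c.π i)) y ![u, v]).re := fun u v hu hv => by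
    have h1 := hΨ' u v (by rw [h0, ContinuousAlternatingMap.smul_apply, hu, smul_zero])
      (by rw [h0, ContinuousAlternatingMap.smul_apply, hv, smul_zero])
    rw [hΨ u v hu hv] at h1
    rw [reForm_apply, mul_assoc, h1, ← mul_assoc, inv_mul_cancel₀ hq', one_mul]
  have h1 := wedge_eq_smul_pcLocal (hX y hy).z0 h0 hre
  refine ⟨l (e.symm y) * ((t'⁻¹ * t) * (q'⁻¹ * q)), by positivity, ?_⟩
  rw [pcForm_inChart, mul_smul, ← h1]
  rfl

/-- A closed form which is a nonvanishing multiple of `π⁰ ∧ Re Ω` forces `S₂ = 0`. -/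
theorem ReducedStructure.S₂_eq_zero (he : IsDiffeoChart e) (hU : IsOpen U)
    {c : AdaptedCoframing S U} (r : ReducedStructure c) {x : M} (hxe : x ∈ e.source) (hx : x ∈ U)
    {η : R5 → R5 [⋀^Fin 3]→L[ℝ] ℝ} (hη : ContDiffOn ℝ ∞ η (e.target ∩ e.symm ⁻¹' U))
    (hd : ∀ z ∈ e.target ∩ e.symm ⁻¹' U, extDeriv η z = 0)
    (hρ : ∀ z ∈ e.target ∩ e.symm ⁻¹' U, ∃ s : ℝ, s ≠ 0 ∧
      η z = s • pcLocal (inChart e c.π₀) (fun i => inChart e (c.π i)) z) :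
    S₂ (r.P x) = 0 := by
  have hy : e x ∈ e.target ∩ e.symm ⁻¹' U :=
    ⟨e.map_source hxe, by rw [mem_preimage, e.left_inv hxe]; exact hx⟩
  have := S₂_eq_zero_of_closed (isCoframing_inChart he hU c) (isContactEq_inChart he hU r) hy
    (fun z hz => ⟨_, _, isReducedAt_inChart he hU r hz⟩) (isReducedAt_inChart he hU r hy) hη hd hρ
  rwa [e.left_inv hxe] at this

/-- The closed form comes with its own coframing, but θ and Ψ are common to all. On the overlap it
is a nonvanishing multiple of the ρ of any other reduced coframing, to which the local criterion
then applies. -/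
theorem S₂Vanishes_of_hasClosedPCForm (h : HasClosedPCForm S) : S₂Vanishes S := by
  intro U hU c r x hx
  obtain ⟨V, hV, hxV, c', l, -, hl⟩ := h x
  have he := IsDiffeoChart.chartAt x
  have hUV : IsOpen (U ∩ V) := hU.inter hV
  have hη : ContDiffOn ℝ ∞ (inChart (chartAt R5 x) (pcForm c' l))
      ((chartAt R5 x).target ∩ (chartAt R5 x).symm ⁻¹' (U ∩ V)) :=
    ((((he.contDiffOn_comp_symm hl.smooth).smul
      (isCoframing_inChart he hV c').contDiffOn_pcLocal).congr fun y _ =>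
        pcForm_inChart c' l y).mono (inter_mono_right inter_subset_right))
  refine (r.restrict (inter_subset_left (t := V))).S₂_eq_zero he hUV (mem_chart_source R5 x)
    ⟨hx, hxV⟩ hη (fun z hz => ?_) fun z hz => ?_
  · have hz' : (extD (pcForm c' l)).at ((chartAt R5 x).symm z) = 0 := hl.closed _ hz.2.2
    rw [← he.inChart_extD hz.1 (differentiableAt_of_contDiffOn
      ((chartAt R5 x).symm.isOpen_inter_preimage hUV) hη hz), inChart_eq_comp, hz']
    rfl
  · exact AdaptedCoframing.pcForm_inChart_eq_smul he hUV (c.restrict inter_subset_left) c' l hz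
      ⟨hz.1, hz.2.2⟩ (hl.pos _ hz.2.2)

end SystemInChart

/-! ### Euler–Lagrange systems have S₂ = 0 -/

section EulerLagrange

open Set

theorem zero_wedge {E A : Type*} [AddCommGroup E] [Module ℝ E] [TopologicalSpace E]
    [NormedCommRing A] [NormedAlgebra ℝ A] {p q : ℕ} (β : E [⋀^Fin q]→L[ℝ] A) :
    wedge (0 : E [⋀^Fin p]→L[ℝ] A) β = 0 := by
  ext v
  simp [wedge_apply]

theorem wedge_zero_one {E : Type*} [AddCommGroup E] [Module ℝ E] [TopologicalSpace E]
    (a : E [⋀^Fin 0]→L[ℝ] ℝ) (β : E [⋀^Fin 1]→L[ℝ] ℝ) :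
    (wedge a β : E [⋀^Fin 1]→L[ℝ] ℝ) = a ![] • β := by
  ext v
  rw [wedge_zero_left]
  change _ = a ![] * β v
  congr 2
  ext j; fin_cases j; rfl

theorem wedge_zero_two {E : Type*} [AddCommGroup E] [Module ℝ E] [TopologicalSpace E]
    (a : E [⋀^Fin 0]→L[ℝ] ℝ) (β : E [⋀^Fin 2]→L[ℝ] ℝ) :
    (wedge a β : E [⋀^Fin 2]→L[ℝ] ℝ) = a ![] • β := by
  ext v
  rw [wedge_zero_left]
  change _ = a ![] * β v
  congr 2
  ext j; fin_cases j <;> rfl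

variable {M : Type*} [TopologicalSpace M] [ChartedSpace R5 M] [IsManifold 𝓘(ℝ, R5) ∞ M]
  {S : MongeAmpereSystem M} {U : Set M} {e : OpenPartialHomeomorph M R5}

theorem memIdeal_contact {θ : Form M ℝ 1} {Ψ : Form M ℝ 2} : MemIdeal U θ Ψ 1 θ := by
  refine ⟨_, smoothFormOn_one, fun x _ => ?_⟩
  have := wedge_zero_one (ContinuousAlternatingMap.constOfIsEmpty ℝ R5 (Fin 0) (1 : ℝ)) (θ.at x)
  exact ((this.trans (one_smul ℝ (θ.at x))).symm : θ.at x = _)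

theorem memIdeal_generator {θ : Form M ℝ 1} {Ψ : Form M ℝ 2} : MemIdeal U θ Ψ 2 Ψ := by
  refine ⟨_, _, _, smoothFormOn_zero, smoothFormOn_zero, smoothFormOn_one, fun x _ => ?_⟩
  have h1 := wedge_zero_two (ContinuousAlternatingMap.constOfIsEmpty ℝ R5 (Fin 0) (1 : ℝ)) (Ψ.at x)
  have h2 : wedge (p := 1) (0 : R5 [⋀^Fin 1]→L[ℝ] ℝ) (θ.at x) = 0 := zero_wedge _
  have h3 : wedge (p := 0) (0 : R5 [⋀^Fin 0]→L[ℝ] ℝ) ((extD θ).at x) = 0 := zero_wedge _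
  have h4 : Ψ.at x = wedge (p := 1) (0 : R5 [⋀^Fin 1]→L[ℝ] ℝ) (θ.at x) +
      wedge (p := 0) (0 : R5 [⋀^Fin 0]→L[ℝ] ℝ) ((extD θ).at x) +
      wedge (ContinuousAlternatingMap.constOfIsEmpty ℝ R5 (Fin 0) (1 : ℝ)) (Ψ.at x) := by
    rw [h2, h3]
    refine Eq.trans ?_ (congrArg (fun α : R5 [⋀^Fin 2]→L[ℝ] ℝ => 0 + 0 + α) h1).symm
    rw [add_zero, zero_add]
    exact (one_smul ℝ (Ψ.at x)).symm
  exact h4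

omit [IsManifold 𝓘(ℝ, R5) ∞ M] in
theorem MemIdeal.inChart_one {θ : Form M ℝ 1} {Ψ : Form M ℝ 2} {η : Form M ℝ 1}
    (h : MemIdeal U θ Ψ 1 η) {y : R5} (hy : e.symm y ∈ U) :
    ∃ t : ℝ, inChart e η y = t • inChart e θ y := by
  obtain ⟨a, -, ha⟩ := h
  refine ⟨inChart e a y ![], ?_⟩
  have h1 : η.at (e.symm y) = wedge (a.at (e.symm y)) (θ.at (e.symm y)) := ha _ hy
  rw [inChart_eq_comp, h1, inChart_eq_comp]
  refine Eq.trans (wedge_compContinuousLinearMap (a.at (e.symm y)) (θ.at (e.symm y))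
    (chartSymmDeriv e y)) ?_
  exact wedge_zero_one _ _

theorem MemIdeal.inChart_two (he : IsDiffeoChart e) (hU : IsOpen U) {θ : Form M ℝ 1}
    (hθ : SmoothFormOn θ U) {Ψ : Form M ℝ 2} {η : Form M ℝ 2} (h : MemIdeal U θ Ψ 2 η) {y : R5}
    (hy : y ∈ e.target ∩ e.symm ⁻¹' U) :
    ∃ b c : ℝ, ∀ u v, inChart e θ y ![u] = 0 → inChart e θ y ![v] = 0 →
      inChart e η y ![u, v] =
        b * extDeriv (inChart e θ) y ![u, v] + c * inChart e Ψ y ![u, v] := by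
  obtain ⟨a, b, c, -, -, -, habc⟩ := h
  refine ⟨inChart e b y ![], inChart e c y ![], fun u v hu hv => ?_⟩
  have h1 : η.at (e.symm y) = wedge (a.at (e.symm y)) (θ.at (e.symm y)) +
    wedge (b.at (e.symm y)) ((extD θ).at (e.symm y)) + wedge (c.at (e.symm y)) (Ψ.at (e.symm y)) :=
      habc _ hy.2
  have h2 : inChart e η y = wedge (inChart e a y) (inChart e θ y) +
      inChart e b y ![] • inChart e (extD θ) y + inChart e c y ![] • inChart e Ψ y := by
    rw [← wedge_zero_two, ← wedge_zero_two, inChart_eq_comp, h1]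
    simp only [inChart_eq_comp]
    exact congrArg₂ (· + ·) (congrArg₂ (· + ·)
      (wedge_compContinuousLinearMap (a.at (e.symm y)) (θ.at (e.symm y)) (chartSymmDeriv e y))
      (wedge_compContinuousLinearMap (b.at (e.symm y)) ((extD θ).at (e.symm y))
        (chartSymmDeriv e y)))
      (wedge_compContinuousLinearMap (c.at (e.symm y)) (Ψ.at (e.symm y)) (chartSymmDeriv e y))
  rw [h2, ← he.inChart_extD_of_smoothFormOn hU hθ hy]
  simp only [ContinuousAlternatingMap.add_apply, ContinuousAlternatingMap.smul_apply, smul_eq_mul,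
    wedge_one_one, Matrix.cons_val_zero, Matrix.cons_val_one]
  rw [hu, hv]
  ring

/-- The Poincaré–Cartan form θ' ∧ Ψ' is exact, hence closed, and equality of the ideals makes it a
nonvanishing multiple of ρ for every reduced coframing. -/
theorem S₂Vanishes_of_isLocallyEulerLagrange (h : IsLocallyEulerLagrange S) : S₂Vanishes S := by
  intro U hU c r x hx
  obtain ⟨φ, hxφ, hφ, hφ', θ', Ψ', ⟨hθ', hΨ', Λ, β, hΛ, hβ, hEL⟩, hI⟩ := h x
  have he : IsDiffeoChart φ := ⟨hφ, hφ'⟩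
  set W := φ.target ∩ φ.symm ⁻¹' U with hWdef
  have hWt : W ⊆ φ.target := inter_subset_left
  have hW : IsOpen W := φ.symm.isOpen_inter_preimage hU
  have hcf := isCoframing_inChart he hU c
  have hψ := isContactEq_inChart he hU r
  have hθs : ContDiffOn ℝ ∞ θ'.at φ.target := (smoothFormOn_model_iff φ.open_target).1 hθ'.smooth
  have hΨs : ContDiffOn ℝ ∞ Ψ'.at φ.target := (smoothFormOn_model_iff φ.open_target).1 hΨ'
  have hpθ : ∀ y ∈ φ.target, inChart φ (pullback φ θ') y = θ'.at y := fun y hy =>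
    inChart_pullback he θ'.at hy
  have hpΨ : ∀ y ∈ φ.target, inChart φ (pullback φ Ψ') y = Ψ'.at y := fun y hy =>
    inChart_pullback he Ψ'.at hy
  have hpθs : SmoothFormOn (pullback φ θ') φ.source :=
    he.smoothFormOn_pullback φ.open_target hθs fun x hx => ⟨hx, φ.map_source hx⟩
  have hdθ : ∀ y ∈ φ.target, extDeriv (inChart φ (pullback φ θ')) y = extDeriv θ'.at y :=
    fun y hy => Filter.EventuallyEq.extDeriv_eq
      (Filter.eventually_of_mem (φ.open_target.mem_nhds hy) hpθ)
  have hclosed : ∀ y ∈ φ.target, extDeriv (fun z => wedge (θ'.at z) (Ψ'.at z)) y = 0 := by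
    have hξ : ContDiffOn ℝ ∞ (fun z => Λ.at z - wedge (θ'.at z) (β.at z)) φ.target :=
      ((smoothFormOn_model_iff φ.open_target).1 hΛ).sub
        (contDiffOn_wedge (p := 1) (q := 1) hθs ((smoothFormOn_model_iff φ.open_target).1 hβ))
    have h1 : ∀ z ∈ φ.target, wedge (θ'.at z) (Ψ'.at z) =
        extDeriv (fun z => Λ.at z - wedge (θ'.at z) (β.at z)) z := fun z hz => by
      have h2 : wedge (θ'.at z) (Ψ'.at z) =
          Form.at (M := R5) (F := ℝ) (extD fun y => Λ y - wedge (θ' y) (β y)) z := hEL z hz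
      rw [h2]
      exact extD_model (differentiableAt_of_contDiffOn φ.open_target hξ hz)
    intro y hy
    have h2 : (fun z => wedge (θ'.at z) (Ψ'.at z)) =ᶠ[nhds y]
        extDeriv (fun z => Λ.at z - wedge (θ'.at z) (β.at z)) :=
      Filter.eventually_of_mem (φ.open_target.mem_nhds hy) h1
    rw [h2.extDeriv_eq]
    exact extDeriv_extDeriv_apply (contDiffAt_of_contDiffOn φ.open_target hξ hy)
      minSmoothness_two_le
  have hS : ∀ y ∈ φ.target, θ'.at y ≠ 0 := fun y hy h0 => by
    refine hθ'.nondegenerate y hy ?_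
    have : wedge (θ'.at y) (wedge ((extD θ').at y) ((extD θ').at y)) = 0 := by
      rw [h0, zero_wedge]
    exact this
  -- Both inclusions are used: θ' and Ψ' lie in the given ideal, which fixes their shape modulo π⁰,
  -- and Ψ lies in the Euler–Lagrange ideal, which rules out that Ψ' has no Re Ω part.
  have hmem1 := (hI 1 _).2 memIdeal_contact
  have hmem2 := (hI 2 _).2 memIdeal_generator
  have hmem3 := (hI 2 _).1 memIdeal_generator
  have hts : ∀ y ∈ W, ∃ t : ℝ, inChart φ S.θ y = t • inChart φ c.π₀ y := fun y hy =>
    (c.contact_inChart hy).imp fun _ h => h.2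
  have ht : ∀ y ∈ W, ∃ t : ℝ, t ≠ 0 ∧ θ'.at y = t • inChart φ c.π₀ y := by
    intro y hy
    obtain ⟨s, hs⟩ := hmem1.inChart_one (φ.map_target hy.1)
    obtain ⟨t, ht⟩ := hts y hy
    have e1 : θ'.at y = (s * t) • inChart φ c.π₀ y := by
      rw [← hpθ y hy.1, hs, ht, smul_smul]
    refine ⟨s * t, fun h0 => hS y hy.1 ?_, e1⟩
    rw [e1, h0, zero_smul]
  have hθl : ContDiffOn ℝ ∞ (inChart φ S.θ) W :=
    he.contDiffOn_of_smoothFormOn hU (S.contact.smooth.mono (subset_univ _))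
  refine r.S₂_eq_zero he hU hxφ hx (contDiffOn_wedge (p := 1) (q := 2) (hθs.mono hWt)
    (hΨs.mono hWt)) (fun z hz => hclosed z hz.1) fun y hy => ?_
  have hyφ : y ∈ φ.target ∩ φ.symm ⁻¹' φ.source := ⟨hy.1, φ.map_target hy.1⟩
  obtain ⟨b₁, c₁, h₁⟩ := hmem2.inChart_two he φ.open_source (S.contact.smooth.mono (subset_univ _))
    hyφ
  obtain ⟨b₂, c₂, h₂⟩ := hmem3.inChart_two he φ.open_source hpθs hyφ
  obtain ⟨t, ht0⟩ := hts y hy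
  obtain ⟨t', -, ht0'⟩ := ht y hy
  obtain ⟨q, hq, hΨq⟩ := c.psi_inChart hy
  refine wedge_eq_smul_pcLocal_of_closed hcf hψ (hθs.mono hWt) (hΨs.mono hWt) ht hy
    (p := b₁ * t) (q := c₁ * q) (fun u v hu hv => ?_) (b := b₂) (c := c₂) hq (fun u v hu hv => ?_)
    (hclosed y hy.1)
  · rw [← hpΨ y hy.1, h₁ u v (by rw [ht0, ContinuousAlternatingMap.smul_apply, hu, smul_zero])
      (by rw [ht0, ContinuousAlternatingMap.smul_apply, hv, smul_zero]), hΨq u v hu hv,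
      hcf.extDeriv_apply_of_eq_smul hθl hts hy ht0 hu hv, hψ.apply hy, hu, hv]
    ring
  · rw [← hΨq u v hu hv, h₂ u v, hdθ y hy.1, hpΨ y hy.1]
    · rw [hpθ y hy.1, ht0', ContinuousAlternatingMap.smul_apply, hu, smul_zero]
    · rw [hpθ y hy.1, ht0', ContinuousAlternatingMap.smul_apply, hv, smul_zero]

end EulerLagrange

/-! ### From S₂ = 0 to a closed Poincaré–Cartan form -/

section ClosedForm

open Set

variable {M : Type*} [TopologicalSpace M] [ChartedSpace R5 M] [IsManifold 𝓘(ℝ, R5) ∞ M]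
  {S : MongeAmpereSystem M} {e : OpenPartialHomeomorph M R5}

theorem MongeAmpereSystem.contDiffOn_θ (S : MongeAmpereSystem M) (he : IsDiffeoChart e) :
    ContDiffOn ℝ ∞ (inChart e S.θ) e.target :=
  (he.contDiffOn_of_smoothFormOn isOpen_univ S.contact.smooth).mono fun _ hy => ⟨hy, mem_univ _⟩

theorem MongeAmpereSystem.contDiffOn_Ψ (S : MongeAmpereSystem M) (he : IsDiffeoChart e) :
    ContDiffOn ℝ ∞ (inChart e S.Ψ) e.target :=
  (he.contDiffOn_of_smoothFormOn isOpen_univ S.smooth).mono fun _ hy => ⟨hy, mem_univ _⟩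

theorem MongeAmpereSystem.inChart_extD_θ (S : MongeAmpereSystem M) (he : IsDiffeoChart e) {y : R5}
    (hy : y ∈ e.target) : inChart e (extD S.θ) y = extDeriv (inChart e S.θ) y :=
  he.inChart_extD_of_smoothFormOn isOpen_univ S.contact.smooth ⟨hy, mem_univ _⟩

theorem MongeAmpereSystem.nondegenerate_inChart (S : MongeAmpereSystem M) (he : IsDiffeoChart e)
    {y : R5} (hy : y ∈ e.target) : wedge (inChart e S.θ y)
      (wedge (extDeriv (inChart e S.θ) y) (extDeriv (inChart e S.θ) y)) ≠ 0 := by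
  intro h0
  refine S.contact.nondegenerate (e.symm y) (mem_univ _) ?_
  refine (he.eq_iff (η := fun x => wedge (S.θ x) (wedge (extD S.θ x) (extD S.θ x)))
    (ζ := fun _ => 0) (e.map_target hy)).2 ?_
  rw [e.right_inv hy, inChart_wedge e S.θ (fun x => wedge (extD S.θ x) (extD S.θ x)),
    inChart_wedge, S.inChart_extD_θ he hy, h0]
  rfl

theorem MongeAmpereSystem.primitive_inChart (S : MongeAmpereSystem M) (he : IsDiffeoChart e)
    {y : R5} (hy : y ∈ e.target) : ModEq (k := 3) (inChart e S.θ y)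
      (wedge (p := 2) (q := 2) (inChart e S.Ψ y) (extDeriv (inChart e S.θ) y)) 0 := by
  rw [← S.inChart_extD_θ he hy, ← inChart_wedge]
  have h : ModEq (k := 3) (S.θ.at (e.symm y))
    (wedge (p := 2) (q := 2) (S.Ψ.at (e.symm y)) ((extD S.θ).at (e.symm y))) 0 := S.primitive _
  exact h.comp (chartSymmDeriv e y)

theorem MongeAmpereSystem.IsElliptic.inChart (hS : S.IsElliptic) (he : IsDiffeoChart e)
    {y : R5} (hy : y ∈ e.target) : ∃ c : ℝ, 0 < c ∧ ModEq (k := 3) (inChart e S.θ y)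
      (wedge (p := 2) (q := 2) (MongeAmpere.inChart e S.Ψ y) (MongeAmpere.inChart e S.Ψ y))
      (c • wedge (extDeriv (MongeAmpere.inChart e S.θ) y)
        (extDeriv (MongeAmpere.inChart e S.θ) y)) := by
  obtain ⟨c, hc, h⟩ := hS (e.symm y)
  refine ⟨c, hc, ?_⟩
  rw [← S.inChart_extD_θ he hy, ← inChart_wedge, ← inChart_wedge]
  have h' : ModEq (k := 3) (S.θ.at (e.symm y))
    (wedge (p := 2) (q := 2) (S.Ψ.at (e.symm y)) (S.Ψ.at (e.symm y)))
    (c • wedge ((extD S.θ).at (e.symm y)) ((extD S.θ).at (e.symm y))) := h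
  exact h'.comp (chartSymmDeriv e y)

variable {W : Set R5} {π : Fin 2 → R5 → R5 [⋀^Fin 1]→L[ℝ] ℂ} {ψ₀ : R5 → R5 [⋀^Fin 1]→L[ℝ] ℝ}

/-- The adapted coframing defined by a coframing in a chart. -/
def AdaptedCoframing.ofChart (he : IsDiffeoChart e) (hc : IsCoframing W (inChart e S.θ) π)
    (hψ : IsContactEq W (inChart e S.θ) π ψ₀)
    (hμ : ∀ y ∈ W, ∃ μ : ℝ, μ ≠ 0 ∧ ModEq (k := 1) (inChart e S.θ y) (inChart e S.Ψ y)
      (μ • reForm (wedge (π 0 y) (π 1 y)))) :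
    AdaptedCoframing S (e.source ∩ e ⁻¹' W) where
  π₀ := S.θ
  π i := pullback (N := R5) e (π i)
  smooth₀ := S.contact.smooth.mono (subset_univ _)
  smooth i := he.smoothFormOn_pullback hc.isOpen (hc.smooth i) fun _ hx => hx
  coframe x hx v h0 h1 := by
    have key : ∀ u : R5, S.θ.at x (fun _ => u) = 0 →
        (∀ i, (π i (e x)).compContinuousLinearMap (chartDeriv e x) (fun _ => u) = 0) → u = 0 := by
      intro u h0 h1
      have e0 : ![chartDeriv e x u] = fun i => chartDeriv e x ((fun _ => u : Fin 1 → R5) i) := by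
        ext i; fin_cases i; rfl
      have h2 := hc.coframe _ hx.2 (chartDeriv e x u)
        (by rw [he.at_eq_inChart S.θ hx.1] at h0; rw [e0]; exact h0)
        fun i => by rw [e0]; exact h1 i
      have h3 := congrArg (fun L => L u) (he.symm_deriv_comp_deriv hx.1)
      simp only [ContinuousLinearMap.comp_apply, h2, map_zero] at h3
      exact h3.symm
    exact key v h0 h1
  contact x _ := ⟨1, one_ne_zero, (one_smul ℝ (S.θ.at x)).symm⟩
  dcontact x hx := by
    have h : ModEq (k := 1) (inChart e S.θ (e x)) (extDeriv (inChart e S.θ) (e x))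
        (imForm (wedge (π 0 (e x)) (π 1 (e x)))) :=
      ⟨-ψ₀ (e x), by rw [hψ.eq _ hx.2, wedge_neg_left]; abel⟩
    have h' := h.comp (chartDeriv e x)
    rw [← he.at_eq_inChart S.θ hx.1, ← S.inChart_extD_θ he (e.map_source hx.1),
      ← he.at_eq_inChart _ hx.1] at h'
    have h2 : (imForm (wedge (π 0 (e x)) (π 1 (e x)))).compContinuousLinearMap (chartDeriv e x) =
      imForm (wedge ((π 0 (e x)).compContinuousLinearMap (chartDeriv e x))
        ((π 1 (e x)).compContinuousLinearMap (chartDeriv e x))) := by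
      rw [← wedge_compContinuousLinearMap]; rfl
    rw [h2] at h'
    exact h'
  psi x hx := by
    obtain ⟨μ, hμ0, h⟩ := hμ _ hx.2
    refine ⟨μ, hμ0, ?_⟩
    have h' := h.comp (chartDeriv e x)
    rw [← he.at_eq_inChart S.θ hx.1, ← he.at_eq_inChart S.Ψ hx.1] at h'
    have h2 : (μ • reForm (wedge (π 0 (e x)) (π 1 (e x)))).compContinuousLinearMap
        (chartDeriv e x) = μ • reForm (wedge ((π 0 (e x)).compContinuousLinearMap (chartDeriv e x))
        ((π 1 (e x)).compContinuousLinearMap (chartDeriv e x))) := by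
      rw [← wedge_compContinuousLinearMap]; rfl
    rw [h2] at h'
    exact h'

/-- The reduced structure equations in a chart give those of the adapted coframing. -/
def ReducedStructure.ofChart (he : IsDiffeoChart e) (hc : IsCoframing W (inChart e S.θ) π)
    (hψ : IsContactEq W (inChart e S.θ) π ψ₀)
    (hμ : ∀ y ∈ W, ∃ μ : ℝ, μ ≠ 0 ∧ ModEq (k := 1) (inChart e S.θ y) (inChart e S.Ψ y)
      (μ • reForm (wedge (π 0 y) (π 1 y))))
    {ψ : Fin 2 → Fin 2 → R5 → R5 [⋀^Fin 1]→L[ℝ] ℂ} {P : R5 → Matrix (Fin 2) (Fin 2) ℂ}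
    (hψs : ∀ i j, ContDiffOn ℝ ∞ (ψ i j) W) (hPs : ∀ i j, ContDiffOn ℝ ∞ (fun y => P y i j) W)
    (hr : ∀ y ∈ W, IsReducedAt (inChart e S.θ) π ψ₀ (fun i j => ψ i j y) (P y) y) :
    ReducedStructure (AdaptedCoframing.ofChart he hc hψ hμ) where
  ψ₀ := pullback (N := R5) e ψ₀
  ψ i j := pullback (N := R5) e (ψ i j)
  P x := P (e x)
  smooth₀ := he.smoothFormOn_pullback hc.isOpen hψ.smooth fun _ hx => hx
  smooth i j := he.smoothFormOn_pullback hc.isOpen (hψs i j) fun _ hx => hx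
  smoothP i j := he.contMDiffOn_comp (hPs i j) fun _ hx => hx
  trace x hx := congrArg (fun α => α.compContinuousLinearMap (chartDeriv e x)) (hr _ hx.2).trace
  eq₀ x hx := by
    have h := congrArg (fun α => α.compContinuousLinearMap (chartDeriv e x)) (hψ.eq _ hx.2)
    rw [← S.inChart_extD_θ he (e.map_source hx.1), ← he.at_eq_inChart _ hx.1] at h
    have h2 : (-wedge (ψ₀ (e x)) (inChart e S.θ (e x)) +
        imForm (wedge (π 0 (e x)) (π 1 (e x)))).compContinuousLinearMap (chartDeriv e x) =
      -wedge ((ψ₀ (e x)).compContinuousLinearMap (chartDeriv e x)) (S.θ.at x) +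
      imForm (wedge ((π 0 (e x)).compContinuousLinearMap (chartDeriv e x))
        ((π 1 (e x)).compContinuousLinearMap (chartDeriv e x))) := by
      rw [he.at_eq_inChart S.θ hx.1, ← wedge_compContinuousLinearMap,
        ← wedge_compContinuousLinearMap]; rfl
    rw [h2] at h
    exact h
  eq x hx i := by
    have hy : e x ∈ W ∩ e.target := ⟨hx.2, e.map_source hx.1⟩
    have h := congrArg (fun α => α.compContinuousLinearMap (chartDeriv e x)) ((hr _ hx.2).eq i)
    have hpb : ∀ z ∈ W ∩ e.target, inChart e (pullback (N := R5) e (π i) : Form M ℂ 1) z = π i z :=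
      fun z hz => inChart_pullback he (π i) hz.2
    have ho : IsOpen (W ∩ e.target) := hc.isOpen.inter e.open_target
    have hd : inChart e (extD (pullback (N := R5) e (π i) : Form M ℂ 1)) (e x) =
        extDeriv (π i) (e x) := by
      rw [he.inChart_extD hy.2 (differentiableAt_of_eqOn ho ((hc.smooth i).mono inter_subset_left)
        hpb hy)]
      exact Filter.EventuallyEq.extDeriv_eq (Filter.eventually_of_mem (ho.mem_nhds hy) hpb)
    rw [← hd, ← he.at_eq_inChart _ hx.1] at h
    have h2 : (-(∑ j, wedge (ψ i j (e x)) (π j (e x))) - ∑ j, P (e x) i j • wedge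
        (conjForm (π j (e x))) (ofRealForm (inChart e S.θ (e x)))).compContinuousLinearMap
          (chartDeriv e x) =
      -(∑ j, wedge ((ψ i j (e x)).compContinuousLinearMap (chartDeriv e x))
        ((π j (e x)).compContinuousLinearMap (chartDeriv e x))) - ∑ j, P (e x) i j • wedge
        (conjForm ((π j (e x)).compContinuousLinearMap (chartDeriv e x)))
          (ofRealForm (S.θ.at x)) := by
      have e1 : ∀ α : R5 [⋀^Fin 1]→L[ℝ] ℂ, conjForm (α.compContinuousLinearMap (chartDeriv e x)) =
        (conjForm α).compContinuousLinearMap (chartDeriv e x) := fun α => rfl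
      have e2 : ∀ α : R5 [⋀^Fin 1]→L[ℝ] ℝ,
        ofRealForm (α.compContinuousLinearMap (chartDeriv e x)) =
        (ofRealForm α).compContinuousLinearMap (chartDeriv e x) := fun α => rfl
      simp only [he.at_eq_inChart S.θ hx.1, e1, e2, ← wedge_compContinuousLinearMap,
        Fin.sum_univ_two]
      rfl
    rw [h2] at h
    exact h

theorem hasClosedPCForm_of_S₂Vanishes (hS : S.IsElliptic) (h : S₂Vanishes S) :
    HasClosedPCForm S := by
  intro x
  set e := chartAt R5 x with hedef
  have he : IsDiffeoChart e := .chartAt x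
  have hxe : x ∈ e.source := mem_chart_source R5 x
  obtain ⟨W, π, ψ₀, ψ, P, hWt, hxW, hc, hψ, hψs, hPs, hr, hμ⟩ := exists_reduced_coframing
    e.open_target (S.contDiffOn_θ he) (S.contDiffOn_Ψ he)
    (fun y hy => S.nondegenerate_inChart he hy) (fun y hy => S.primitive_inChart he hy)
    (fun y hy => hS.inChart he hy) (e.map_source hxe)
  let c := AdaptedCoframing.ofChart he hc hψ hμ
  let r : ReducedStructure c := ReducedStructure.ofChart he hc hψ hμ hψs hPs hr
  have hS₂ : ∀ y ∈ W, S₂ (P y) = 0 := fun y hy => by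
    have e1 := e.right_inv (hWt hy)
    have h1 := h _ (e.isOpen_inter_preimage hc.isOpen) c r (e.symm y)
      ⟨e.map_target (hWt hy), by rw [mem_preimage, e1]; exact hy⟩
    have h2 : r.P (e.symm y) = P (e (e.symm y)) := rfl
    rwa [h2, e1] at h1
  obtain ⟨ρ, hρ, hB, l, hls, hl, hd⟩ := exists_closed_pcLocal hc hψ
    (fun y hy => ⟨_, _, hr y hy, hS₂ y hy⟩) hxW
  -- Writing ρ = g θ ∧ Ψ exhibits lρ as an element of the ideal: its Ψ-coefficient is l g θ and the
  -- other two coefficients are 0.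
  obtain ⟨g, hgs, hg⟩ := hc.exists_pcLocal_eq_smul hc.smooth₀ ((S.contDiffOn_Ψ he).mono hWt)
    (fun y _ => ⟨1, one_ne_zero, (one_smul _ _).symm⟩)
    (fun y hy => by
      obtain ⟨μ, hμ0, hmod⟩ := hμ y hy
      exact ⟨μ, hμ0, fun u v hu hv => hmod.apply_eq_of_ker (w := ![u, v]) fun i => by
        fin_cases i <;> assumption⟩)
  set B := Metric.ball (e x) ρ with hBdef
  have hV : e.source ∩ e ⁻¹' B ⊆ e.source ∩ e ⁻¹' W := inter_subset_inter_right _ (preimage_mono hB)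
  have hpc : ∀ y ∈ B, inChart e (pcForm (c.restrict hV) (fun x => l (e x))) y =
      l y • pcLocal (inChart e S.θ) π y := fun y hy => by
    have e1 : ∀ i, inChart e (pullback (N := R5) e (π i) : Form M ℂ 1) y = π i y := fun i =>
      inChart_pullback he (π i) (hWt (hB hy))
    rw [pcForm_inChart, e.right_inv (hWt (hB hy))]
    change l y • wedge (inChart e S.θ y) (reForm (wedge
      (inChart e (pullback (N := R5) e (π 0) : Form M ℂ 1) y)
      (inChart e (pullback (N := R5) e (π 1) : Form M ℂ 1) y))) = _
    rw [e1, e1]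
    rfl
  have hlp : ContDiffOn ℝ ∞ (fun y => l y • pcLocal (inChart e S.θ) π y) B :=
    hls.smul (hc.contDiffOn_pcLocal.mono hB)
  refine ⟨e.source ∩ e ⁻¹' B, e.isOpen_inter_preimage Metric.isOpen_ball,
    ⟨hxe, Metric.mem_ball_self hρ⟩, c.restrict hV, fun x => l (e x), ⟨r.restrict hV⟩,
    ⟨he.contMDiffOn_comp hls fun _ hx => hx, fun x _ => hl _, ?_, fun z hz => ?_⟩⟩
  · refine ⟨_, _, pullback (N := R5) e fun y => (l y * g y) • inChart e S.θ y, smoothFormOn_zero,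
      smoothFormOn_zero, he.smoothFormOn_pullback Metric.isOpen_ball
        ((hls.mul (hgs.mono hB)).smul (hc.smooth₀.mono hB)) fun _ hx => hx, fun z hz => ?_⟩
    have h1 : (pcForm (c.restrict hV) (fun x => l (e x))).at z =
        wedge (((l (e z) * g (e z)) • inChart e S.θ (e z)).compContinuousLinearMap (chartDeriv e z))
          (S.Ψ.at z) := by
      rw [he.at_eq_inChart _ hz.1, he.at_eq_inChart S.Ψ hz.1, ← wedge_compContinuousLinearMap,
        hpc _ hz.2, (hg _ (hB hz.2)).2, wedge_smul_left, mul_smul]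
    have h2 : wedge (p := 2) (0 : R5 [⋀^Fin 2]→L[ℝ] ℝ) (S.θ.at z) = 0 := zero_wedge _
    have h3 : wedge (p := 1) (0 : R5 [⋀^Fin 1]→L[ℝ] ℝ) ((extD S.θ).at z) = 0 := zero_wedge _
    have h4 : (pcForm (c.restrict hV) (fun x => l (e x))).at z =
        wedge (p := 2) (0 : R5 [⋀^Fin 2]→L[ℝ] ℝ) (S.θ.at z) +
        wedge (p := 1) (0 : R5 [⋀^Fin 1]→L[ℝ] ℝ) ((extD S.θ).at z) +
        wedge (((l (e z) * g (e z)) • inChart e S.θ (e z)).compContinuousLinearMap (chartDeriv e z))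
          (S.Ψ.at z) := by
      rw [h2, h3, h1, add_zero]
      exact (zero_add _).symm
    exact h4
  · refine (he.eq_iff (ζ := fun _ => 0) hz.1).2 ?_
    have hev := Filter.eventually_of_mem (Metric.isOpen_ball.mem_nhds hz.2) hpc
    rw [he.inChart_extD (e.map_source hz.1) (differentiableAt_of_eqOn Metric.isOpen_ball hlp hpc
      hz.2), Filter.EventuallyEq.extDeriv_eq hev, hd _ hz.2]
    rfl

end ClosedForm

/-! ### From a closed Poincaré–Cartan form to an Euler–Lagrange system -/

section ToEulerLagrange

open Set

variable {M : Type*} [TopologicalSpace M] [ChartedSpace R5 M]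
  {S : MongeAmpereSystem M} {U : Set M} {e : OpenPartialHomeomorph M R5}

theorem extD_congr {F : Type*} [NormedAddCommGroup F] [NormedSpace ℝ F] {k : ℕ} {η ζ : Form M F k}
    (hU : IsOpen U) (h : ∀ x ∈ U, η x = ζ x) {x : M} (hx : x ∈ U) : extD η x = extD ζ x := by
  have ho := (chartAt R5 x).symm.isOpen_inter_preimage hU
  have hy : chartAt R5 x x ∈ (chartAt R5 x).target ∩ (chartAt R5 x).symm ⁻¹' U :=
    ⟨mem_chart_target R5 x, by
      rw [mem_preimage, (chartAt R5 x).left_inv (mem_chart_source R5 x)]; exact hx⟩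
  have e1 : inChart (chartAt R5 x) η =ᶠ[nhds (chartAt R5 x x)] inChart (chartAt R5 x) ζ := by
    filter_upwards [ho.mem_nhds hy] with z hz
    have h1 : η.at ((chartAt R5 x).symm z) = ζ.at ((chartAt R5 x).symm z) := h _ hz.2
    rw [inChart_eq_comp, inChart_eq_comp, h1]
  simp only [extD]
  rw [e1.extDeriv_eq]

variable [IsManifold 𝓘(ℝ, R5) ∞ M]

theorem IsDiffeoChart.smoothFormOn_smul (he : IsDiffeoChart e) (hU : IsOpen U) {k : ℕ}
    {η : Form M ℝ k} (hη : SmoothFormOn η U) {g : R5 → ℝ} {V : Set R5} (hV : IsOpen V)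
    (hg : ContDiffOn ℝ ∞ g V) (hUV : ∀ x ∈ U, x ∈ e.source ∧ e x ∈ V) :
    SmoothFormOn (fun x => g (e x) • η x) U := by
  have ho : IsOpen (e.target ∩ e.symm ⁻¹' U) := e.symm.isOpen_inter_preimage hU
  refine he.smoothFormOn (ho.inter hV) ((hg.mono inter_subset_right).smul
    ((he.contDiffOn_of_smoothFormOn hU hη).mono inter_subset_left)) (fun y hy => ?_)
    fun x hx => ⟨(hUV x hx).1, ⟨e.map_source (hUV x hx).1, ?_⟩, (hUV x hx).2⟩
  · have : inChart e (fun x => g (e x) • η x) y = g (e (e.symm y)) • inChart e η y := rfl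
    rw [this, e.right_inv hy.1.1]
    rfl
  · rw [mem_preimage, e.left_inv (hUV x hx).1]
    exact hx

/-- Rescaling the generator `Ψ` does not enlarge the ideal. -/
theorem MemIdeal.of_smul (he : IsDiffeoChart e) (hU : IsOpen U) {θ θ' : Form M ℝ 1}
    {Ψ Ψ' : Form M ℝ 2} (hθ : ∀ x ∈ U, θ x = θ' x) {g : R5 → ℝ} {V : Set R5} (hV : IsOpen V)
    (hg : ContDiffOn ℝ ∞ g V) (hUV : ∀ x ∈ U, x ∈ e.source ∧ e x ∈ V)
    (hΨ : ∀ x ∈ U, Ψ x = g (e x) • Ψ' x) {k : ℕ} {η : Form M ℝ k} (h : MemIdeal U θ Ψ k η) :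
    MemIdeal U θ' Ψ' k η := by
  match k, η, h with
  | 0, η, h => exact h
  | 1, η, ⟨a, ha, h⟩ => exact ⟨a, ha, fun x hx => by rw [h x hx, hθ x hx]⟩
  | k + 2, η, ⟨a, b, c, ha, hb, hc, h⟩ =>
    refine ⟨a, b, fun x => g (e x) • c x, ha, hb, he.smoothFormOn_smul hU hc hV hg hUV,
      fun x hx => ?_⟩
    rw [h x hx, hθ x hx, extD_congr hU hθ hx, hΨ x hx, wedge_smul_right, wedge_smul_left]

/-- In a chart λρ = θ ∧ HΨ with H nowhere zero. Replacing Ψ by HΨ keeps the ideal, and the closed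
form θ ∧ HΨ has a primitive Λ on a ball, so it is the Poincaré–Cartan form of Λ with β = 0. -/
theorem isLocallyEulerLagrange_of_hasClosedPCForm (h : HasClosedPCForm S) :
    IsLocallyEulerLagrange S := by
  intro x
  obtain ⟨U, hU, hxU, c, l, -, hl⟩ := h x
  set e := chartAt R5 x with hedef
  have he : IsDiffeoChart e := .chartAt x
  have hxe : x ∈ e.source := mem_chart_source R5 x
  have hcf := isCoframing_inChart he hU c
  have hWt : e.target ∩ e.symm ⁻¹' U ⊆ e.target := inter_subset_left
  obtain ⟨g, hgs, hg⟩ := hcf.exists_pcLocal_eq_smul ((S.contDiffOn_θ he).mono hWt)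
    ((S.contDiffOn_Ψ he).mono hWt) (fun y hy => c.contact_inChart hy) fun y hy => c.psi_inChart hy
  let H : R5 → ℝ := fun y => l (e.symm y) * g y
  have hHs : ContDiffOn ℝ ∞ H (e.target ∩ e.symm ⁻¹' U) :=
    (he.contDiffOn_comp_symm hl.smooth).mul hgs
  have hH : ∀ y ∈ e.target ∩ e.symm ⁻¹' U, H y ≠ 0 := fun y hy =>
    mul_ne_zero (hl.pos _ hy.2).ne' (hg y hy).1
  obtain ⟨ρ, hρ, hB⟩ := Metric.isOpen_iff.1 hcf.isOpen (e x)
    ⟨e.map_source hxe, by rw [mem_preimage, e.left_inv hxe]; exact hxU⟩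
  set B := Metric.ball (e x) ρ with hBdef
  have hBo : IsOpen B := Metric.isOpen_ball
  have hBt : B ⊆ e.target := hB.trans hWt
  have hV : IsOpen (e.source ∩ e ⁻¹' B) := e.isOpen_inter_preimage hBo
  -- The chart is cut down to a ball, where the Poincaré lemma supplies Λ.
  let φ : OpenPartialHomeomorph M R5 := e.restrOpen (e.source ∩ e ⁻¹' B) hV
  have hφs : ∀ z ∈ φ.source, z ∈ e.source ∧ e z ∈ B := fun z hz => hz.2
  have hφt : ∀ y ∈ φ.target, y ∈ B := fun y hy => by
    have h1 : e (e.symm y) ∈ B := hy.2.2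
    rwa [e.right_inv hy.1] at h1
  let Ψ' : R5 → R5 [⋀^Fin 2]→L[ℝ] ℝ := fun y => H y • inChart e S.Ψ y
  have hθs : ContDiffOn ℝ ∞ (inChart e S.θ) B := (S.contDiffOn_θ he).mono hBt
  have hΨs : ContDiffOn ℝ ∞ Ψ' B := (hHs.mono hB).smul ((S.contDiffOn_Ψ he).mono hBt)
  have hpc : ∀ y ∈ B, inChart e (pcForm c l) y = wedge (inChart e S.θ y) (Ψ' y) := fun y hy => by
    rw [pcForm_inChart, (hg y (hB hy)).2, wedge_smul_right, smul_smul]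
  have hη : ContDiffOn ℝ ∞ (fun y => wedge (inChart e S.θ y) (Ψ' y)) B :=
    contDiffOn_wedge (p := 1) (q := 2) hθs hΨs
  have hclosed : ∀ y ∈ B, extDeriv (fun y => wedge (inChart e S.θ y) (Ψ' y)) y = 0 := fun y hy => by
    have h1 : (extD (pcForm c l)).at (e.symm y) = 0 := hl.closed _ (hB hy).2
    rw [← Filter.EventuallyEq.extDeriv_eq (Filter.eventually_of_mem (hBo.mem_nhds hy) hpc),
      ← he.inChart_extD (hBt hy) (differentiableAt_of_eqOn hBo hη hpc hy), inChart_eq_comp, h1]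
    rfl
  obtain ⟨Λ, hΛs, hΛ⟩ := exists_extDeriv_eq (k := 2) hη hclosed
  have hθp : ∀ z ∈ φ.source, S.θ z = pullback (N := R5) φ (inChart e S.θ) z := fun z hz =>
    he.at_eq_inChart S.θ (hφs z hz).1
  have hΨp : ∀ z ∈ φ.source, pullback (N := R5) φ Ψ' z = H (e z) • S.Ψ z := fun z hz => by
    have h1 := congrArg (fun α => H (e z) • α) (he.at_eq_inChart S.Ψ (hφs z hz).1)
    exact h1.symm
  have hΨp' : ∀ z ∈ φ.source, S.Ψ z = (fun y => (H y)⁻¹) (e z) • pullback (N := R5) φ Ψ' z :=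
    fun z hz => by
      rw [hΨp z hz, smul_smul, inv_mul_cancel₀ (hH _ (hB (hφs z hz).2)), one_smul]
  refine ⟨φ, ⟨hxe, hxe, Metric.mem_ball_self hρ⟩, he.contMDiffOn.mono fun z hz => (hφs z hz).1,
    he.contMDiffOn_symm.mono fun y hy => hBt (hφt y hy), inChart e S.θ, Ψ',
    ⟨⟨(smoothFormOn_model_iff φ.open_target).2 (hθs.mono hφt), fun y hy => ?_⟩,
      (smoothFormOn_model_iff φ.open_target).2 (hΨs.mono hφt), Λ, fun _ => 0,
      (smoothFormOn_model_iff φ.open_target).2 (hΛs.mono hφt), smoothFormOn_zero, fun y hy => ?_⟩,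
    fun k η => ⟨fun hm => ?_, fun hm => ?_⟩⟩
  · have h1 : (extD (M := R5) (inChart e S.θ)) y = extDeriv (inChart e S.θ) y :=
      extD_model (η := inChart e S.θ) (differentiableAt_of_contDiffOn hBo hθs (hφt y hy))
    rw [h1]
    exact S.nondegenerate_inChart he (hBt (hφt y hy))
  · have h1 : (fun y => Λ y - wedge (inChart e S.θ y) (0 : R5 [⋀^Fin 1]→L[ℝ] ℝ)) = Λ := by
      funext y
      rw [wedge_zero_right]
      exact sub_zero _
    have h2 : (extD (M := R5) Λ) y = extDeriv Λ y :=
      extD_model (η := Λ) (differentiableAt_of_contDiffOn hBo hΛs (hφt y hy))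
    have h3 : wedge (inChart e S.θ y) (Ψ' y) = extD (M := R5) (F := ℝ) (k := 2)
        (fun y => Λ y - wedge (inChart e S.θ y) (0 : R5 [⋀^Fin 1]→L[ℝ] ℝ)) y := by
      rw [← hΛ y (hφt y hy), ← h2]
      exact (congrArg (fun α : Form R5 ℝ 2 => extD α y) h1).symm
    exact h3
  · exact hm.of_smul he φ.open_source hθp hBo ((hHs.mono hB).inv fun y hy => hH y (hB hy)) hφs hΨp'
  · exact hm.of_smul he φ.open_source (fun z hz => (hθp z hz).symm) hBo (hHs.mono hB) hφs hΨp

end ToEulerLagrange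

end MongeAmpere

end

theorem theorem3p3 {M : Type*} [TopologicalSpace M] [ChartedSpace MongeAmpere.R5 M]
    [IsManifold (modelWithCornersSelf ℝ MongeAmpere.R5) ∞ M]
    (S : MongeAmpere.MongeAmpereSystem M) (hS : S.IsElliptic) :
    (MongeAmpere.S₂Vanishes S ↔ MongeAmpere.IsLocallyEulerLagrange S) ∧
    (MongeAmpere.S₂Vanishes S ↔ MongeAmpere.HasClosedPCForm S) := by
  refine ⟨⟨fun h => ?_, MongeAmpere.S₂Vanishes_of_isLocallyEulerLagrange⟩,
    MongeAmpere.hasClosedPCForm_of_S₂Vanishes hS, MongeAmpere.S₂Vanishes_of_hasClosedPCForm⟩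
  exact MongeAmpere.isLocallyEulerLagrange_of_hasClosedPCForm
    (MongeAmpere.hasClosedPCForm_of_S₂Vanishes hS h)
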